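/- Let \(B=\mathbb{R}^{0|s}\) be a superpoint and let \(M\to B\) be a supermanifold over \(B\) of relative dimension \(m|n\) with Hausdorff underlying space. For a superpoint \(C_B\colon C\to B\) over \(B\), let \(\underline{M}(C_B)\) be the manifold of \(C_B\)-points of \(M\), that is, of maps \(C\to M\) over \(B\). For a \(B\)-point \(p\colon B\to M\) let \(\underline{\Gamma_p(TM)}\) be the functor \(C_B\mapsto(\Gamma(p^*TM)\otimes_{\mathcal{O}_B}\mathcal{O}_C)_0\) of even tangent vectors at \(p\). Let \(g\) be a Riemannian metric on \(M\), i.e. an even, (super)symmetric, non-degenerate \(\mathcal{O}_M\)-bilinear form on \(TM\) whose reduction is positive definite. Then \(M\) has a Levi-Civita connection \(\nabla\) (torsion free and with \(\nabla g=0\)), and with respect to it the following holds for every \(B\)-point \(p\) of \(M\). 1. For every superpoint \(C_B\colon C\to B\) and every \(v\in\underline{\Gamma_p(TM)}(C_B)\) there are \(T>0\) and a unique map \(\gamma_{p,v}\colon(-T,T)\times C\to M\times_B C\) over \(C\) such that \[\nabla_{\partial_t}d\gamma_{p,v}(\partial_t)=0,\qquad \gamma_{p,v}(0)=p\circ C_B,\qquad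 d\gamma_{p,v}(\partial_t)|_{t=0}=v.\] Moreover, on every open interval \(I\ni 0\) there is at most one map \(I\times C\to M\times_B C\) over \(C\) with these properties, and there is one if and only if the geodesic with the reduced initial data (the case \(C=\mathbb{R}^{0|0}\), with \(p\) and \(v\) replaced by their reductions) is defined on \(I\). 2. There is an open subfunctor \(\underline{U}\subset\underline{\Gamma_p(TM)}\) containing the zero vector such that for all \(C_B\) and all \(v\in\underline{U}(C_B)\) the geodesic \(\gamma_{p,v}\) is defined on an open interval containing \([-1,1]\), and such that \(\underline{\exp_p}\colon\underline{U}\to\underline{M}\), \(v\mapsto\gamma_{p,v}(1)\), is a morphism of supermanifolds. There is an open subfunctor \(\underline{U}'\subset\underline{U}\) containing the zero vector such that \(\underline{\exp_p}\) restricts to an isomorphism of supermanifolds from \(\underline{U}'\) onto an open subfunctor of \(\underline{M}\) around \(p\). -/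

import Mathlib

open CategoryTheory Set Filter
open scoped Topology ContDiff

universe u

noncomputable section

namespace SuperGeometry

/-! ## Grassmann algebras and superpoints -/

/-- The real Grassmann algebra in `r` odd generators: the functions on the superpoint
`ℝ^{0|r}`. -/
abbrev Grassmann (r : ℕ) : Type := ExteriorAlgebra ℝ (Fin r → ℝ)

/-- The monomial basis of the Grassmann algebra. -/
def grassmannBasis (r : ℕ) : Module.Basis (Finset (Fin r)) ℝ (Grassmann r) :=
  (Pi.basisFun ℝ (Fin r)).ExteriorAlgebra

instance (r : ℕ) : Module.Finite ℝ (Grassmann r) := Module.Finite.of_basis (grassmannBasis r)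

/-- The norm is the maximum of the absolute values of the coefficients; only the topology and the
smooth structure of the finite dimensional space matter. -/
instance (r : ℕ) : NormedAddCommGroup (Grassmann r) :=
  NormedAddCommGroup.induced (Grassmann r) (Finset (Fin r) → ℝ) (grassmannBasis r).equivFun
    (grassmannBasis r).equivFun.injective

instance (r : ℕ) : NormedSpace ℝ (Grassmann r) :=
  NormedSpace.induced ℝ (Grassmann r) (Finset (Fin r) → ℝ) (grassmannBasis r).equivFun

/-- The homogeneous part of parity `i` (`0`: even, `1`: odd) of the Grassmann algebra. -/
abbrev part (i : ZMod 2) (r : ℕ) : Submodule ℝ (Grassmann r) :=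
  CliffordAlgebra.evenOdd (0 : QuadraticForm ℝ (Fin r → ℝ)) i

/-- The body (the coefficient of `1`) of an element of the Grassmann algebra. -/
abbrev body {r : ℕ} : Grassmann r →ₐ[ℝ] ℝ := ExteriorAlgebra.algebraMapInv

/-- Parity preserving homomorphisms of Grassmann algebras. -/
def IsParityPreserving {r r' : ℕ} (f : Grassmann r →ₐ[ℝ] Grassmann r') : Prop :=
  ∀ (i : ZMod 2) (x : Grassmann r), x ∈ part i r → f x ∈ part i r'

/-- A superpoint `C` over the superpoint `B = ℝ^{0|s}`: the superpoint `C = ℝ^{0|r}` together with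
a map `C → B`, that is, a parity preserving homomorphism `𝒪_B → 𝒪_C`. -/
structure SPoint (s : ℕ) where
  /-- the number of odd generators of `𝒪_C` -/
  r : ℕ
  /-- the homomorphism `𝒪_B → 𝒪_C` -/
  str : Grassmann s →ₐ[ℝ] Grassmann r
  str_parity : IsParityPreserving str

/-- A morphism `C ⟶ D` is a parity preserving homomorphism `𝒪_C → 𝒪_D` over `𝒪_B`, that is, a map
of superpoints from `D` to `C` over `B`. -/
@[ext] structure SPoint.Hom {s : ℕ} (C D : SPoint s) where
  /-- the homomorphism `𝒪_C → 𝒪_D` -/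
  alg : Grassmann C.r →ₐ[ℝ] Grassmann D.r
  parity : IsParityPreserving alg
  str_comm : alg.comp C.str = D.str

/-- With these morphisms `SPoint s` is the *opposite* of the category of superpoints over
`B = ℝ^{0|s}`. -/
instance (s : ℕ) : Category (SPoint s) where
  Hom := SPoint.Hom
  id C := ⟨AlgHom.id ℝ _, fun _ _ h => h, AlgHom.id_comp _⟩
  comp f g := ⟨g.alg.comp f.alg, fun i x h => g.parity i _ (f.parity i x h), by
    rw [AlgHom.comp_assoc, f.str_comm, g.str_comm]⟩

/-- The reduction `ℝ → 𝒪_C` composed with the body map. -/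
def bodyHom (r r' : ℕ) : Grassmann r →ₐ[ℝ] Grassmann r' :=
  (Algebra.ofId ℝ (Grassmann r')).comp body

lemma body_odd {r : ℕ} {x : Grassmann r} (h : x ∈ part 1 r) : body x = 0 := by
  induction x, h using CliffordAlgebra.odd_induction with
  | ι v => exact ExteriorAlgebra.lift_ι_apply ℝ _ _ v
  | add x y hx hy ihx ihy => rw [map_add, ihx, ihy, add_zero]
  | ι_mul_ι_mul a b x hx ih => rw [map_mul, ih, mul_zero]

lemma bodyHom_parity (r r' : ℕ) : IsParityPreserving (bodyHom r r') := by
  intro i x hx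
  have h01 : i = 0 ∨ i = 1 := by clear hx; revert i; decide
  rcases h01 with rfl | rfl
  · exact SetLike.algebraMap_mem_graded
      (CliffordAlgebra.evenOdd (0 : QuadraticForm ℝ (Fin r' → ℝ))) (body x)
  · have : bodyHom r r' x = 0 := by simp [bodyHom, body_odd hx]
    rw [this]
    exact zero_mem _

/-- The superpoint `id : B → B`. -/
def SPoint.base (s : ℕ) : SPoint s := ⟨s, AlgHom.id ℝ _, fun _ _ h => h⟩

/-- The superpoint `ℝ^{0|0} → B`. -/
def SPoint.pt (s : ℕ) : SPoint s := ⟨0, bodyHom s 0, bodyHom_parity s 0⟩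

/-- The map of superpoints `C_B : C → B`. -/
def SPoint.fromBase {s : ℕ} (C : SPoint s) : SPoint.base s ⟶ C :=
  SPoint.Hom.mk (C := SPoint.base s) C.str C.str_parity (AlgHom.comp_id _)

/-- The inclusion `ℝ^{0|0} → C` of the reduced point. -/
def SPoint.toPt {s : ℕ} (C : SPoint s) : C ⟶ SPoint.pt s :=
  SPoint.Hom.mk (D := SPoint.pt s) (bodyHom C.r 0) (bodyHom_parity C.r 0) (by
    have h : (body (r := C.r)).comp C.str = body := by
      apply ExteriorAlgebra.hom_ext
      ext i
      have h1 : C.str (ExteriorAlgebra.ι ℝ (Pi.single i 1)) ∈ part 1 C.r :=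
        C.str_parity 1 _ (CliffordAlgebra.ι_mem_evenOdd_one _ _)
      have h2 : body (ExteriorAlgebra.ι ℝ (Pi.single i (1 : ℝ))) = 0 :=
        body_odd (CliffordAlgebra.ι_mem_evenOdd_one _ _)
      simp only [AlgHom.comp_toLinearMap, LinearMap.comp_apply, AlgHom.toLinearMap_apply,
        LinearMap.single_apply]
      rw [body_odd h1, h2]
    change ((Algebra.ofId ℝ (Grassmann 0)).comp body).comp C.str = _
    rw [AlgHom.comp_assoc, h]
    rfl)

/-! ## The superspace `ℝ^{m|n}` and supersmooth maps -/

/-- The `C`-points of `ℝ^{m|n}`: `m` even and `n` odd elements of `𝒪_C`. -/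
abbrev Pts {s : ℕ} (m n : ℕ) (C : SPoint s) : Type :=
  (Fin m → part 0 C.r) × (Fin n → part 1 C.r)

namespace Pts

variable {s m n : ℕ}

/-- The restriction of a homomorphism of Grassmann algebras to a homogeneous part. -/
def partMap {C D : SPoint s} (f : C ⟶ D) (i : ZMod 2) : part i C.r →ₗ[ℝ] part i D.r :=
  (SPoint.Hom.alg f).toLinearMap.restrict (SPoint.Hom.parity f i)

/-- The functor `ℝ^{m|n}` on morphisms of superpoints. -/
def map {C D : SPoint s} (f : C ⟶ D) : Pts m n C →L[ℝ] Pts m n D :=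
  LinearMap.toContinuousLinearMap
    (LinearMap.prodMap ((partMap f 0).compLeft (Fin m)) ((partMap f 1).compLeft (Fin n)))

/-- Multiplication of an even vector by an even element of `𝒪_C`. -/
def esmul {C : SPoint s} (a : part 0 C.r) (v : Pts m n C) : Pts m n C :=
  (fun i => ⟨a * v.1 i, by
      simpa using SetLike.GradedMul.mul_mem a.2 (v.1 i).2⟩,
   fun i => ⟨a * v.2 i, by
      simpa using SetLike.GradedMul.mul_mem a.2 (v.2 i).2⟩)

/-- The underlying point of `ℝ^m` of a `C`-point of `ℝ^{m|n}`. -/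
def red {C : SPoint s} (v : Pts m n C) : Fin m → ℝ := fun i => body (v.1 i : Grassmann C.r)

lemma map_id (C : SPoint s) (v : Pts m n C) : map (𝟙 C) v = v := rfl

lemma map_comp {C D E : SPoint s} (f : C ⟶ D) (g : D ⟶ E) (v : Pts m n C) :
    map (f ≫ g) v = map g (map f v) := rfl

end Pts

variable {s m n k l : ℕ}

/-- A family of maps `F C`, defined on open sets `S C ⊆ ℝ^{m|n}(C)` and with values in
`ℝ^{k|l}(C)`, is supersmooth if it is smooth for every superpoint `C`, natural in `C`, and if its
differentials are linear over the even part of `𝒪_C`. -/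
structure IsSupersmoothOn (S : ∀ C : SPoint s, Set (Pts m n C))
    (F : ∀ C : SPoint s, Pts m n C → Pts k l C) : Prop where
  smooth : ∀ C, ContDiffOn ℝ ∞ (F C) (S C)
  natural : ∀ {C D : SPoint s} (f : C ⟶ D), ∀ x ∈ S C,
    Pts.map f x ∈ S D ∧ F D (Pts.map f x) = Pts.map f (F C x)
  fderiv_esmul : ∀ (C : SPoint s), ∀ x ∈ S C, ∀ (a : part 0 C.r) (v : Pts m n C),
    fderiv ℝ (F C) x (Pts.esmul a v) = Pts.esmul a (fderiv ℝ (F C) x v)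

/-- A family of bilinear maps of even vectors `Φ C x : ℝ^{m|n}(C) × ℝ^{m|n}(C) → ℝ^{k|l}(C)`
depending supersmoothly on `x ∈ S C`: a bundle map `T ⊗ T → ℝ^{k|l}`, where `T` is the tangent
bundle of the superdomain `S`. -/
structure IsSuperBilinearOn (S : ∀ C : SPoint s, Set (Pts m n C))
    (Φ : ∀ C : SPoint s, Pts m n C → Pts m n C → Pts m n C → Pts k l C) : Prop where
  add_left : ∀ C, ∀ x ∈ S C, ∀ v v' w, Φ C x (v + v') w = Φ C x v w + Φ C x v' w
  add_right : ∀ C, ∀ x ∈ S C, ∀ v w w', Φ C x v (w + w') = Φ C x v w + Φ C x v w'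
  esmul_left : ∀ C, ∀ x ∈ S C, ∀ a v w, Φ C x (Pts.esmul a v) w = Pts.esmul a (Φ C x v w)
  esmul_right : ∀ C, ∀ x ∈ S C, ∀ a v w, Φ C x v (Pts.esmul a w) = Pts.esmul a (Φ C x v w)
  natural : ∀ {C D : SPoint s} (f : C ⟶ D), ∀ x ∈ S C, ∀ v w,
    Φ D (Pts.map f x) (Pts.map f v) (Pts.map f w) = Pts.map f (Φ C x v w)
  smooth : ∀ C v w, ContDiffOn ℝ ∞ (fun x => Φ C x v w) (S C)
  fderiv_esmul : ∀ C, ∀ x ∈ S C, ∀ v w a h,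
    fderiv ℝ (fun y => Φ C y v w) x (Pts.esmul a h)
      = Pts.esmul a (fderiv ℝ (fun y => Φ C y v w) x h)

/-- An even covector over the superpoint `C`: a natural family of functionals, linear over the even
part of `𝒪_D`, on the `D`-points of `ℝ^{m|n}` for all superpoints `D` over `C`. -/
structure IsCovector (C : SPoint s)
    (K : ∀ D : SPoint s, (C ⟶ D) → Pts m n D → Pts 1 0 D) : Prop where
  add : ∀ D f v w, K D f (v + w) = K D f v + K D f w
  esmul : ∀ D f a v, K D f (Pts.esmul a v) = Pts.esmul a (K D f v)
  natural : ∀ {D E : SPoint s} (f : C ⟶ D) (g : D ⟶ E) v,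
    K E (f ≫ g) (Pts.map g v) = Pts.map g (K D f v)

/-! ## Supermanifolds -/

/-- A supermanifold `M` over `B = ℝ^{0|s}` of relative dimension `m|n`, described by its functor of
points `C ↦ M(C)` on the opposite category of superpoints over `B` and a cover by open subfunctors
isomorphic to superdomains in `ℝ^{m|n}` with supersmooth transition maps. -/
structure Supermanifold (s m n : ℕ) where
  /-- the functor of points -/
  pts : SPoint s ⥤ Type u
  /-- the index set of the atlas -/
  ι : Type u
  /-- the underlying open sets of the superdomains -/
  dom : ι → Set (Fin m → ℝ)
  isOpen_dom : ∀ i, IsOpen (dom i)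
  /-- the charts on `C`-points -/
  chart : ι → ∀ C : SPoint s, PartialEquiv (pts.obj C) (Pts m n C)
  chart_target : ∀ i C, (chart i C).target = {x | Pts.red x ∈ dom i}
  /-- the domain of a chart is the subfunctor determined by its reduced points -/
  mem_source_iff : ∀ i C (q : pts.obj C),
    q ∈ (chart i C).source ↔ pts.map C.toPt q ∈ (chart i (SPoint.pt s)).source
  chart_natural : ∀ i {C D : SPoint s} (f : C ⟶ D), ∀ q ∈ (chart i C).source,
    pts.map f q ∈ (chart i D).source ∧ chart i D (pts.map f q) = Pts.map f (chart i C q)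
  cover : ∀ q : pts.obj (SPoint.pt s), ∃ i, q ∈ (chart i (SPoint.pt s)).source
  isOpen_overlap : ∀ i j C, IsOpen ((chart i C).symm.trans (chart j C)).source
  transition : ∀ i j, IsSupersmoothOn (fun C => ((chart i C).symm.trans (chart j C)).source)
    (fun C => (chart i C).symm.trans (chart j C))

namespace Supermanifold

/-- The topology of the manifold `M(C)`: a set is open iff it is so in all charts. -/
instance (M : Supermanifold.{u} s m n) (C : SPoint s) : TopologicalSpace (M.pts.obj C) :=
  ⨆ i, TopologicalSpace.coinduced
    (fun x : (M.chart i C).target => (M.chart i C).symm x) inferInstance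

variable (M : Supermanifold.{u} s m n)

/-- The coordinate change from chart `i` to chart `j` on `C`-points. -/
def trans (i j : M.ι) (C : SPoint s) : Pts m n C → Pts m n C :=
  (M.chart i C).symm.trans (M.chart j C)

/-- The coordinate domain of chart `i`. -/
def target (i : M.ι) (C : SPoint s) : Set (Pts m n C) := (M.chart i C).target

/-- The part of the coordinate domain of chart `i` where chart `j` is defined. -/
def overlap (i j : M.ι) (C : SPoint s) : Set (Pts m n C) :=
  ((M.chart i C).symm.trans (M.chart j C)).source

/-- The open subfunctor of `M` given by an open set `U` of reduced points. -/
def restrict (U : Set (M.pts.obj (SPoint.pt s))) (C : SPoint s) : Set (M.pts.obj C) :=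
  {q | M.pts.map C.toPt q ∈ U}

variable {M} in
/-- `Φ` is a morphism of supermanifolds from the open subfunctor `U` of `M` to `N`. -/
structure IsMorphismOn {N : Supermanifold.{u} s k l} (U : Set (M.pts.obj (SPoint.pt s)))
    (Φ : ∀ C, M.pts.obj C → N.pts.obj C) : Prop where
  natural : ∀ {C D : SPoint s} (f : C ⟶ D), ∀ q ∈ M.restrict U C,
    Φ D (M.pts.map f q) = N.pts.map f (Φ C q)
  isOpen : ∀ i j C, IsOpen {x ∈ M.target i C | (M.chart i C).symm x ∈ M.restrict U C ∧
    Φ C ((M.chart i C).symm x) ∈ (N.chart j C).source}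
  supersmooth : ∀ i j, IsSupersmoothOn
    (fun C => {x ∈ M.target i C | (M.chart i C).symm x ∈ M.restrict U C ∧
      Φ C ((M.chart i C).symm x) ∈ (N.chart j C).source})
    (fun C x => N.chart j C (Φ C ((M.chart i C).symm x)))

variable {M} in
/-- `Φ` is an isomorphism of supermanifolds from the open subfunctor `U` of `M` onto the open
subfunctor `W` of `N`. -/
def IsIsomorphismOn {N : Supermanifold.{u} s k l} (U : Set (M.pts.obj (SPoint.pt s)))
    (W : Set (N.pts.obj (SPoint.pt s))) (Φ : ∀ C, M.pts.obj C → N.pts.obj C) : Prop :=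
  IsMorphismOn U Φ ∧ ∃ Ψ : ∀ C, N.pts.obj C → M.pts.obj C, IsMorphismOn W Ψ ∧
    ∀ C, MapsTo (Φ C) (M.restrict U C) (N.restrict W C) ∧
      MapsTo (Ψ C) (N.restrict W C) (M.restrict U C) ∧
      InvOn (Ψ C) (Φ C) (M.restrict U C) (N.restrict W C)

/-! ### Tangent vectors at a `B`-point -/

variable {M}

/-- The `C`-point `p ∘ C_B` obtained from a `B`-point `p`. -/
def at_ (p : M.pts.obj (SPoint.base s)) (C : SPoint s) : M.pts.obj C := M.pts.map C.fromBase p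

/-- The charts around a `B`-point. -/
abbrev ChartsAt (p : M.pts.obj (SPoint.base s)) : Type u :=
  {i : M.ι // p ∈ (M.chart i (SPoint.base s)).source}

/-- An even tangent vector at the `B`-point `p` over the superpoint `C`, that is, an even element
of `Γ(p^*TM) ⊗ 𝒪_C`, given by its coordinates in all charts around `p`. -/
@[ext] structure TangentVec (p : M.pts.obj (SPoint.base s)) (C : SPoint s) where
  /-- the coordinates with respect to a chart -/
  coord : ChartsAt p → Pts m n C
  compat : ∀ i j, coord j =
    fderiv ℝ (M.trans i.1 j.1 C) (M.chart i.1 C (at_ p C)) (coord i)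

variable (p : M.pts.obj (SPoint.base s))

lemma at_mem (i : ChartsAt p) (C : SPoint s) : at_ p C ∈ (M.chart i.1 C).source :=
  (M.chart_natural i.1 C.fromBase p i.2).1

lemma map_at {C D : SPoint s} (f : C ⟶ D) : M.pts.map f (at_ p C) = at_ p D := by
  have h : C.fromBase ≫ f = D.fromBase := SPoint.Hom.ext (SPoint.Hom.str_comm f)
  rw [at_, at_, ← h, Functor.map_comp_apply]

lemma chart_at_mem (i j : ChartsAt p) (C : SPoint s) :
    M.chart i.1 C (at_ p C) ∈ M.overlap i.1 j.1 C := by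
  refine ⟨(M.chart i.1 C).map_source (at_mem p i C), ?_⟩
  change (M.chart i.1 C).symm (M.chart i.1 C (at_ p C)) ∈ (M.chart j.1 C).source
  rw [(M.chart i.1 C).left_inv (at_mem p i C)]
  exact at_mem p j C

lemma trans_chart_at (i j : ChartsAt p) (C : SPoint s) :
    M.trans i.1 j.1 C (M.chart i.1 C (at_ p C)) = M.chart j.1 C (at_ p C) := by
  change M.chart j.1 C ((M.chart i.1 C).symm (M.chart i.1 C (at_ p C))) = _
  rw [(M.chart i.1 C).left_inv (at_mem p i C)]

lemma differentiableAt_trans (i j : M.ι) (C : SPoint s) {x : Pts m n C}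
    (hx : x ∈ M.overlap i j C) : DifferentiableAt ℝ (M.trans i j C) x :=
  (((M.transition i j).smooth C).contDiffAt ((M.isOpen_overlap i j C).mem_nhds hx)).differentiableAt
    (by simp)

/-- The coordinate change of tangent vectors at `p`. -/
def tangentTrans (i j : ChartsAt p) (C : SPoint s) : Pts m n C →L[ℝ] Pts m n C :=
  fderiv ℝ (M.trans i.1 j.1 C) (M.chart i.1 C (at_ p C))

lemma tangentTrans_comp (i j k : ChartsAt p) (C : SPoint s) :
    (tangentTrans p j k C).comp (tangentTrans p i j C) = tangentTrans p i k C := by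
  have hij := differentiableAt_trans i.1 j.1 C (chart_at_mem p i j C)
  have hjk := differentiableAt_trans j.1 k.1 C (chart_at_mem p j k C)
  rw [tangentTrans, tangentTrans, tangentTrans, ← trans_chart_at p i j C]
  rw [← trans_chart_at p i j C] at hjk
  rw [← fderiv_comp _ hjk hij]
  apply Filter.EventuallyEq.fderiv_eq
  filter_upwards [(M.isOpen_overlap i.1 j.1 C).mem_nhds (chart_at_mem p i j C)] with x hx
  change M.chart k.1 C ((M.chart j.1 C).symm (M.chart j.1 C ((M.chart i.1 C).symm x))) = _
  have hx2 : (M.chart i.1 C).symm x ∈ (M.chart j.1 C).source := hx.2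
  rw [(M.chart j.1 C).left_inv hx2]
  rfl

lemma tangentTrans_self (i : ChartsAt p) (C : SPoint s) (v : Pts m n C) :
    tangentTrans p i i C v = v := by
  have h : fderiv ℝ (M.trans i.1 i.1 C) (M.chart i.1 C (at_ p C)) =
      fderiv ℝ id (M.chart i.1 C (at_ p C)) := by
    apply Filter.EventuallyEq.fderiv_eq
    filter_upwards [(M.isOpen_overlap i.1 i.1 C).mem_nhds (chart_at_mem p i i C)] with x hx
    exact (M.chart i.1 C).right_inv hx.1
  rw [tangentTrans, h, fderiv_id]
  rfl

lemma tangentTrans_map (i j : ChartsAt p) {C D : SPoint s} (f : C ⟶ D) (v : Pts m n C) :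
    tangentTrans p i j D (Pts.map f v) = Pts.map f (tangentTrans p i j C v) := by
  have hC := differentiableAt_trans i.1 j.1 C (chart_at_mem p i j C)
  have hD := differentiableAt_trans i.1 j.1 D (chart_at_mem p i j D)
  have hx : M.chart i.1 D (at_ p D) = Pts.map f (M.chart i.1 C (at_ p C)) := by
    rw [← (M.chart_natural i.1 f _ (at_mem p i C)).2, map_at]
  have hD' := hD
  rw [hx] at hD'
  have key : fderiv ℝ (M.trans i.1 j.1 D ∘ Pts.map f) (M.chart i.1 C (at_ p C)) =
      fderiv ℝ (Pts.map f ∘ M.trans i.1 j.1 C) (M.chart i.1 C (at_ p C)) := by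
    apply Filter.EventuallyEq.fderiv_eq
    filter_upwards [(M.isOpen_overlap i.1 j.1 C).mem_nhds (chart_at_mem p i j C)] with x hx
    exact ((M.transition i.1 j.1).natural f x hx).2
  rw [fderiv_comp _ hD' (Pts.map f).differentiableAt,
    fderiv_comp _ (Pts.map f).differentiableAt hC, ContinuousLinearMap.fderiv,
    ContinuousLinearMap.fderiv] at key
  rw [tangentTrans, tangentTrans, hx]
  exact congrArg (fun L => L v) key

/-- The tangent vector with given coordinates in the chart `i`. -/
def TangentVec.ofCoord {C : SPoint s} (i : ChartsAt p) (v : Pts m n C) : TangentVec p C where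
  coord j := tangentTrans p i j C v
  compat j k := congrArg (fun L => L v) (tangentTrans_comp p i j k C).symm

/-- The functoriality of tangent vectors in the superpoint. -/
def TangentVec.map {C D : SPoint s} (f : C ⟶ D) (v : TangentVec p C) : TangentVec p D where
  coord i := Pts.map f (v.coord i)
  compat i j := by
    rw [v.compat i j]
    exact (tangentTrans_map p i j f _).symm

instance (C : SPoint s) : Zero (TangentVec p C) where
  zero := { coord := fun _ => 0, compat := fun _ _ => (map_zero _).symm }

/-- The coordinates of tangent vectors at `p` in a chart around `p`. -/
def TangentVec.chart (i : ChartsAt p) (C : SPoint s) : PartialEquiv (TangentVec p C) (Pts m n C) :=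
  Equiv.toPartialEquiv
    { toFun := fun v => v.coord i
      invFun := TangentVec.ofCoord p i
      left_inv := fun v => TangentVec.ext (funext fun j => (v.compat i j).symm)
      right_inv := fun v => tangentTrans_self p i C v }

/-- The functor `C ↦ (Γ(p^*TM) ⊗ 𝒪_C)₀` of tangent vectors of `M` at the `B`-point `p`, as a
supermanifold with the linear coordinates given by the charts of `M` around `p`. -/
def tangentAt : Supermanifold.{u} s m n where
  pts :=
    { obj := fun C => TangentVec p C
      map := fun f => TypeCat.ofHom (TangentVec.map p f) }
  ι := ChartsAt p
  dom _ := univ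
  isOpen_dom _ := isOpen_univ
  chart := TangentVec.chart p
  chart_target _ _ := by ext; simp [TangentVec.chart]
  mem_source_iff _ _ _ := Iff.rfl
  chart_natural _ _ _ _ _ _ := ⟨trivial, rfl⟩
  cover v := by
    obtain ⟨i, hi⟩ := M.cover (M.pts.map (SPoint.base s).toPt p)
    exact ⟨⟨i, (M.mem_source_iff i _ p).2 hi⟩, trivial⟩
  isOpen_overlap i j C := by
    simp [TangentVec.chart]
  transition i j := by
    have hF : ∀ C : SPoint s, (fun x => ((TangentVec.chart p i C).symm.trans
        (TangentVec.chart p j C)) x) = tangentTrans p i j C := fun C => rfl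
    refine ⟨fun C => ?_, fun {C D} f x _ => ⟨?_, tangentTrans_map p i j f x⟩,
      fun C x _ a v => ?_⟩
    · exact (tangentTrans p i j C).contDiff.contDiffOn
    · simp [TangentVec.chart]
    · change fderiv ℝ (tangentTrans p i j C) x _ = Pts.esmul a (fderiv ℝ (tangentTrans p i j C) x v)
      rw [ContinuousLinearMap.fderiv]
      exact (M.transition i.1 j.1).fderiv_esmul C _ (chart_at_mem p i j C) a v

end Supermanifold

open Supermanifold

/-! ## Riemannian metrics, connections and geodesics -/

/-- A Riemannian metric on `M → B`: an even, symmetric, non-degenerate bilinear form on the tangent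
bundle whose reduction is positive definite. In a chart it is given by its values on even tangent
vectors over all superpoints; the sign rule `m(X,Y) = (-1)^{|X||Y|} m(Y,X)` is then plain symmetry.
Non-degeneracy says that the induced map from the tangent to the cotangent bundle is bijective. -/
structure RiemannianMetric (M : Supermanifold.{u} s m n) where
  /-- the form in the chart `i` -/
  form : M.ι → ∀ C : SPoint s, Pts m n C → Pts m n C → Pts m n C → Pts 1 0 C
  bilinear : ∀ i, IsSuperBilinearOn (M.target i) (form i)
  compat : ∀ i j C, ∀ x ∈ M.overlap i j C, ∀ v w, form i C x v w =
    form j C (M.trans i j C x) (fderiv ℝ (M.trans i j C) x v) (fderiv ℝ (M.trans i j C) x w)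
  symm : ∀ i C, ∀ x ∈ M.target i C, ∀ v w, form i C x v w = form i C x w v
  nondegenerate : ∀ i C, ∀ x ∈ M.target i C, ∀ K, IsCovector C K →
    ∃! v : Pts m n C, ∀ D (f : C ⟶ D) w, form i D (Pts.map f x) (Pts.map f v) w = K D f w
  pos_def : ∀ i, ∀ x ∈ M.target i (SPoint.pt s), ∀ v, v ≠ 0 →
    0 < Pts.red (form i (SPoint.pt s) x v v) 0

/-- A connection on the tangent bundle of `M`. In a chart `∇_v W = dW(v) + Γ(v, W)`, and `Γ`
(the Christoffel symbols) changes between charts in such a way that `∇` is well defined. -/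
structure Connection (M : Supermanifold.{u} s m n) where
  /-- the Christoffel symbols in the chart `i` -/
  Γ : M.ι → ∀ C : SPoint s, Pts m n C → Pts m n C → Pts m n C → Pts m n C
  bilinear : ∀ i, IsSuperBilinearOn (M.target i) (Γ i)
  compat : ∀ i j C, ∀ x ∈ M.overlap i j C, ∀ v w,
    fderiv ℝ (M.trans i j C) x (Γ i C x v w) =
      fderiv ℝ (fderiv ℝ (M.trans i j C)) x v w +
        Γ j C (M.trans i j C x) (fderiv ℝ (M.trans i j C) x v) (fderiv ℝ (M.trans i j C) x w)

/-- A map `γ : I × C → M ×_B C` over `C`, for an open interval `I`, is a smooth curve in the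
manifold `M(C)` of `C`-points, as its coordinates in a chart are smooth functions on `I` with
values in the even respectively odd part of `𝒪_C`. Outside of `I` the values of `γ` are
irrelevant. -/
def IsSmoothCurveOn {M : Supermanifold.{u} s m n} {C : SPoint s} (I : Set ℝ)
    (γ : ℝ → M.pts.obj C) : Prop :=
  ∀ t ∈ I, ∀ i, γ t ∈ (M.chart i C).source →
    (∀ᶠ r in 𝓝 t, γ r ∈ (M.chart i C).source) ∧
      ContDiffAt ℝ ∞ (fun r => M.chart i C (γ r)) t

namespace Connection

variable {M : Supermanifold.{u} s m n} (nabla : Connection M)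

/-- The Levi-Civita condition: `∇` is torsion free and the metric is parallel. -/
structure IsLeviCivita (g : RiemannianMetric M) : Prop where
  torsion_free : ∀ i C, ∀ x ∈ M.target i C, ∀ v w, nabla.Γ i C x v w = nabla.Γ i C x w v
  metric : ∀ i C, ∀ x ∈ M.target i C, ∀ u v w,
    fderiv ℝ (fun y => g.form i C y v w) x u =
      g.form i C x (nabla.Γ i C x u v) w + g.form i C x v (nabla.Γ i C x u w)

/-- The geodesic equation `∇_{∂_t} dγ(∂_t) = 0` on `I`. -/
def IsGeodesicOn {C : SPoint s} (I : Set ℝ) (γ : ℝ → M.pts.obj C) : Prop :=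
  IsSmoothCurveOn I γ ∧ ∀ t ∈ I, ∀ i, γ t ∈ (M.chart i C).source →
    deriv (deriv fun r => M.chart i C (γ r)) t +
      nabla.Γ i C (M.chart i C (γ t)) (deriv (fun r => M.chart i C (γ r)) t)
        (deriv (fun r => M.chart i C (γ r)) t) = 0

/-- `γ` is a geodesic on the open interval `I` with `γ(0) = p ∘ C_B` and `dγ(∂_t)|_{t=0} = v`. -/
def IsGeodesicFrom {C : SPoint s} (I : Set ℝ) (p : M.pts.obj (SPoint.base s))
    (v : TangentVec p C) (γ : ℝ → M.pts.obj C) : Prop :=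
  nabla.IsGeodesicOn I γ ∧ γ 0 = at_ p C ∧
    ∀ i : ChartsAt p, deriv (fun r => M.chart i.1 C (γ r)) 0 = v.coord i

end Connection

end SuperGeometry

end

open SuperGeometry

/-! On `C`-points the problem is classical. A geodesic over `C` is a curve in the finite-dimensional
manifold `M(C)`, and in a chart its position and velocity form an integral curve of the smooth
vector field `spray`, (x, v) ↦ (v, -Γ(v, v)). Local existence, uniqueness and smooth dependence are
therefore ODE theory; `exists_local_flow` gets them from the implicit function theorem in C([-1, 1],
E). What remains is the super part: all constructions must be natural in `C`, their differentials
must be linear over even elements, and domains may depend on reduced data only.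

Naturality comes from uniqueness, because a morphism of superpoints carries geodesics to geodesics.
Even linearity comes from the linearised equation, whose coefficients commute with multiplication by
even elements (`fderiv_flow_comm`, `contDiffAt_solution`).

Domains are controlled by scaling odd generators by c → 0, which contracts a point to its body.
Scaling the generators of `C` need not respect the map to `B`, so the generators are doubled: the
structure map uses only the first block, and scaling the second block is a morphism over `B`.
Initial data placed in the second block and scaled close to their body lie in the domain of a local
flow; undoing the scaling and identifying the blocks gives a solution with the original data on the
same time interval (`exists_solution_near`). Existence times thus depend only on reduced data, and a
geodesic can be continued along its reduced geodesic (`exists_geodesic_extension`,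
`exists_isGeodesicFrom_of_reduced`). The Hausdorff condition enters only on reduced points.

Scaling also reads the powers of the nilpotent ideal off the order of vanishing in c
(`Pts.mem_vanish_iff`). This yields a Taylor formula whose remainder gains a degree
(`IsSupersmoothOn.taylor_mem_vanish`) and, as the filtration is finite, an inverse function theorem
by a terminating Newton iteration (`IsSupersmoothOn.exists_inverse`). It applies to exp_p, whose
differential at zero is the identity since exp_p(cw) is the geodesic of w at time c.

For the Levi-Civita connection, the Koszul expression is an even covector in its last argument, and
non-degeneracy turns it into Christoffel symbols. Their properties are read off from the defining
equation, tested over all superpoints over `C`. -/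

noncomputable section

namespace SuperGeometry

/-! ## Flows of smooth vector fields -/

section SmoothODE

set_option linter.unusedSectionVars false

variable {K : Type} [TopologicalSpace K] [CompactSpace K]
variable {E E' : Type} [NormedAddCommGroup E] [NormedSpace ℝ E] [NormedAddCommGroup E']
  [NormedSpace ℝ E']

/-- The superposition operator `y ↦ F ∘ y` on continuous functions. -/
def superposition (F : C(E, E')) (y : C(K, E)) : C(K, E') := F.comp y

/-- Pointwise application of a continuous family of operators to continuous functions. -/
def pointwiseApply : C(K, E →L[ℝ] E') →L[ℝ] C(K, E) →L[ℝ] C(K, E') :=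
  LinearMap.mkContinuous₂
    (LinearMap.mk₂ ℝ (fun (A : C(K, E →L[ℝ] E')) (h : C(K, E)) =>
      (⟨fun t => A t (h t), by fun_prop⟩ : C(K, E')))
      (fun _ _ _ => by ext; simp) (fun _ _ _ => by ext; simp)
      (fun _ _ _ => by ext; simp) (fun _ _ _ => by ext; simp)) 1 (by
    intro A h
    rw [one_mul]
    refine (ContinuousMap.norm_le _ (by positivity)).2 fun t => ?_
    exact (A t).le_of_opNorm_le_of_le (A.norm_coe_le_norm t) (h.norm_coe_le_norm t))

/-- The mean value inequality is applied pointwise on balls around `y t` of radius ‖h‖. The estimate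
is uniform in `t` because z ↦ F' ∘ z is continuous for the sup norm at `y`. -/
lemma hasFDerivAt_superposition {F : C(E, E')} {F' : C(E, E →L[ℝ] E')}
    (hF : ∀ x, HasFDerivAt F (F' x) x) (y : C(K, E)) :
    HasFDerivAt (superposition F) (pointwiseApply (superposition F' y)) y := by
  rw [hasFDerivAt_iff_isLittleO_nhds_zero, Asymptotics.isLittleO_iff]
  intro c hc
  have hcont : ContinuousAt (fun z : C(K, E) => superposition F' z) y :=
    (ContinuousMap.continuous_postcomp F').continuousAt
  obtain ⟨δ, hδ, H⟩ := Metric.continuousAt_iff.1 hcont c hc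
  filter_upwards [Metric.ball_mem_nhds (0 : C(K, E)) hδ] with h hh
  rw [mem_ball_zero_iff] at hh
  refine (ContinuousMap.norm_le _ (by positivity)).2 fun t => ?_
  have key : ∀ z ∈ Metric.closedBall (y t) ‖h‖, ‖F' z - F' (y t)‖ ≤ c := by
    intro z hz
    -- Shifting `y` by the constant `z - y t` produces a function with value `z` at `t` whose sup
    -- distance from `y` is at most ‖h‖, so the choice of δ bounds `F' z - F' (y t)`.
    have h1 := H (x := y + ContinuousMap.const K (z - y t)) (by
      rw [dist_eq_norm, add_sub_cancel_left]
      refine lt_of_le_of_lt ((ContinuousMap.norm_le _ (norm_nonneg h)).2 fun s => ?_) hh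
      simpa [dist_eq_norm] using hz)
    have h2 := ContinuousMap.dist_apply_le_dist (f := superposition F'
      (y + ContinuousMap.const K (z - y t))) (g := superposition F' y) t
    have h3 : superposition F' (y + ContinuousMap.const K (z - y t)) t = F' z := by
      simp [superposition]
    rw [h3] at h2
    have h4 : superposition F' y t = F' (y t) := rfl
    rw [h4, dist_eq_norm] at h2
    exact h2.trans h1.le
  have := (convex_closedBall (y t) ‖h‖).norm_image_sub_le_of_norm_hasFDerivWithin_le'
    (f := F) (f' := F') (φ := F' (y t)) (C := c) (fun z _ => (hF z).hasFDerivWithinAt) key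
    (Metric.mem_closedBall_self (norm_nonneg h)) (y := y t + h t)
    (by simpa [dist_eq_norm] using h.norm_coe_le_norm t)
  rw [add_sub_cancel_left] at this
  change ‖F (y t + h t) - F (y t) - F' (y t) (h t)‖ ≤ c * ‖h‖
  exact this.trans (mul_le_mul_of_nonneg_left (h.norm_coe_le_norm t) hc.le)

/-- The derivative is again a superposition operator, now with operator values, followed by the
continuous linear `pointwiseApply`. Hence the induction on the order has to let the target space
vary. -/
lemma contDiff_superposition {F : C(E, E')} (hF : ContDiff ℝ ∞ F) :
    ContDiff ℝ ∞ (superposition F : C(K, E) → C(K, E')) := by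
  rw [contDiff_infty]
  intro k
  induction k generalizing E' with
  | zero => exact contDiff_zero.2 (ContinuousMap.continuous_postcomp F)
  | succ k ih =>
    have hF' : ContDiff ℝ ∞ (fderiv ℝ F) := hF.fderiv_right (by simp)
    let F' : C(E, E →L[ℝ] E') := ⟨fderiv ℝ F, hF'.continuous⟩
    push_cast
    rw [contDiff_succ_iff_hasFDerivAt]
    refine ⟨fun y => pointwiseApply (superposition F' y), ?_, fun y =>
      hasFDerivAt_superposition (F' := F') (fun x => (hF.differentiable (by simp) x).hasFDerivAt) y⟩
    exact pointwiseApply.contDiff.comp (ih (F := F') hF')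

/-- The compact time interval `[-1, 1]`. -/
abbrev TimeInterval : Type := Icc (-1 : ℝ) 1

/-- The extension of a continuous function on `[-1, 1]` that is constant outside of `[-1, 1]`. -/
def extendTime (y : C(TimeInterval, E)) (t : ℝ) : E :=
  y (projIcc (-1 : ℝ) 1 (by norm_num) t)

lemma continuous_extendTime (y : C(TimeInterval, E)) : Continuous (extendTime y) :=
  y.continuous.comp continuous_projIcc

lemma extendTime_coe (y : C(TimeInterval, E)) (t : TimeInterval) : extendTime y t = y t := by
  rw [extendTime, projIcc_val]

lemma norm_extendTime_le (y : C(TimeInterval, E)) (t : ℝ) : ‖extendTime y t‖ ≤ ‖y‖ :=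
  y.norm_coe_le_norm _

variable [CompleteSpace E]

/-- The operator `y ↦ ∫₀ᵗ y`. -/
def integralFromZero : C(TimeInterval, E) →L[ℝ] C(TimeInterval, E) :=
  LinearMap.mkContinuous
    { toFun := fun y => ⟨fun t => ∫ s in (0 : ℝ)..t, extendTime y s, by
        have : Continuous fun t : ℝ => ∫ s in (0 : ℝ)..t, extendTime y s :=
          intervalIntegral.continuous_primitive
            (fun a b => (continuous_extendTime y).intervalIntegrable a b) 0
        exact this.comp continuous_subtype_val⟩
      map_add' := fun y z => by
        ext t
        exact intervalIntegral.integral_add ((continuous_extendTime y).intervalIntegrable _ _)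
          ((continuous_extendTime z).intervalIntegrable _ _)
      map_smul' := fun c y => by
        ext t
        exact intervalIntegral.integral_smul c _ } 1 (by
    intro y
    refine (ContinuousMap.norm_le _ (by positivity)).2 fun t => ?_
    have h := intervalIntegral.norm_integral_le_of_norm_le_const (a := 0) (b := (t : ℝ))
      (f := extendTime y) (C := ‖y‖) (fun s _ => norm_extendTime_le y s)
    have ht : |(t : ℝ) - 0| ≤ 1 := by rw [sub_zero]; exact abs_le.2 t.2
    exact h.trans (by rw [mul_comm]; exact mul_le_mul_of_nonneg_right ht (norm_nonneg y)))

lemma integralFromZero_apply (y : C(TimeInterval, E)) (t : TimeInterval) :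
    integralFromZero y t = ∫ s in (0 : ℝ)..t, extendTime y s := rfl

/-- The map whose zeros `(x, ε, y)` are the solutions `y` on `[-1, 1]` of `y' = ε F(y)` with
`y(0) = x`. -/
def odeMap (F : C(E, E)) (q : (E × ℝ) × C(TimeInterval, E)) : C(TimeInterval, E) :=
  q.2 - ContinuousLinearMap.const ℝ TimeInterval q.1.1 - q.1.2 • integralFromZero (superposition F q.2)

lemma contDiff_odeMap {F : C(E, E)} (hF : ContDiff ℝ ∞ F) : ContDiff ℝ ∞ (odeMap F) := by
  have h := contDiff_superposition (K := TimeInterval) hF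
  unfold odeMap
  fun_prop

/-- At ε = 0 the map `odeMap` is y - x, with partial derivative in y the identity, so the implicit
function theorem applies at the constant solution. This is why ε is carried as a parameter. -/
lemma exists_smooth_integral_solution {F : C(E, E)} (hF : ContDiff ℝ ∞ F) (x₀ : E) :
    ∃ y : E × ℝ → C(TimeInterval, E), y (x₀, 0) = ContinuousMap.const _ x₀ ∧
      ∀ᶠ q in 𝓝 (x₀, (0 : ℝ)), ContDiffAt ℝ ∞ y q ∧ odeMap F (q, y q) = 0 := by
  set u : (E × ℝ) × C(TimeInterval, E) := ((x₀, 0), ContinuousMap.const _ x₀) with hu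
  have h0 : odeMap F u = 0 := by
    ext t
    simp [odeMap, hu]
  let P : (E × ℝ) × C(TimeInterval, E) → C(TimeInterval, E) →L[ℝ] C(TimeInterval, E) :=
    fun q => fderiv ℝ (odeMap F) q ∘L .inr ℝ (E × ℝ) C(TimeInterval, E)
  have hPc : Continuous P :=
    (((contDiff_odeMap hF).fderiv_right (m := ∞) (by simp)).continuous).clm_comp continuous_const
  have hinv : (P u).IsInvertible := by
    have h1 : HasFDerivAt (fun y => odeMap F ((x₀, 0), y)) (P u) (ContinuousMap.const _ x₀) :=
      (((contDiff_odeMap hF).differentiable (by simp) u).hasFDerivAt).comp _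
        (hasFDerivAt_prodMk_right _ _)
    have h2 : HasFDerivAt (fun y => odeMap F ((x₀, 0), y))
        (ContinuousLinearMap.id ℝ C(TimeInterval, E)) (ContinuousMap.const _ x₀) := by
      have : (fun y => odeMap F ((x₀, 0), y)) =
          fun y => y - ContinuousLinearMap.const ℝ TimeInterval x₀ := by
        ext y t
        simp [odeMap]
      rw [this]
      exact (hasFDerivAt_id _).sub_const _
    rw [h1.unique h2]
    exact ⟨ContinuousLinearEquiv.refl ℝ _, rfl⟩
  have cd : ∀ q, ContDiffAt ℝ ∞ (odeMap F) q := fun q => (contDiff_odeMap hF).contDiffAt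
  set y := (cd u).implicitFunction (by simp) hinv
  have hy0 : y (x₀, 0) = ContinuousMap.const _ x₀ :=
    (cd u).implicitFunction_apply_self (by simp) hinv
  have hy : ContDiffAt ℝ ∞ y (x₀, 0) := (cd u).contDiffAt_implicitFunction (by simp) hinv
  have hy1 : ∀ᶠ q in 𝓝 (x₀, (0 : ℝ)), ContinuousAt y q := by
    filter_upwards [(hy.of_le (m := 1) (by simp)).eventually (by simp)] with q hq
    exact hq.continuousAt
  have hzero : ∀ᶠ q in 𝓝 (x₀, (0 : ℝ)), odeMap F (q, y q) = 0 := by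
    filter_upwards [(cd u).eventually_apply_implicitFunction (by simp) hinv] with q hq
    rw [hq, h0]
  have hinv' : ∀ᶠ q in 𝓝 (x₀, (0 : ℝ)), (P (q, y q)).IsInvertible := by
    have h1 : ContinuousAt (fun q => P (q, y q)) (x₀, 0) :=
      hPc.continuousAt.comp (continuousAt_id.prodMk hy.continuousAt)
    refine h1.eventually (p := fun A => A.IsInvertible) ?_
    change ∀ᶠ A in 𝓝 (P ((x₀, 0), y (x₀, 0))), A.IsInvertible
    rw [hy0]
    exact (ContinuousLinearEquiv.isOpen (𝕜 := ℝ)).mem_nhds hinv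
  refine ⟨y, hy0, ?_⟩
  filter_upwards [hy1, hzero.eventually_nhds, hinv'] with q hq1 hq2 hq3
  refine ⟨?_, hq2.self_of_nhds⟩
  -- `ContDiffAt ℝ ∞` at the base point gives only finite orders on neighbourhoods that may shrink.
  -- Smoothness at nearby points comes from applying the theorem again there and identifying the new
  -- implicit function with `y` by local uniqueness of zeros.
  have h3 := (cd (q, y q)).contDiffAt_implicitFunction (by simp) hq3
  refine h3.congr_of_eventuallyEq ?_
  have h4 := (cd (q, y q)).eventually_apply_eq_iff_implicitFunction (by simp) hq3
  have h5 : ContinuousAt (fun q' => (q', y q')) q := continuousAt_id.prodMk hq1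
  filter_upwards [h5.eventually h4, hq2] with q' h6 h7
  exact (h6.1 (h7.trans hq2.self_of_nhds.symm)).symm

lemma hasDerivAt_extendTime {z w : C(TimeInterval, E)} {c : E} {ε : ℝ}
    (h : z = ContinuousMap.const _ c + ε • integralFromZero w) {t : ℝ} (ht : t ∈ Ioo (-1 : ℝ) 1) :
    HasDerivAt (extendTime z) (ε • extendTime w t) t := by
  have h1 : HasDerivAt (fun t => c + ε • ∫ s in (0 : ℝ)..t, extendTime w s)
      (ε • extendTime w t) t :=
    (((continuous_extendTime w).integral_hasStrictDerivAt 0 t).hasDerivAt.const_smul ε).const_add c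
  refine h1.congr_of_eventuallyEq ?_
  filter_upwards [Icc_mem_nhds ht.1 ht.2] with r hr
  have : extendTime z r = z ⟨r, hr⟩ := extendTime_coe z ⟨r, hr⟩
  rw [this, h]
  rfl

lemma extendTime_zero_of_eq {z w : C(TimeInterval, E)} {c : E} {ε : ℝ}
    (h : z = ContinuousMap.const _ c + ε • integralFromZero w) : extendTime z 0 = c := by
  have h0 : (0 : ℝ) ∈ Icc (-1 : ℝ) 1 := by norm_num
  have : extendTime z 0 = z ⟨0, h0⟩ := extendTime_coe z ⟨0, h0⟩
  rw [this, h]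
  simp [integralFromZero_apply]

/-- A bump function supported inside `S` cuts the field off, since superposition operators need a
globally smooth map. -/
lemma exists_contDiff_eq_near [FiniteDimensional ℝ E] {S : Set E} (hS : IsOpen S) {F : E → E'}
    (hF : ContDiffOn ℝ ∞ F S) {x₀ : E} (hx₀ : x₀ ∈ S) :
    ∃ F₁ : E → E', ContDiff ℝ ∞ F₁ ∧ ∃ r > 0, Metric.ball x₀ r ⊆ S ∧
      EqOn F₁ F (Metric.ball x₀ r) := by
  obtain ⟨r, hr, hrS⟩ := Metric.isOpen_iff.1 hS x₀ hx₀
  let χ : ContDiffBump x₀ := ⟨r / 4, r / 2, by positivity, by linarith⟩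
  refine ⟨fun x => χ x • F x, ?_, r / 4, by positivity,
    (Metric.ball_subset_ball (by linarith)).trans hrS, fun x hx => ?_⟩
  · rw [contDiff_iff_contDiffAt]
    intro x
    by_cases hx : x ∈ S
    · exact χ.contDiffAt.smul (hF.contDiffAt (hS.mem_nhds hx))
    · have h1 : x ∉ tsupport χ := by
        rw [χ.tsupport_eq]
        exact fun h => hx (hrS (Metric.closedBall_subset_ball (by
          change r / 2 < r; linarith) h))
      have h2 : (fun x => χ x • F x) =ᶠ[𝓝 x] fun _ => 0 := by
        filter_upwards [(isClosed_tsupport χ).isOpen_compl.mem_nhds h1] with z hz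
        rw [image_eq_zero_of_notMem_tsupport hz, zero_smul]
      exact contDiffAt_const.congr_of_eventuallyEq h2
  · change χ x • F x = F x
    rw [χ.one_of_mem_closedBall (Metric.ball_subset_closedBall hx), one_smul]

/-- Local existence of the flow of a smooth vector field, its smooth dependence on the initial
value, and the linearised equation. -/
theorem exists_local_flow [FiniteDimensional ℝ E] {S : Set E} (hS : IsOpen S) {F : E → E}
    (hF : ContDiffOn ℝ ∞ F S) {x₀ : E} (hx₀ : x₀ ∈ S) :
    ∃ ε > 0, ∃ N : Set E, IsOpen N ∧ x₀ ∈ N ∧ ∃ Φ : E → ℝ → E, ∀ x ∈ N, Φ x 0 = x ∧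
      ∀ t ∈ Ioo (-ε) ε, Φ x t ∈ S ∧ HasDerivAt (Φ x) (F (Φ x t)) t ∧
        ContDiffAt ℝ ∞ (fun z => Φ z t) x ∧
        ∀ h, HasDerivAt (fun τ => fderiv ℝ (fun z => Φ z τ) x h)
          (fderiv ℝ F (Φ x t) (fderiv ℝ (fun z => Φ z t) x h)) t := by
  obtain ⟨F₁, hF₁, r, hr, hrS, heq⟩ := exists_contDiff_eq_near hS hF hx₀
  let F₂ : C(E, E) := ⟨F₁, hF₁.continuous⟩
  obtain ⟨y, hy0, hy⟩ := exists_smooth_integral_solution (F := F₂) hF₁ x₀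
  have hball : ∀ᶠ q in 𝓝 (x₀, (0 : ℝ)), y q ∈ Metric.ball (ContinuousMap.const _ x₀) r :=
    hy.self_of_nhds.1.continuousAt.eventually (p := fun z => z ∈ _)
      (by rw [hy0]; exact Metric.ball_mem_nhds _ hr)
  have hall := (hy.and hball).eventually_nhds
  rw [nhds_prod_eq] at hall
  obtain ⟨p₁, hp₁, p₂, hp₂, hp⟩ := eventually_prod_iff.1 hall
  obtain ⟨N, hNp, hNo, hxN⟩ := eventually_nhds_iff.1 hp₁
  obtain ⟨δ, hδ, hδp⟩ := Metric.eventually_nhds_iff.1 hp₂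
  -- A fixed positive ε in the admissible parameter range turns solutions of y' = εF(y) on [-1, 1]
  -- into solutions of y' = F(y) on (-ε, ε), through the time change t ↦ t / ε.
  set ε := δ / 2 with hε
  have hεpos : 0 < ε := by positivity
  have hN : ∀ x ∈ N, ∀ᶠ q in 𝓝 (x, ε), (ContDiffAt ℝ ∞ y q ∧ odeMap F₂ (q, y q) = 0) ∧
      y q ∈ Metric.ball (ContinuousMap.const _ x₀) r := fun x hx =>
    hp (hNp x hx) (hδp (by rw [Real.dist_eq, sub_zero, abs_of_pos hεpos, hε]; linarith))
  have htime : ∀ t ∈ Ioo (-ε) ε, t / ε ∈ Ioo (-1 : ℝ) 1 := fun t ht =>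
    ⟨by rw [lt_div_iff₀ hεpos]; linarith [ht.1], by rw [div_lt_iff₀ hεpos]; linarith [ht.2]⟩
  have hdiv : ∀ t : ℝ, HasDerivAt (fun t : ℝ => t / ε) ε⁻¹ t := fun t => by
    simpa using (hasDerivAt_id t).div_const ε
  have hsol : ∀ q : E × ℝ, odeMap F₂ (q, y q) = 0 →
      y q = ContinuousMap.const _ q.1 + q.2 • integralFromZero (superposition F₂ (y q)) := by
    intro q hq
    rw [odeMap, sub_sub, sub_eq_zero] at hq
    exact hq
  have hmem : ∀ z ∈ Metric.ball (ContinuousMap.const TimeInterval x₀) r, ∀ t,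
      extendTime z t ∈ Metric.ball x₀ r := fun z hz t =>
    lt_of_le_of_lt (ContinuousMap.dist_apply_le_dist _) hz
  refine ⟨ε, hεpos, N, hNo, hxN, fun x t => extendTime (y (x, ε)) (t / ε), fun x hx => ?_⟩
  have hx1 := (hN x hx).self_of_nhds
  have hx2 := hsol _ hx1.1.2
  refine ⟨by simpa using extendTime_zero_of_eq hx2, fun t ht => ?_⟩
  have hin : ∀ τ, extendTime (y (x, ε)) τ ∈ Metric.ball x₀ r := hmem _ hx1.2
  have hyd : HasFDerivAt y (fderiv ℝ y (x, ε)) (x, ε) :=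
    (hx1.1.1.differentiableAt (by simp)).hasFDerivAt
  have hpair : ContDiff ℝ ∞ fun z : E => (z, ε) := contDiff_id.prodMk contDiff_const
  have hxd : HasFDerivAt (fun z => y (z, ε)) (fderiv ℝ y (x, ε) ∘L .inl ℝ E ℝ) x :=
    hyd.comp x (hasFDerivAt_prodMk_left x ε)
  let ev : ℝ → C(TimeInterval, E) →L[ℝ] E := fun τ =>
    ContinuousMap.evalCLM ℝ (projIcc (-1 : ℝ) 1 (by norm_num) (τ / ε))
  have hev : ∀ τ (z : C(TimeInterval, E)), ev τ z = extendTime z (τ / ε) := fun τ z => rfl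
  have hfd : ∀ τ h, fderiv ℝ (fun z => extendTime (y (z, ε)) (τ / ε)) x h =
      extendTime (fderiv ℝ y (x, ε) (h, 0)) (τ / ε) := fun τ h => by
    have : HasFDerivAt (fun z => extendTime (y (z, ε)) (τ / ε))
        (ev τ ∘L (fderiv ℝ y (x, ε) ∘L .inl ℝ E ℝ)) x := (ev τ).hasFDerivAt.comp x hxd
    rw [this.fderiv]
    rfl
  refine ⟨hrS (hin _), ?_, ?_, fun h => ?_⟩
  · have h1 := (hasDerivAt_extendTime hx2 (htime t ht)).scomp t (hdiv t)
    rw [smul_smul, inv_mul_cancel₀ hεpos.ne', one_smul] at h1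
    have h2 : extendTime (superposition F₂ (y (x, ε))) (t / ε) =
        F (extendTime (y (x, ε)) (t / ε)) := heq (hin _)
    rw [h2] at h1
    exact h1
  · exact (ev t).contDiff.contDiffAt.comp x (hx1.1.1.comp x hpair.contDiffAt)
  · simp only [hfd]
    let F₂' : C(E, E →L[ℝ] E) := ⟨fderiv ℝ F₁, hF₁.continuous_fderiv (by simp)⟩
    set Y := fderiv ℝ y (x, ε) (h, 0) with hY
    -- The integral equation holds for all initial values near `x`, so it may be differentiated in
    -- `x`. The result is the integral form of the linearised equation.
    have hYeq : Y = ContinuousMap.const _ h +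
        ε • integralFromZero (pointwiseApply (superposition F₂' (y (x, ε))) Y) := by
      have h1 : HasFDerivAt (fun z => y (z, ε)) _ x := hxd
      have h2 := (hasFDerivAt_superposition (F := F₂) (F' := F₂')
        (fun z => (hF₁.differentiable (by simp) z).hasFDerivAt) (y (x, ε))).comp x h1
      have h3 := ((integralFromZero (E := E)).hasFDerivAt.comp x h2).const_smul ε
      have h4 := ((ContinuousLinearMap.const ℝ TimeInterval (M := E)).hasFDerivAt (x := x)).add h3
      have h5 : (fun z => y (z, ε)) =ᶠ[𝓝 x] fun z => ContinuousLinearMap.const ℝ TimeInterval z +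
          ε • integralFromZero (superposition F₂ (y (z, ε))) := by
        filter_upwards [(hpair.continuous.continuousAt (x := x)).eventually (hN x hx)] with z hz
        exact hsol _ hz.1.2
      have h6 := h1.unique (h4.congr_of_eventuallyEq h5)
      exact congrArg (fun A => A h) h6
    have h1 := (hasDerivAt_extendTime hYeq (htime t ht)).scomp t (hdiv t)
    rw [smul_smul, inv_mul_cancel₀ hεpos.ne', one_smul] at h1
    have h2 : fderiv ℝ F₁ (extendTime (y (x, ε)) (t / ε)) =
        fderiv ℝ F (extendTime (y (x, ε)) (t / ε)) :=
      (heq.eventuallyEq_of_mem (Metric.isOpen_ball.mem_nhds (hin _))).fderiv_eq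
    rw [← h2]
    exact h1

/-- The coefficients need not be bounded on the open interval. They are bounded on each compact [-b,
b] inside it, and this bound is the Lipschitz constant there. -/
lemma linear_ode_unique {ε : ℝ} {A : ℝ → E →L[ℝ] E} (hA : ContinuousOn A (Ioo (-ε) ε))
    {u w : ℝ → E} (hu : ∀ t ∈ Ioo (-ε) ε, HasDerivAt u (A t (u t)) t)
    (hw : ∀ t ∈ Ioo (-ε) ε, HasDerivAt w (A t (w t)) t) (h0 : u 0 = w 0) :
    EqOn u w (Ioo (-ε) ε) := by
  intro t ht
  obtain ⟨b, hb1, hb2⟩ := exists_between (abs_lt.2 ht)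
  have hsub : Icc (-b) b ⊆ Ioo (-ε) ε := fun s hs => ⟨by linarith [hs.1], by linarith [hs.2]⟩
  obtain ⟨c, hc⟩ := isCompact_Icc.exists_bound_of_continuousOn (hA.mono hsub)
  have hlip : ∀ s ∈ Ioo (-b) b, LipschitzOnWith c.toNNReal (fun x => A s x) univ := by
    intro s hs
    refine ((A s).lipschitz.weaken ?_).lipschitzOnWith
    rw [← NNReal.coe_le_coe]
    exact (hc s (Ioo_subset_Icc_self hs)).trans (Real.le_coe_toNNReal c)
  have hb0 : 0 < b := (abs_nonneg t).trans_lt hb1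
  exact ODE_solution_unique_of_mem_Ioo (v := fun s x => A s x) (s := fun _ => univ)
    (t₀ := 0) hlip ⟨by linarith, hb0⟩
    (fun s hs => ⟨hu s (hsub (Ioo_subset_Icc_self hs)), trivial⟩)
    (fun s hs => ⟨hw s (hsub (Ioo_subset_Icc_self hs)), trivial⟩) h0 (abs_lt.1 hb1)

lemma ode_unique_near {S : Set E} (hS : IsOpen S) {F : E → E} (hF : ContDiffOn ℝ ∞ F S)
    {u w : ℝ → E} {t₀ : ℝ} (hu : ∀ᶠ t in 𝓝 t₀, HasDerivAt u (F (u t)) t)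
    (hw : ∀ᶠ t in 𝓝 t₀, HasDerivAt w (F (w t)) t) (hmem : u t₀ ∈ S) (h0 : u t₀ = w t₀) :
    u =ᶠ[𝓝 t₀] w := by
  obtain ⟨c, V, hV, hlip⟩ := ((hF.contDiffAt (hS.mem_nhds hmem)).of_le
    (m := 1) (by simp)).exists_lipschitzOnWith
  refine ODE_solution_unique_of_eventually (v := fun _ => F) (s := fun _ => V)
    (Eventually.of_forall fun _ => hlip) ?_ ?_ h0
  · filter_upwards [hu, hu.self_of_nhds.continuousAt hV] with t h1 h2 using ⟨h1, h2⟩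
  · rw [h0] at hV
    filter_upwards [hw, hw.self_of_nhds.continuousAt hV] with t h1 h2 using ⟨h1, h2⟩

end SmoothODE

/-! ## Homomorphisms of Grassmann algebras -/

section GrassmannMaps

lemma parity_cases (i : ZMod 2) : i = 0 ∨ i = 1 := by
  revert i; decide

lemma part_mul_mem {r : ℕ} {i j : ZMod 2} {x y : Grassmann r} (hx : x ∈ part i r)
    (hy : y ∈ part j r) : x * y ∈ part (i + j) r :=
  SetLike.mul_mem_graded hx hy

lemma isParityPreserving_of_ι {r r' : ℕ} (f : Grassmann r →ₐ[ℝ] Grassmann r')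
    (hf : ∀ v, f (ExteriorAlgebra.ι ℝ v) ∈ part 1 r') : IsParityPreserving f := by
  have h2 : ∀ a b, f (ExteriorAlgebra.ι ℝ a) * f (ExteriorAlgebra.ι ℝ b) ∈ part 0 r' := by
    intro a b
    have h := part_mul_mem (hf a) (hf b)
    rwa [show (1 : ZMod 2) + 1 = 0 by decide] at h
  intro i x hx
  rcases parity_cases i with rfl | rfl
  · induction x, hx using CliffordAlgebra.even_induction with
    | algebraMap c => rw [AlgHom.commutes]; exact SetLike.algebraMap_mem_graded _ _
    | add x y _ _ ihx ihy => rw [map_add]; exact add_mem ihx ihy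
    | ι_mul_ι_mul a b x _ ih =>
      rw [map_mul, map_mul]
      simpa using part_mul_mem (h2 a b) ih
  · induction x, hx using CliffordAlgebra.odd_induction with
    | ι v => exact hf v
    | add x y _ _ ihx ihy => rw [map_add]; exact add_mem ihx ihy
    | ι_mul_ι_mul a b x _ ih =>
      rw [map_mul, map_mul]
      simpa using part_mul_mem (h2 a b) ih

/-- A linear map of generators induces a parity preserving homomorphism. -/
lemma map_parity {r r' : ℕ} (L : (Fin r → ℝ) →ₗ[ℝ] (Fin r' → ℝ)) :
    IsParityPreserving (ExteriorAlgebra.map L) :=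
  isParityPreserving_of_ι _ fun v => by
    rw [ExteriorAlgebra.map_apply_ι]
    exact CliffordAlgebra.ι_mem_evenOdd_one _ _

lemma ι_mul_odd {r : ℕ} (v : Fin r → ℝ) {y : Grassmann r} (hy : y ∈ part 1 r) :
    ExteriorAlgebra.ι ℝ v * y = -(y * ExteriorAlgebra.ι ℝ v) := by
  have hswap : ∀ a b : Fin r → ℝ, ExteriorAlgebra.ι ℝ a * ExteriorAlgebra.ι ℝ b =
      -(ExteriorAlgebra.ι ℝ b * ExteriorAlgebra.ι ℝ a) := fun a b =>
    eq_neg_of_add_eq_zero_left (ExteriorAlgebra.ι_add_mul_swap a b)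
  induction y, hy using CliffordAlgebra.odd_induction with
  | ι w => exact hswap v w
  | add x y _ _ ihx ihy => rw [mul_add, add_mul, ihx, ihy, neg_add]
  | ι_mul_ι_mul a b x _ ih =>
    change ExteriorAlgebra.ι ℝ v * (ExteriorAlgebra.ι ℝ a * ExteriorAlgebra.ι ℝ b * x) =
      -(ExteriorAlgebra.ι ℝ a * ExteriorAlgebra.ι ℝ b * x * ExteriorAlgebra.ι ℝ v)
    rw [mul_assoc (ExteriorAlgebra.ι ℝ a * _) x, ← neg_eq_iff_eq_neg.2 ih, mul_assoc, ← mul_assoc,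
      hswap v a, neg_mul, mul_assoc, ← mul_assoc _ _ x, hswap v b, mul_neg, neg_neg, neg_mul,
      mul_neg, mul_assoc, mul_assoc, neg_neg]

lemma odd_mul_odd {r : ℕ} {x y : Grassmann r} (hx : x ∈ part 1 r) (hy : y ∈ part 1 r) :
    x * y = -(y * x) := by
  induction x, hx using CliffordAlgebra.odd_induction with
  | ι v => exact ι_mul_odd v hy
  | add x z _ _ ihx ihz => rw [mul_add, add_mul, ihx, ihz, neg_add]
  | ι_mul_ι_mul a b x _ ih =>
    change ExteriorAlgebra.ι ℝ a * ExteriorAlgebra.ι ℝ b * x * y =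
      -(y * (ExteriorAlgebra.ι ℝ a * ExteriorAlgebra.ι ℝ b * x))
    rw [mul_assoc, ih, mul_neg, ← mul_assoc, mul_assoc (ExteriorAlgebra.ι ℝ a), ι_mul_odd b hy,
      mul_neg, ← mul_assoc, ι_mul_odd a hy]
    simp only [neg_mul, mul_assoc, neg_neg]

/-- Anticommutativity and division by 2. This is the relation that allows `oddLift` to send the
generator of Λ₁ to an arbitrary odd element. -/
lemma odd_mul_self {r : ℕ} {x : Grassmann r} (hx : x ∈ part 1 r) : x * x = 0 := by
  have h : (2 : ℝ) • (x * x) = 0 := by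
    rw [two_smul]
    exact add_eq_zero_iff_eq_neg.2 (odd_mul_odd hx hx)
  exact (smul_eq_zero.1 h).resolve_left two_ne_zero

/-- The homomorphism `Λ₁ → Λ_r` sending the generator to an odd element. -/
def oddLift {r : ℕ} (w : part 1 r) : Grassmann 1 →ₐ[ℝ] Grassmann r :=
  ExteriorAlgebra.lift ℝ ⟨(LinearMap.proj (0 : Fin 1) : (Fin 1 → ℝ) →ₗ[ℝ] ℝ).smulRight (w : Grassmann r),
    fun v => by
      simp only [LinearMap.smulRight_apply, smul_mul_assoc, mul_smul_comm, odd_mul_self w.2,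
        smul_zero]⟩

lemma oddLift_ι {r : ℕ} (w : part 1 r) (v : Fin 1 → ℝ) :
    oddLift w (ExteriorAlgebra.ι ℝ v) = v 0 • (w : Grassmann r) := by
  rw [oddLift, ExteriorAlgebra.lift_ι_apply]
  rfl

lemma oddLift_parity {r : ℕ} (w : part 1 r) : IsParityPreserving (oddLift w) :=
  isParityPreserving_of_ι _ fun v => by
    rw [oddLift_ι]
    exact Submodule.smul_mem _ _ w.2

/-- The multiplication of the Grassmann algebra as a continuous bilinear map. -/
def mulL (r : ℕ) : Grassmann r →L[ℝ] Grassmann r →L[ℝ] Grassmann r :=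
  LinearMap.toContinuousLinearMap
    (LinearMap.toContinuousLinearMap.toLinearMap ∘ₗ LinearMap.mul ℝ (Grassmann r))

/-- Generators go to affine functions of `c`, and products preserve smoothness. The lemma makes the
limit c → 0 of scalings meaningful. -/
lemma contDiff_map_affine {r r' : ℕ} (L₀ L₁ : (Fin r → ℝ) →ₗ[ℝ] (Fin r' → ℝ)) (y : Grassmann r) :
    ContDiff ℝ ∞ fun c : ℝ => ExteriorAlgebra.map (L₀ + c • L₁) y := by
  induction y using ExteriorAlgebra.induction with
  | algebraMap a => simp only [AlgHom.commutes]; exact contDiff_const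
  | ι v =>
    have : (fun c : ℝ => ExteriorAlgebra.map (L₀ + c • L₁) (ExteriorAlgebra.ι ℝ v)) =
        fun c : ℝ => ExteriorAlgebra.ι ℝ (L₀ v) + c • ExteriorAlgebra.ι ℝ (L₁ v) := by
      funext c
      rw [ExteriorAlgebra.map_apply_ι, LinearMap.add_apply, LinearMap.smul_apply, map_add, map_smul]
    rw [this]
    fun_prop
  | mul a b ha hb =>
    simp only [map_mul]
    exact ((mulL r').contDiff.comp ha).clm_apply hb
  | add a b ha hb =>
    simp only [map_add]
    exact ha.add hb

lemma map_zero_eq_bodyHom (r r' : ℕ) :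
    ExteriorAlgebra.map (0 : (Fin r → ℝ) →ₗ[ℝ] (Fin r' → ℝ)) = bodyHom r r' := by
  apply ExteriorAlgebra.hom_ext
  ext i
  simp [bodyHom, ExteriorAlgebra.algebraMapInv]

lemma body_comp_eq {r r' : ℕ} {f : Grassmann r →ₐ[ℝ] Grassmann r'} (hf : IsParityPreserving f) :
    (body (r := r')).comp f = body := by
  apply ExteriorAlgebra.hom_ext
  ext i
  have h1 : f (ExteriorAlgebra.ι ℝ (Pi.single i 1)) ∈ part 1 r' :=
    hf 1 _ (CliffordAlgebra.ι_mem_evenOdd_one _ _)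
  have h2 : body (ExteriorAlgebra.ι ℝ (Pi.single i (1 : ℝ))) = 0 :=
    body_odd (CliffordAlgebra.ι_mem_evenOdd_one _ _)
  simp only [AlgHom.comp_toLinearMap, LinearMap.comp_apply, AlgHom.toLinearMap_apply,
    LinearMap.single_apply]
  rw [body_odd h1, h2]

lemma bodyHom_comp_eq {r r' : ℕ} {f : Grassmann r →ₐ[ℝ] Grassmann r'} (hf : IsParityPreserving f)
    (k : ℕ) : (bodyHom r' k).comp f = bodyHom r k := by
  rw [bodyHom, AlgHom.comp_assoc, body_comp_eq hf]
  rfl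

/-- The coefficient of a monomial. -/
def gcoef {r : ℕ} (I : Finset (Fin r)) : Grassmann r →ₗ[ℝ] ℝ := (grassmannBasis r).coord I

/-- Scalings are diagonal in the monomial basis, so degrees of monomials become orders of vanishing
in `c`. -/
lemma gcoef_scale {r : ℕ} (I : Finset (Fin r)) (c : ℝ) (x : Grassmann r) :
    gcoef I (ExteriorAlgebra.map (c • LinearMap.id) x) = c ^ I.card * gcoef I x := by
  have hb : ∀ J, ExteriorAlgebra.map (c • LinearMap.id) (grassmannBasis r J) =
      c ^ J.card • grassmannBasis r J := by
    intro J
    rw [grassmannBasis, ExteriorAlgebra.basis_apply]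
    simp only [ExteriorAlgebra.ιMulti_family]
    have := (ExteriorAlgebra.ιMulti ℝ J.card (M := Fin r → ℝ)).map_smul_univ (fun _ => c)
      ((Pi.basisFun ℝ (Fin r)) ∘ (Set.powersetCard.ofFinEmbEquiv.symm (Set.powersetCard.prodEquiv.symm J).2))
    simp only [Finset.prod_const, Finset.card_univ, Fintype.card_fin] at this
    exact (ExteriorAlgebra.map_apply_ιMulti _ _).trans this
  have : (gcoef I).comp (ExteriorAlgebra.map (c • LinearMap.id)).toLinearMap =
      c ^ I.card • gcoef I := by
    refine (grassmannBasis r).ext fun J => ?_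
    simp only [LinearMap.comp_apply, AlgHom.toLinearMap_apply, hb, map_smul, LinearMap.smul_apply]
    rw [gcoef, Module.Basis.coord_apply, Module.Basis.repr_self]
    by_cases h : J = I
    · rw [h]
    · rw [Finsupp.single_eq_of_ne (Ne.symm h), smul_zero, smul_zero]
  exact congrArg (fun g => g x) this

lemma gcoef_ext {r : ℕ} {x : Grassmann r} (h : ∀ I, gcoef I x = 0) : x = 0 :=
  (grassmannBasis r).ext_elem fun I => by
    have := h I
    rw [gcoef, Module.Basis.coord_apply] at this
    rw [this, map_zero]
    rfl

end GrassmannMaps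

/-! ## Points of superspaces -/

variable {s m n k l : ℕ}

section PtsMaps

/-- The superpoint `ℝ^{0|r}` with the constant map to `B`. -/
abbrev SPoint.triv (s r : ℕ) : SPoint s := ⟨r, bodyHom s r, bodyHom_parity s r⟩

/-- The map of coordinates induced by a parity preserving homomorphism that need not be compatible
with the maps to `B`. -/
def Pts.coordMap {C D : SPoint s} (f : Grassmann C.r →ₐ[ℝ] Grassmann D.r)
    (hf : IsParityPreserving f) : Pts m n C →L[ℝ] Pts m n D :=
  LinearMap.toContinuousLinearMap
    (LinearMap.prodMap ((f.toLinearMap.restrict (hf 0)).compLeft (Fin m))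
      ((f.toLinearMap.restrict (hf 1)).compLeft (Fin n)))

lemma Pts.map_eq_coordMap {C D : SPoint s} (f : C ⟶ D) :
    (Pts.map f : Pts m n C →L[ℝ] Pts m n D) = Pts.coordMap (SPoint.Hom.alg f) (SPoint.Hom.parity f) :=
  rfl

lemma Pts.coordMap_fst {C D : SPoint s} (f : Grassmann C.r →ₐ[ℝ] Grassmann D.r)
    (hf : IsParityPreserving f) (x : Pts m n C) (i : Fin m) :
    ((Pts.coordMap f hf x : Pts m n D).1 i : Grassmann D.r) = f (x.1 i) := rfl

lemma Pts.coordMap_snd {C D : SPoint s} (f : Grassmann C.r →ₐ[ℝ] Grassmann D.r)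
    (hf : IsParityPreserving f) (x : Pts m n C) (i : Fin n) :
    ((Pts.coordMap f hf x : Pts m n D).2 i : Grassmann D.r) = f (x.2 i) := rfl

lemma Pts.ext_coord {C : SPoint s} {x y : Pts m n C}
    (h₁ : ∀ i, (x.1 i : Grassmann C.r) = y.1 i) (h₂ : ∀ i, (x.2 i : Grassmann C.r) = y.2 i) :
    x = y :=
  Prod.ext (funext fun i => Subtype.ext (h₁ i)) (funext fun i => Subtype.ext (h₂ i))

lemma Pts.coordMap_coordMap {C D E : SPoint s} {f : Grassmann C.r →ₐ[ℝ] Grassmann D.r}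
    {hf : IsParityPreserving f} {g : Grassmann D.r →ₐ[ℝ] Grassmann E.r}
    {hg : IsParityPreserving g} (h : Grassmann C.r →ₐ[ℝ] Grassmann E.r)
    (hh : IsParityPreserving h) (e : g.comp f = h) (x : Pts m n C) :
    (Pts.coordMap g hg (Pts.coordMap f hf x : Pts m n D) : Pts m n E) = Pts.coordMap h hh x := by
  subst e
  rfl

/-- The map of coordinates induced by a linear map of generators. -/
def Pts.lin {C D : SPoint s} (L : (Fin C.r → ℝ) →ₗ[ℝ] (Fin D.r → ℝ)) :
    Pts m n C →L[ℝ] Pts m n D :=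
  Pts.coordMap (ExteriorAlgebra.map L) (map_parity L)

lemma Pts.lin_lin {C D E : SPoint s} (L : (Fin C.r → ℝ) →ₗ[ℝ] (Fin D.r → ℝ))
    (L' : (Fin D.r → ℝ) →ₗ[ℝ] (Fin E.r → ℝ)) (x : Pts m n C) :
    (Pts.lin L' (Pts.lin L x : Pts m n D) : Pts m n E) = Pts.lin (L' ∘ₗ L) x :=
  Pts.coordMap_coordMap _ _ (ExteriorAlgebra.map_comp_map L L') x

lemma Pts.lin_id {C : SPoint s} (x : Pts m n C) :
    (Pts.lin (LinearMap.id : (Fin C.r → ℝ) →ₗ[ℝ] (Fin C.r → ℝ)) x : Pts m n C) = x := by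
  apply Pts.ext_coord <;> intro i
  · rw [Pts.lin, Pts.coordMap_fst, ExteriorAlgebra.map_id]; rfl
  · rw [Pts.lin, Pts.coordMap_snd, ExteriorAlgebra.map_id]; rfl

lemma Pts.red_coordMap {C D : SPoint s} (f : Grassmann C.r →ₐ[ℝ] Grassmann D.r)
    (hf : IsParityPreserving f) (x : Pts m n C) :
    Pts.red (Pts.coordMap f hf x : Pts m n D) = Pts.red x :=
  funext fun i => congrArg (fun g => g (x.1 i : Grassmann C.r)) (body_comp_eq hf)

lemma Pts.red_map {C D : SPoint s} (f : C ⟶ D) (x : Pts m n C) :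
    Pts.red (Pts.map f x) = Pts.red x := Pts.red_coordMap _ (SPoint.Hom.parity f) x

lemma Pts.red_lin {C D : SPoint s} (L : (Fin C.r → ℝ) →ₗ[ℝ] (Fin D.r → ℝ)) (x : Pts m n C) :
    Pts.red (Pts.lin L x : Pts m n D) = Pts.red x := Pts.red_coordMap _ _ x

/-- The underlying point as a continuous linear map. -/
def Pts.redL (C : SPoint s) : Pts m n C →L[ℝ] (Fin m → ℝ) :=
  LinearMap.toContinuousLinearMap
    (LinearMap.pi fun i => (body (r := C.r)).toLinearMap ∘ₗ (part 0 C.r).subtype ∘ₗ LinearMap.proj i ∘ₗ LinearMap.fst ℝ _ _)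

lemma Pts.redL_apply {C : SPoint s} (x : Pts m n C) : Pts.redL C x = Pts.red x := rfl

lemma Pts.red_add {C : SPoint s} (x y : Pts m n C) : Pts.red (x + y) = Pts.red x + Pts.red y :=
  map_add (Pts.redL C) x y

lemma Pts.isOpen_red {C : SPoint s} {O : Set (Fin m → ℝ)} (hO : IsOpen O) :
    IsOpen {x : Pts m n C | Pts.red x ∈ O} :=
  hO.preimage (Pts.redL C).continuous

/-- Sending all generators to zero leaves only bodies, and odd coordinates have body zero. The two
points may live over different superpoints. -/
lemma Pts.lin_zero_congr {C D E : SPoint s} {x : Pts m n C} {y : Pts m n D}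
    (h : Pts.red x = Pts.red y) :
    (Pts.lin (0 : (Fin C.r → ℝ) →ₗ[ℝ] (Fin E.r → ℝ)) x : Pts m n E) =
      Pts.lin (0 : (Fin D.r → ℝ) →ₗ[ℝ] (Fin E.r → ℝ)) y := by
  apply Pts.ext_coord <;> intro i
  · rw [Pts.lin, Pts.lin, Pts.coordMap_fst, Pts.coordMap_fst, map_zero_eq_bodyHom,
      map_zero_eq_bodyHom]
    exact congrArg (algebraMap ℝ (Grassmann E.r)) (congrFun h i)
  · rw [Pts.lin, Pts.lin, Pts.coordMap_snd, Pts.coordMap_snd, map_zero_eq_bodyHom,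
      map_zero_eq_bodyHom]
    exact congrArg (algebraMap ℝ (Grassmann E.r))
      ((body_odd (x.2 i).2).trans (body_odd (y.2 i).2).symm)

lemma contDiff_coe_iff {X : Type*} [NormedAddCommGroup X] [NormedSpace ℝ X] {i : ZMod 2} {r : ℕ}
    {f : X → part i r} :
    ContDiff ℝ ∞ f ↔ ContDiff ℝ ∞ fun x => (f x : Grassmann r) := by
  refine ⟨fun h => (part i r).subtypeL.contDiff.comp h, fun h => ?_⟩
  obtain ⟨g, hg⟩ := (part i r).subtype.exists_leftInverse_of_injective (part i r).ker_subtype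
  have : f = fun x => g.toContinuousLinearMap (f x : Grassmann r) :=
    funext fun x => (congrArg (fun A => A (f x)) hg).symm
  rw [this]
  exact g.toContinuousLinearMap.contDiff.comp h

lemma Pts.contDiff_lin_affine {C D : SPoint s} (L₀ L₁ : (Fin C.r → ℝ) →ₗ[ℝ] (Fin D.r → ℝ))
    (x : Pts m n C) : ContDiff ℝ ∞ fun c : ℝ => (Pts.lin (L₀ + c • L₁) x : Pts m n D) := by
  refine (contDiff_pi.2 fun i => ?_).prodMk (contDiff_pi.2 fun i => ?_)
  · exact contDiff_coe_iff.2 (contDiff_map_affine L₀ L₁ (x.1 i))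
  · exact contDiff_coe_iff.2 (contDiff_map_affine L₀ L₁ (x.2 i))

/-- The coefficients of the coordinates with respect to the monomials. -/
def Pts.coef (C : SPoint s) : Pts m n C →L[ℝ] ((Fin m ⊕ Fin n) × Finset (Fin C.r) → ℝ) :=
  LinearMap.toContinuousLinearMap (LinearMap.pi fun a => gcoef a.2 ∘ₗ Sum.elim
    (fun i => (part 0 C.r).subtype ∘ₗ LinearMap.proj i ∘ₗ LinearMap.fst ℝ _ _)
    (fun i => (part 1 C.r).subtype ∘ₗ LinearMap.proj i ∘ₗ LinearMap.snd ℝ _ _) a.1)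

lemma Pts.coef_injective (C : SPoint s) : Function.Injective (Pts.coef C : Pts m n C →L[ℝ] _) := by
  refine (injective_iff_map_eq_zero _).2 fun x hx => ?_
  apply Pts.ext_coord <;> intro i
  · exact gcoef_ext fun I => congrFun hx (Sum.inl i, I)
  · exact gcoef_ext fun I => congrFun hx (Sum.inr i, I)

lemma Pts.coef_scale {C : SPoint s} (c : ℝ) (x : Pts m n C) (a) :
    Pts.coef C (Pts.lin (c • LinearMap.id : (Fin C.r → ℝ) →ₗ[ℝ] (Fin C.r → ℝ)) x) a =
      c ^ a.2.card * Pts.coef C x a := by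
  rcases a with ⟨i | i, I⟩
  · exact gcoef_scale I c _
  · exact gcoef_scale I c _

/-- The points all of whose coordinates have no monomials of degree less than `d`. -/
def Pts.vanish (m n d : ℕ) (C : SPoint s) : Submodule ℝ (Pts m n C) where
  carrier := {x | ∀ a, a.2.card < d → Pts.coef C x a = 0}
  add_mem' hx hy a ha := by rw [map_add, Pi.add_apply, hx a ha, hy a ha, add_zero]
  zero_mem' a _ := by rw [map_zero]; rfl
  smul_mem' c x hx a ha := by rw [map_smul, Pi.smul_apply, hx a ha, smul_zero]

lemma Pts.vanish_zero {C : SPoint s} (x : Pts m n C) : x ∈ Pts.vanish m n 0 C :=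
  fun _ ha => absurd ha (Nat.not_lt_zero _)

/-- No monomial has degree above the number of generators. This finiteness makes the later
degree-by-degree iterations stop. -/
lemma Pts.eq_zero_of_vanish {C : SPoint s} {x : Pts m n C} {d : ℕ} (hx : x ∈ Pts.vanish m n d C)
    (hd : C.r < d) : x = 0 := by
  refine (injective_iff_map_eq_zero _).1 (Pts.coef_injective C) x (funext fun a => hx a ?_)
  have := a.2.card_le_univ
  rw [Fintype.card_fin] at this
  omega

/-- The scaling of the generators. -/
abbrev Pts.scale {C : SPoint s} (c : ℝ) : Pts m n C →L[ℝ] Pts m n C :=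
  Pts.lin (c • LinearMap.id : (Fin C.r → ℝ) →ₗ[ℝ] (Fin C.r → ℝ))

lemma isBigO_coef_iff {C : SPoint s} {f : ℝ → Pts m n C} {g : ℝ → ℝ} :
    f =O[𝓝 0] g ↔ ∀ a, (fun c => Pts.coef C (f c) a) =O[𝓝 0] g := by
  refine Iff.trans ?_ (Asymptotics.isBigO_pi (f := fun c => Pts.coef C (f c)) (g' := g))
  refine ⟨fun h => ((Pts.coef C).isBigO_comp f _).trans h, fun h => ?_⟩
  obtain ⟨K, -, hK⟩ := (Pts.coef C : Pts m n C →L[ℝ] _).toLinearMap.exists_antilipschitzWith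
    (LinearMap.ker_eq_bot.2 (Pts.coef_injective C))
  refine Asymptotics.IsBigO.trans (Asymptotics.IsBigO.of_bound K (Eventually.of_forall fun c => ?_)) h
  simpa using hK.le_mul_dist (f c) 0

/-- Each coefficient is multiplied by c to its degree. The analytic form of the filtration lets it
be combined with Fréchet differentiability and with boundedness of linear maps. -/
lemma Pts.mem_vanish_iff {C : SPoint s} {x : Pts m n C} {d : ℕ} :
    x ∈ Pts.vanish m n d C ↔ (fun c : ℝ => Pts.scale c x) =O[𝓝 0] fun c : ℝ => c ^ d := by
  rw [isBigO_coef_iff]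
  refine forall_congr' fun a => ?_
  simp only [Pts.coef_scale]
  constructor
  · intro h
    by_cases ha : a.2.card < d
    · simp only [h ha, mul_zero]
      exact Asymptotics.isBigO_zero _ _
    · have : (fun c : ℝ => c ^ a.2.card) =O[𝓝 0] fun c : ℝ => c ^ d :=
        Asymptotics.IsBigO.of_bound 1 (by
          filter_upwards [Metric.closedBall_mem_nhds (0 : ℝ) one_pos] with c hc
          rw [mem_closedBall_zero_iff] at hc
          rw [norm_pow, norm_pow, one_mul]
          exact pow_le_pow_of_le_one (norm_nonneg c) hc (not_lt.1 ha))
      simpa [mul_comm] using this.const_mul_left (Pts.coef C x a)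
  · intro h ha
    by_contra h0
    have h1 : (fun c : ℝ => c ^ a.2.card) =O[𝓝 0] fun c : ℝ => c ^ d := by
      have := h.const_mul_left (Pts.coef C x a)⁻¹
      refine this.congr_left fun c => ?_
      field_simp
    -- A nonzero coefficient of degree less than `d` would make a power of c little-o of itself,
    -- which is absurd on a punctured neighbourhood.
    have h2 := h1.trans_isLittleO (Asymptotics.isLittleO_pow_pow (𝕜 := ℝ) ha)
    have h3 := (h2.mono nhdsWithin_le_nhds : _ =o[𝓝[≠] (0 : ℝ)] _)
    refine Asymptotics.isLittleO_irrefl (Eventually.frequently ?_) h3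
    filter_upwards [self_mem_nhdsWithin] with c hc using pow_ne_zero _ hc

/-- Only integer powers of c occur in the coefficients, so being o of one power forces the next one.
-/
lemma Pts.mem_vanish_succ_of_isLittleO {C : SPoint s} {x : Pts m n C} {d : ℕ}
    (h : (fun c : ℝ => Pts.scale c x) =o[𝓝 0] fun c : ℝ => c ^ d) :
    x ∈ Pts.vanish m n (d + 1) C := by
  intro a ha
  by_contra h0
  have h1 : (fun c : ℝ => c ^ a.2.card) =o[𝓝 0] fun c : ℝ => c ^ d := by
    have h2 : (fun c : ℝ => Pts.coef C (Pts.scale c x) a) =o[𝓝 0] fun c : ℝ => c ^ d :=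
      (((ContinuousLinearMap.proj (R := ℝ) a).comp (Pts.coef C)).isBigO_comp _ _).trans_isLittleO h
    simp only [Pts.coef_scale] at h2
    refine (h2.const_mul_left (Pts.coef C x a)⁻¹).congr_left fun c => ?_
    field_simp
  have h2 : (fun c : ℝ => c ^ d) =O[𝓝 0] fun c : ℝ => c ^ a.2.card :=
    Asymptotics.IsBigO.of_bound 1 (by
      filter_upwards [Metric.closedBall_mem_nhds (0 : ℝ) one_pos] with c hc
      rw [mem_closedBall_zero_iff] at hc
      rw [norm_pow, norm_pow, one_mul]
      exact pow_le_pow_of_le_one (norm_nonneg c) hc (by omega))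
  have h3 := ((h2.trans_isLittleO h1).mono nhdsWithin_le_nhds : _ =o[𝓝[≠] (0 : ℝ)] _)
  refine Asymptotics.isLittleO_irrefl (Eventually.frequently ?_) h3
  filter_upwards [self_mem_nhdsWithin] with c hc using pow_ne_zero _ hc

/-- Linear maps of generators commute with scalings, so they do not worsen the order in c. -/
lemma Pts.lin_mem_vanish {C D : SPoint s} (L : (Fin C.r → ℝ) →ₗ[ℝ] (Fin D.r → ℝ))
    {x : Pts m n C} {d : ℕ} (hx : x ∈ Pts.vanish m n d C) :
    (Pts.lin L x : Pts m n D) ∈ Pts.vanish m n d D := by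
  rw [Pts.mem_vanish_iff] at hx ⊢
  refine ((Pts.lin L : Pts m n C →L[ℝ] Pts m n D).isBigO_comp _ _).trans hx |>.congr_left fun c => ?_
  change Pts.lin L (Pts.lin _ x : Pts m n C) = (Pts.lin _ (Pts.lin L x : Pts m n D) : Pts m n D)
  rw [Pts.lin_lin, Pts.lin_lin]
  congr 2
  ext
  simp

lemma Pts.mem_vanish_one_iff {C : SPoint s} {x : Pts m n C} :
    x ∈ Pts.vanish m n 1 C ↔ Pts.lin (0 : (Fin C.r → ℝ) →ₗ[ℝ] (Fin C.r → ℝ)) x = (0 : Pts m n C) := by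
  have h : ∀ a, Pts.coef C (Pts.lin (0 : (Fin C.r → ℝ) →ₗ[ℝ] (Fin C.r → ℝ)) x : Pts m n C) a =
      0 ^ a.2.card * Pts.coef C x a := fun a => by
    rw [← Pts.coef_scale, zero_smul]
  constructor
  · intro hx
    refine (injective_iff_map_eq_zero _).1 (Pts.coef_injective C) _ (funext fun a => ?_)
    rw [h]
    by_cases ha : a.2.card < 1
    · rw [hx a ha, mul_zero]; rfl
    · rw [zero_pow (by omega), zero_mul]; rfl
  · intro hx a ha
    have h1 := h a
    rw [hx, map_zero, show a.2.card = 0 by omega, pow_zero, one_mul] at h1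
    exact h1.symm

lemma Pts.sub_mem_vanish_one {C : SPoint s} {x y : Pts m n C} (h : Pts.red x = Pts.red y) :
    x - y ∈ Pts.vanish m n 1 C := by
  rw [Pts.mem_vanish_one_iff, map_sub, sub_eq_zero]
  exact Pts.lin_zero_congr h

lemma Pts.red_eq_zero_of_vanish {C : SPoint s} {x : Pts m n C} {d : ℕ}
    (hx : x ∈ Pts.vanish m n d C) (hd : 1 ≤ d) : Pts.red x = 0 := by
  have h1 : x ∈ Pts.vanish m n 1 C := fun a ha => hx a (by omega)
  rw [← Pts.red_lin (C := C) (D := C) 0 x, Pts.mem_vanish_one_iff.1 h1]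
  exact map_zero (Pts.redL (n := n) C)

/-- The point of `ℝ^{m|n}(C)` given by a point of `ℝ^m`. -/
def Pts.real (C : SPoint s) (x : Fin m → ℝ) : Pts m n C :=
  (fun i => ⟨algebraMap ℝ _ (x i), SetLike.algebraMap_mem_graded _ _⟩, 0)

lemma Pts.red_real (C : SPoint s) (x : Fin m → ℝ) :
    Pts.red (Pts.real C x : Pts m n C) = x :=
  funext fun _ => AlgHom.commutes _ _

lemma Pts.coordMap_real {C D : SPoint s} (f : Grassmann C.r →ₐ[ℝ] Grassmann D.r)
    (hf : IsParityPreserving f) (x : Fin m → ℝ) :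
    (Pts.coordMap f hf (Pts.real C x : Pts m n C) : Pts m n D) = Pts.real D x := by
  apply Pts.ext_coord <;> intro i
  · exact AlgHom.commutes _ _
  · exact map_zero f

lemma Pts.lin_zero_eq_real {C D : SPoint s} (x : Pts m n C) :
    (Pts.lin (0 : (Fin C.r → ℝ) →ₗ[ℝ] (Fin D.r → ℝ)) x : Pts m n D) = Pts.real D (Pts.red x) := by
  rw [Pts.lin_zero_congr (D := C) (y := Pts.real C (Pts.red x)) (Pts.red_real _ _).symm]
  exact Pts.coordMap_real _ _ _

end PtsMaps

/-! ### Doubling the generators of a superpoint. -/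

section Doubling

/-- The generators of `C × ℝ^{0|r}` as pairs. -/
def splitGen (r : ℕ) : (Fin (r + r) → ℝ) ≃ₗ[ℝ] (Fin r → ℝ) × (Fin r → ℝ) :=
  (LinearEquiv.funCongrLeft ℝ ℝ finSumFinEquiv).trans
    (LinearEquiv.sumArrowLequivProdArrow (Fin r) (Fin r) ℝ ℝ)

/-- The inclusion of the first block of generators. -/
def inclFst (r : ℕ) : (Fin r → ℝ) →ₗ[ℝ] (Fin (r + r) → ℝ) :=
  (splitGen r).symm.toLinearMap ∘ₗ LinearMap.inl ℝ _ _

/-- The inclusion of the second block of generators. -/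
def inclSnd (r : ℕ) : (Fin r → ℝ) →ₗ[ℝ] (Fin (r + r) → ℝ) :=
  (splitGen r).symm.toLinearMap ∘ₗ LinearMap.inr ℝ _ _

/-- The identification of the two blocks of generators. -/
def foldGen (r : ℕ) : (Fin (r + r) → ℝ) →ₗ[ℝ] (Fin r → ℝ) :=
  (LinearMap.fst ℝ _ _ + LinearMap.snd ℝ _ _) ∘ₗ (splitGen r).toLinearMap

/-- The projection to the second block of generators. -/
def projSnd (r : ℕ) : (Fin (r + r) → ℝ) →ₗ[ℝ] (Fin r → ℝ) :=
  LinearMap.snd ℝ _ _ ∘ₗ (splitGen r).toLinearMap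

/-- The scaling of the first block of generators. -/
def scaleFst (r : ℕ) (c : ℝ) : (Fin (r + r) → ℝ) →ₗ[ℝ] (Fin (r + r) → ℝ) :=
  (splitGen r).symm.toLinearMap ∘ₗ
    (LinearMap.inr ℝ _ _ ∘ₗ LinearMap.snd ℝ _ _ + c • (LinearMap.inl ℝ _ _ ∘ₗ LinearMap.fst ℝ _ _))
      ∘ₗ (splitGen r).toLinearMap

/-- The scaling of the second block of generators. -/
def scaleSnd (r : ℕ) (c : ℝ) : (Fin (r + r) → ℝ) →ₗ[ℝ] (Fin (r + r) → ℝ) :=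
  (splitGen r).symm.toLinearMap ∘ₗ
    (LinearMap.inl ℝ _ _ ∘ₗ LinearMap.fst ℝ _ _ + c • (LinearMap.inr ℝ _ _ ∘ₗ LinearMap.snd ℝ _ _))
      ∘ₗ (splitGen r).toLinearMap

variable (r : ℕ)

lemma foldGen_inclFst : foldGen r ∘ₗ inclFst r = LinearMap.id := by
  apply LinearMap.ext; intro x; simp [foldGen, inclFst]

lemma foldGen_inclSnd : foldGen r ∘ₗ inclSnd r = LinearMap.id := by
  apply LinearMap.ext; intro x; simp [foldGen, inclSnd]

lemma projSnd_inclFst : projSnd r ∘ₗ inclFst r = 0 := by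
  apply LinearMap.ext; intro x; simp [projSnd, inclFst]

lemma projSnd_inclSnd : projSnd r ∘ₗ inclSnd r = LinearMap.id := by
  apply LinearMap.ext; intro x; simp [projSnd, inclSnd]

/-- The structure map of the doubled superpoint lands in the first block. This identity is what
makes scaling of the second block a morphism over `B`. -/
lemma scaleSnd_inclFst (c : ℝ) : scaleSnd r c ∘ₗ inclFst r = inclFst r := by
  apply LinearMap.ext; intro x; simp [scaleSnd, inclFst]

lemma scaleSnd_inclSnd (c : ℝ) : scaleSnd r c ∘ₗ inclSnd r = inclSnd r ∘ₗ (c • LinearMap.id) := by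
  apply LinearMap.ext; intro x; simp [scaleSnd, inclSnd]

lemma scaleSnd_scaleSnd (c d : ℝ) : scaleSnd r c ∘ₗ scaleSnd r d = scaleSnd r (c * d) := by
  apply LinearMap.ext; intro x; simp [scaleSnd, mul_smul]

lemma scaleSnd_one : scaleSnd r 1 = LinearMap.id := by
  apply LinearMap.ext; intro x; simp [scaleSnd]

/-- Both blocks together carry the scaling of the identified generators. Only the factor on the
second block is controlled by naturality; the factor on the first is merely a smooth family of
operators and is handled by estimates. -/
lemma foldGen_scale (c : ℝ) :
    (c • LinearMap.id) ∘ₗ foldGen r = foldGen r ∘ₗ scaleFst r c ∘ₗ scaleSnd r c := by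
  apply LinearMap.ext; intro x; simp [scaleSnd, scaleFst, foldGen]

lemma projSnd_scaleSnd (c : ℝ) : projSnd r ∘ₗ scaleSnd r c = (c • LinearMap.id) ∘ₗ projSnd r := by
  apply LinearMap.ext; intro x; simp [scaleSnd, projSnd]

lemma scaleFst_zero : scaleFst r 0 = inclSnd r ∘ₗ projSnd r := by
  apply LinearMap.ext; intro x; simp [scaleFst, projSnd, inclSnd]

variable {r}

/-- The superpoint `C × ℝ^{0|r}` over `B`, where `C = ℝ^{0|r}`. -/
abbrev SPoint.double (C : SPoint s) : SPoint s :=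
  ⟨C.r + C.r, (ExteriorAlgebra.map (inclFst C.r)).comp C.str, fun i x hx =>
    map_parity _ i _ (C.str_parity i x hx)⟩

/-- A linear map of generators compatible with the maps to `B` is a morphism of superpoints. -/
def SPoint.linHom {C D : SPoint s} (L : (Fin C.r → ℝ) →ₗ[ℝ] (Fin D.r → ℝ))
    (h : (ExteriorAlgebra.map L).comp C.str = D.str) : C ⟶ D :=
  SPoint.Hom.mk (ExteriorAlgebra.map L) (map_parity L) h

variable (C : SPoint s)

lemma double_comp {r' : ℕ} (L : (Fin (C.r + C.r) → ℝ) →ₗ[ℝ] (Fin r' → ℝ)) :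
    (ExteriorAlgebra.map L).comp C.double.str = (ExteriorAlgebra.map (L ∘ₗ inclFst C.r)).comp C.str := by
  change (ExteriorAlgebra.map L).comp ((ExteriorAlgebra.map (inclFst C.r)).comp C.str) = _
  rw [← AlgHom.comp_assoc, ExteriorAlgebra.map_comp_map]

/-- The projection `C × ℝ^{0|r} → C`. -/
def SPoint.inclHom : C ⟶ C.double := SPoint.linHom (inclFst C.r) rfl

/-- The diagonal `C → C × ℝ^{0|r}`. -/
def SPoint.foldHom : C.double ⟶ C := SPoint.linHom (foldGen C.r) (by
  rw [double_comp, foldGen_inclFst, ExteriorAlgebra.map_id]; rfl)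

/-- The scaling of the second factor of `C × ℝ^{0|r}`. -/
def SPoint.scaleHom (c : ℝ) : C.double ⟶ C.double := SPoint.linHom (scaleSnd C.r c) (by
  rw [double_comp, scaleSnd_inclFst])

/-- The inclusion of the second factor of `C × ℝ^{0|r}`. -/
def SPoint.projHom : C.double ⟶ SPoint.triv s C.r := SPoint.linHom (projSnd C.r) (by
  rw [double_comp, projSnd_inclFst, map_zero_eq_bodyHom, bodyHom_comp_eq C.str_parity])

/-- The scaling of `ℝ^{0|r}`. -/
def SPoint.trivHom {r r' : ℕ} (L : (Fin r → ℝ) →ₗ[ℝ] (Fin r' → ℝ)) :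
    SPoint.triv s r ⟶ SPoint.triv s r' := SPoint.linHom L (by
  ext i
  simp [bodyHom])

/-- The map `ℝ^{0|r} → ℝ^{0|1}` given by an odd element. -/
def SPoint.oddHom {r : ℕ} (w : part 1 r) : SPoint.triv s 1 ⟶ SPoint.triv s r :=
  SPoint.Hom.mk (C := SPoint.triv s 1) (D := SPoint.triv s r) (oddLift w) (oddLift_parity w) (by
    ext i
    simp [bodyHom])

end Doubling

/-! ## The filtration by powers of the nilpotent ideal -/

variable {s m n k l : ℕ}

section Filtration

lemma contDiff_scaleFst (C : SPoint s) : ContDiff ℝ ∞ fun c : ℝ =>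
    (Pts.lin (scaleFst C.r c) : Pts m n C.double →L[ℝ] Pts m n C.double) := by
  refine contDiff_clm_apply_iff.2 fun y => ?_
  have h : ∀ c, scaleFst C.r c =
      ((splitGen C.r).symm.toLinearMap ∘ₗ (LinearMap.inr ℝ _ _ ∘ₗ LinearMap.snd ℝ _ _) ∘ₗ
        (splitGen C.r).toLinearMap) + c • ((splitGen C.r).symm.toLinearMap ∘ₗ
        (LinearMap.inl ℝ _ _ ∘ₗ LinearMap.fst ℝ _ _) ∘ₗ (splitGen C.r).toLinearMap) := by
    intro c
    apply LinearMap.ext; intro x; simp [scaleFst, ← map_smul, ← map_add]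
  simp only [h]
  exact Pts.contDiff_lin_affine _ _ y

lemma scale_fold {C : SPoint s} (c : ℝ) (y : Pts m n C.double) :
    Pts.scale c (Pts.lin (foldGen C.r) y : Pts m n C) =
      Pts.lin (foldGen C.r) (Pts.lin (scaleFst C.r c)
        (Pts.lin (scaleSnd C.r c) y : Pts m n C.double) : Pts m n C.double) := by
  change Pts.lin _ (Pts.lin (foldGen C.r) y : Pts m n C) = _
  rw [Pts.lin_lin, Pts.lin_lin, Pts.lin_lin, foldGen_scale, LinearMap.comp_assoc]

lemma isBigO_clm_apply {E E' : Type*} [NormedAddCommGroup E] [NormedSpace ℝ E]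
    [NormedAddCommGroup E'] [NormedSpace ℝ E'] {A : ℝ → E →L[ℝ] E'} {f : ℝ → E} {g h : ℝ → ℝ}
    (hA : A =O[𝓝 0] g) (hf : f =O[𝓝 0] h) : (fun c => A c (f c)) =O[𝓝 0] fun c => g c * h c :=
  (Asymptotics.IsBigO.of_bound 1 (Eventually.of_forall fun c => by
    simpa using (A c).le_opNorm (f c))).trans (hA.norm_left.mul hf.norm_left)

/-- The scalings of the first block stay bounded as c → 0, so orders of vanishing can be measured
with the second block alone. -/
lemma isBigO_scale_fold {C : SPoint s} (y : Pts m n C.double) :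
    (fun c => Pts.scale c (Pts.lin (foldGen C.r) y : Pts m n C)) =O[𝓝 0]
      fun c => (Pts.lin (scaleSnd C.r c) y : Pts m n C.double) := by
  have h1 : (fun c : ℝ => (Pts.lin (scaleFst C.r c) : Pts m n C.double →L[ℝ] Pts m n C.double))
      =O[𝓝 0] fun _ => (1 : ℝ) := (contDiff_scaleFst C).continuous.continuousAt.isBigO_one ℝ
  have h2 := isBigO_clm_apply h1 (Asymptotics.isBigO_refl
    (fun c => (Pts.lin (scaleSnd C.r c) y : Pts m n C.double)) _).norm_right
  simp only [one_mul] at h2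
  simp only [scale_fold]
  exact ((Pts.lin (foldGen C.r) : Pts m n C.double →L[ℝ] Pts m n C).isBigO_comp _ _).trans
    h2.of_norm_right

lemma fold_mem_vanish_of_isLittleO {C : SPoint s} {y : Pts m n C.double} {d : ℕ}
    (h : (fun c => (Pts.lin (scaleSnd C.r c) y : Pts m n C.double)) =o[𝓝 0] fun c => c ^ d) :
    (Pts.lin (foldGen C.r) y : Pts m n C) ∈ Pts.vanish m n (d + 1) C :=
  Pts.mem_vanish_succ_of_isLittleO ((isBigO_scale_fold y).trans_isLittleO h)

/-- One order more than the hypothesis comes from the first block: if the part of `y` free of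
first-block generators is zero, scaling that block contributes another factor c. -/
lemma fold_mem_vanish_of_proj {C : SPoint s} {y : Pts m n C.double} {d : ℕ}
    (h : (fun c => (Pts.lin (scaleSnd C.r c) y : Pts m n C.double)) =O[𝓝 0] fun c => c ^ d)
    (hy : (Pts.lin (projSnd C.r) y : Pts m n C) = 0) :
    (Pts.lin (foldGen C.r) y : Pts m n C) ∈ Pts.vanish m n (d + 1) C := by
  rw [Pts.mem_vanish_iff]
  let A : ℝ → Pts m n C.double →L[ℝ] Pts m n C.double := fun c => Pts.lin (scaleFst C.r c)
  have h1 : (fun c => A c - A 0) =O[𝓝 0] fun c : ℝ => c := by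
    have := ((contDiff_scaleFst (m := m) (n := n) C).differentiable (by simp) 0).isBigO_sub
    simpa using this
  -- `A 0` factors through the projection to the second block, which kills `y`. Hence `A c` may be
  -- replaced by `A c - A 0`, which is O(c).
  have h2 : ∀ c, A 0 (Pts.lin (scaleSnd C.r c) y : Pts m n C.double) = 0 := by
    intro c
    change (Pts.lin (scaleFst C.r 0) (Pts.lin (scaleSnd C.r c) y : Pts m n C.double) :
      Pts m n C.double) = 0
    rw [scaleFst_zero, Pts.lin_lin, LinearMap.comp_assoc, projSnd_scaleSnd,
      ← LinearMap.comp_assoc, ← Pts.lin_lin (D := C), hy, map_zero]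
  have h3 := isBigO_clm_apply h1 h
  have h4 : (fun c => (Pts.lin (scaleFst C.r c) (Pts.lin (scaleSnd C.r c) y : Pts m n C.double) :
      Pts m n C.double)) =O[𝓝 0] fun c : ℝ => c ^ (d + 1) := by
    refine h3.congr (fun c => ?_) (fun c => (pow_succ' c d).symm)
    rw [sub_apply, h2, sub_zero]
  simp only [scale_fold]
  exact ((Pts.lin (foldGen C.r) : Pts m n C.double →L[ℝ] Pts m n C).isBigO_comp _ _).trans h4

lemma lin_scaleSnd_inclSnd {C : SPoint s} (c : ℝ) (v : Pts m n C) :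
    (Pts.lin (scaleSnd C.r c) (Pts.lin (inclSnd C.r) v : Pts m n C.double) : Pts m n C.double) =
      Pts.lin (inclSnd C.r) (Pts.scale c v) := by
  rw [Pts.lin_lin, Pts.scale, Pts.lin_lin, scaleSnd_inclSnd]

lemma lin_scaleSnd_inclFst {C : SPoint s} (c : ℝ) (v : Pts m n C) :
    (Pts.lin (scaleSnd C.r c) (Pts.lin (inclFst C.r) v : Pts m n C.double) : Pts m n C.double) =
      Pts.lin (inclFst C.r) v := by
  rw [Pts.lin_lin, scaleSnd_inclFst]

lemma lin_fold_inclFst {C : SPoint s} (v : Pts m n C) :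
    (Pts.lin (foldGen C.r) (Pts.lin (inclFst C.r) v : Pts m n C.double) : Pts m n C) = v := by
  rw [Pts.lin_lin, foldGen_inclFst]; exact Pts.lin_id v

lemma lin_fold_inclSnd {C : SPoint s} (v : Pts m n C) :
    (Pts.lin (foldGen C.r) (Pts.lin (inclSnd C.r) v : Pts m n C.double) : Pts m n C) = v := by
  rw [Pts.lin_lin, foldGen_inclSnd]; exact Pts.lin_id v

/-- The open subfunctor of `ℝ^{m|n}` over an open set of `ℝ^m`. -/
def redSet (n : ℕ) (O : Set (Fin m → ℝ)) (C : SPoint s) : Set (Pts m n C) := {x | Pts.red x ∈ O}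

lemma IsSupersmoothOn.fderiv_natural {S : ∀ C : SPoint s, Set (Pts m n C)}
    {F : ∀ C : SPoint s, Pts m n C → Pts k l C} (hF : IsSupersmoothOn S F)
    (hS : ∀ C, IsOpen (S C)) {C D : SPoint s} (f : C ⟶ D) {x : Pts m n C} (hx : x ∈ S C)
    (v : Pts m n C) :
    fderiv ℝ (F D) (Pts.map f x) (Pts.map f v) = Pts.map f (fderiv ℝ (F C) x v) := by
  have hC := (((hF.smooth C).contDiffAt ((hS C).mem_nhds hx)).differentiableAt
    (by simp)).hasFDerivAt
  have hD := (((hF.smooth D).contDiffAt ((hS D).mem_nhds (hF.natural f x hx).1)).differentiableAt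
    (by simp)).hasFDerivAt
  have h1 := hD.comp x (Pts.map f).hasFDerivAt
  have h2 := (Pts.map f).hasFDerivAt.comp x hC
  have h3 : (F D ∘ Pts.map f) =ᶠ[𝓝 x] Pts.map f ∘ F C := by
    filter_upwards [(hS C).mem_nhds hx] with y hy using (hF.natural f y hy).2
  exact congrArg (fun A => A v) (h1.unique (h2.congr_of_eventuallyEq h3))

variable {O : Set (Fin m → ℝ)} {F : ∀ C : SPoint s, Pts m n C → Pts k l C}

lemma isOpen_redSet (hO : IsOpen O) (C : SPoint s) : IsOpen (redSet n O C) := Pts.isOpen_red hO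

lemma map_mem_redSet {C D : SPoint s} (f : C ⟶ D) {x : Pts m n C} (hx : x ∈ redSet n O C) :
    Pts.map f x ∈ redSet n O D := by
  change Pts.red _ ∈ O
  rw [Pts.red_map]
  exact hx

lemma add_mem_redSet {C : SPoint s} {x v : Pts m n C} (hx : x ∈ redSet n O C) {d : ℕ} (hd : 1 ≤ d)
    (hv : v ∈ Pts.vanish m n d C) : x + v ∈ redSet n O C := by
  change Pts.red _ ∈ O
  rw [Pts.red_add, Pts.red_eq_zero_of_vanish hv hd, add_zero]
  exact hx

/-- With `x` in the first block and `v` in the second, scaling the second block fixes the base point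
and turns the remainder at `v` into the remainder at the scaled `v`. Fréchet differentiability at
that fixed point makes it o(c^d), and identifying the blocks recovers the original remainder. -/
lemma IsSupersmoothOn.taylor_mem_vanish (hF : IsSupersmoothOn (redSet n O) F) (hO : IsOpen O)
    {C : SPoint s} {x : Pts m n C} (hx : x ∈ redSet n O C) {d : ℕ} (hd : 1 ≤ d) {v : Pts m n C}
    (hv : v ∈ Pts.vanish m n d C) :
    F C (x + v) - F C x - fderiv ℝ (F C) x v ∈ Pts.vanish k l (d + 1) C := by
  set x' := Pts.map C.inclHom x with hx'
  have hx'S : x' ∈ redSet n O C.double := map_mem_redSet _ hx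
  set v' : Pts m n C → Pts m n C.double := fun v => Pts.lin (inclSnd C.r) v with hv'
  have hsum : ∀ u ∈ Pts.vanish m n d C, x' + v' u ∈ redSet n O C.double := fun u hu =>
    add_mem_redSet hx'S hd (Pts.lin_mem_vanish _ hu)
  set R : Pts m n C → Pts k l C.double := fun u =>
    F C.double (x' + v' u) - F C.double x' - fderiv ℝ (F C.double) x' (v' u) with hR
  have key : F C (x + v) - F C x - fderiv ℝ (F C) x v = Pts.lin (foldGen C.r) (R v) := by
    have h1 := hF.fderiv_natural (isOpen_redSet hO) C.foldHom hx'S (v' v)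
    have h2 : Pts.map C.foldHom x' = x := lin_fold_inclFst x
    have h3 : Pts.map C.foldHom (v' v) = v := lin_fold_inclSnd v
    have h4 := (hF.natural C.foldHom _ (hsum v hv)).2
    have h5 := (hF.natural C.foldHom _ hx'S).2
    rw [map_add, h2, h3] at h4
    rw [h2] at h5
    rw [h2, h3] at h1
    change _ = Pts.map C.foldHom (R v)
    rw [hR, map_sub, map_sub, h4, h5, h1]
  rw [key]
  apply fold_mem_vanish_of_isLittleO
  have hscale : ∀ c, Pts.scale c v ∈ Pts.vanish m n d C := fun c => Pts.lin_mem_vanish _ hv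
  have h4 : ∀ c, (Pts.lin (scaleSnd C.r c) (R v) : Pts k l C.double) = R (Pts.scale c v) := by
    intro c
    have h1 := hF.fderiv_natural (isOpen_redSet hO) (C.scaleHom c) hx'S (v' v)
    have h2 : Pts.map (C.scaleHom c) x' = x' := lin_scaleSnd_inclFst c x
    have h3 : Pts.map (C.scaleHom c) (v' v) = v' (Pts.scale c v) := lin_scaleSnd_inclSnd c v
    have h4 := (hF.natural (C.scaleHom c) _ (hsum v hv)).2
    have h5 := (hF.natural (C.scaleHom c) _ hx'S).2
    rw [map_add, h2, h3] at h4
    rw [h2] at h5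
    rw [h2, h3] at h1
    change Pts.map (C.scaleHom c) (R v) = _
    rw [hR, map_sub, map_sub, ← h4, ← h5, ← h1]
  simp only [h4]
  have hO1 : (fun c => v' (Pts.scale c v)) =O[𝓝 0] fun c : ℝ => c ^ d :=
    ((Pts.lin (inclSnd C.r) : Pts m n C →L[ℝ] Pts m n C.double).isBigO_comp _ _).trans
      (Pts.mem_vanish_iff.1 hv)
  have htend : Tendsto (fun c => v' (Pts.scale c v)) (𝓝 0) (𝓝 0) := by
    refine hO1.trans_tendsto ?_
    have : Tendsto (fun c : ℝ => c ^ d) (𝓝 0) (𝓝 (0 ^ d)) := (continuous_pow d).tendsto 0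
    rwa [zero_pow (by omega)] at this
  have hder := (((hF.smooth C.double).contDiffAt ((isOpen_redSet hO _).mem_nhds hx'S)).differentiableAt
    (by simp)).hasFDerivAt
  rw [hasFDerivAt_iff_isLittleO_nhds_zero] at hder
  exact (hder.comp_tendsto htend).trans_isBigO hO1

end Filtration

/-! ## The inverse function theorem -/

variable {s m n k l : ℕ}

section InverseFunction

variable {O : Set (Fin m → ℝ)} {F : ∀ C : SPoint s, Pts m n C → Pts m n C}

/-- The odd basis vectors over `ℝ^{0|1}`. -/
def oddUnit (s m n : ℕ) (j : Fin n) : Pts m n (SPoint.triv s 1) :=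
  (0, Pi.single j ⟨ExteriorAlgebra.ι ℝ (fun _ => 1), CliffordAlgebra.ι_mem_evenOdd_one _ _⟩)

/-- Even coordinates are multiples of real basis vectors by even elements. An odd coordinate cannot
be obtained so, and is instead the image of an odd unit over ℝ^{0|1} under the morphism given by
that odd element. -/
lemma Pts.eq_sum_units {r : ℕ} (w : Pts m n (SPoint.triv s r)) :
    w = ∑ i, Pts.esmul (w.1 i) (Pts.real (SPoint.triv s r) (Pi.single i 1)) +
      ∑ j, Pts.map (SPoint.oddHom (w.2 j)) (oddUnit s m n j) := by
  have hodd : ∀ j i, (((Pts.map (SPoint.oddHom (w.2 j)) (oddUnit s m n j) :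
      Pts m n (SPoint.triv s r)).2 i : part 1 r) : Grassmann r) =
      if i = j then (w.2 j : Grassmann r) else 0 := by
    intro j i
    change oddLift (w.2 j) (((Pi.single j _ : Fin n → part 1 1) i : part 1 1) : Grassmann 1) = _
    by_cases h : i = j
    · subst h
      rw [Pi.single_eq_same, if_pos rfl, oddLift_ι, one_smul]
    · rw [Pi.single_eq_of_ne h, if_neg h]
      exact map_zero _
  have heven : ∀ j i, (((Pts.esmul (w.1 j) (Pts.real (SPoint.triv s r) (Pi.single j 1)) :
      Pts m n (SPoint.triv s r)).1 i : part 0 r) : Grassmann r) =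
      if i = j then (w.1 j : Grassmann r) else 0 := by
    intro j i
    change (w.1 j : Grassmann r) * algebraMap ℝ _ ((Pi.single j 1 : Fin m → ℝ) i) = _
    by_cases h : i = j
    · subst h
      rw [Pi.single_eq_same, map_one, mul_one, if_pos rfl]
    · rw [Pi.single_eq_of_ne h, map_zero, mul_zero, if_neg h]
  have heven2 : ∀ j i, (((Pts.esmul (w.1 j) (Pts.real (SPoint.triv s r) (Pi.single j 1)) :
      Pts m n (SPoint.triv s r)).2 i : part 1 r) : Grassmann r) = 0 := fun j i => mul_zero _
  have hodd1 : ∀ j i, (((Pts.map (SPoint.oddHom (w.2 j)) (oddUnit s m n j) :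
      Pts m n (SPoint.triv s r)).1 i : part 0 r) : Grassmann r) = 0 := fun j i => map_zero _
  apply Pts.ext_coord <;> intro i
  · simp only [Prod.fst_add, Prod.fst_sum, Pi.add_apply, Finset.sum_apply, Submodule.coe_add,
      Submodule.coe_sum, heven, hodd1]
    simp
  · simp only [Prod.snd_add, Prod.snd_sum, Pi.add_apply, Finset.sum_apply, Submodule.coe_add,
      Submodule.coe_sum, heven2, hodd]
    simp

/-- By even linearity and naturality at a real base point, the range contains every summand in
`Pts.eq_sum_units`. So ℝ^{0|1} suffices as a test for all trivial superpoints. -/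
lemma IsSupersmoothOn.fderiv_triv_surjective (hF : IsSupersmoothOn (redSet n O) F) (hO : IsOpen O)
    {x : Fin m → ℝ} (hx : x ∈ O)
    (h : Function.Surjective (fderiv ℝ (F (SPoint.triv s 1)) (Pts.real _ x))) (r : ℕ) :
    Function.Surjective (fderiv ℝ (F (SPoint.triv s r)) (Pts.real _ x)) := by
  have hxS : ∀ C : SPoint s, (Pts.real C x : Pts m n C) ∈ redSet n O C := fun C => by
    change Pts.red _ ∈ O
    rwa [Pts.red_real]
  have hmap : ∀ (f : SPoint.triv s 1 ⟶ SPoint.triv s r) (w : Pts m n (SPoint.triv s 1)),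
      ∃ v, fderiv ℝ (F (SPoint.triv s r)) (Pts.real _ x) v = Pts.map f w := by
    intro f w
    obtain ⟨v, hv⟩ := h w
    refine ⟨Pts.map f v, ?_⟩
    have h1 := hF.fderiv_natural (isOpen_redSet hO) f (hxS _) v
    rw [hv, Pts.map_eq_coordMap, Pts.coordMap_real] at h1
    exact h1
  intro w
  let A := (fderiv ℝ (F (SPoint.triv s r)) (Pts.real _ x)).toLinearMap
  suffices w ∈ LinearMap.range A from this
  rw [Pts.eq_sum_units w]
  refine add_mem (sum_mem fun i _ => ?_) (sum_mem fun j _ => hmap _ _)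
  obtain ⟨v, hv⟩ := hmap (SPoint.trivHom 0) (Pts.real _ (Pi.single i 1))
  rw [Pts.map_eq_coordMap, Pts.coordMap_real] at hv
  exact ⟨Pts.esmul (w.1 i) v, by
    change fderiv ℝ (F (SPoint.triv s r)) (Pts.real _ x) _ = _
    rw [hF.fderiv_esmul _ _ (hxS _), hv]⟩

/-- The differential at `x` is approximated by `A`, the differential at the body of `x`. `A` is
invertible and commutes with scaling, so solving with it keeps the degree. The error has the same
order in the second block and vanishes when the first block is set to zero, so
`fold_mem_vanish_of_proj` gives it one degree more. -/
lemma IsSupersmoothOn.exists_fderiv_sub_mem_vanish (hF : IsSupersmoothOn (redSet n O) F)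
    (hO : IsOpen O) {C : SPoint s} {x : Pts m n C} (hx : x ∈ redSet n O C)
    (h : Function.Surjective (fderiv ℝ (F (SPoint.triv s 1)) (Pts.real _ (Pts.red x))))
    {d : ℕ} {w : Pts m n C} (hw : w ∈ Pts.vanish m n d C) :
    ∃ v ∈ Pts.vanish m n d C, fderiv ℝ (F C) x v - w ∈ Pts.vanish m n (d + 1) C := by
  have hsurj := hF.fderiv_triv_surjective hO hx h C.r
  set A := fderiv ℝ (F (SPoint.triv s C.r)) (Pts.real _ (Pts.red x)) with hA
  have hinj : Function.Injective A.toLinearMap :=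
    LinearMap.injective_iff_surjective.2 hsurj
  let e := (LinearEquiv.ofBijective A.toLinearMap ⟨hinj, hsurj⟩).toContinuousLinearEquiv
  have hreal : (Pts.real (SPoint.triv s C.r) (Pts.red x) : Pts m n _) ∈
      redSet n O (SPoint.triv s C.r) := by
    change Pts.red _ ∈ O
    rw [Pts.red_real]
    exact hx
  -- Points over `C` and over the trivial superpoint with the same generators form the same type.
  -- Over the latter every scaling is a morphism, so `A` and its inverse commute with scalings.
  obtain ⟨v, hAv, hv⟩ : ∃ v : Pts m n C, A v = w ∧ v ∈ Pts.vanish m n d C := by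
    let v : Pts m n (SPoint.triv s C.r) := e.symm w
    have hAv : A v = w := e.apply_symm_apply w
    have hscale : ∀ c : ℝ, Pts.scale c v = e.symm (Pts.scale c w) := by
      intro c
      rw [eq_comm, ContinuousLinearEquiv.symm_apply_eq]
      change _ = A (Pts.scale c v)
      have h1 := hF.fderiv_natural (isOpen_redSet hO) (SPoint.trivHom (c • LinearMap.id)) hreal v
      rw [Pts.map_eq_coordMap, Pts.coordMap_real] at h1
      refine Eq.trans ?_ h1.symm
      rw [← hA, hAv]
      rfl
    have hv : v ∈ Pts.vanish m n d (SPoint.triv s C.r) := by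
      rw [Pts.mem_vanish_iff]
      simp only [hscale]
      exact (e.symm.toContinuousLinearMap.isBigO_comp _ _).trans
        (Pts.mem_vanish_iff.1 hw)
    exact ⟨v, hAv, hv⟩
  refine ⟨v, hv, ?_⟩
  set x' := Pts.map C.inclHom x with hx'
  have hx'S : x' ∈ redSet n O C.double := map_mem_redSet _ hx
  set v' : Pts m n C.double := Pts.lin (inclSnd C.r) v with hv'
  set w' : Pts m n C.double := Pts.lin (inclSnd C.r) w with hw'
  set Y := fderiv ℝ (F C.double) x' v' - w' with hY
  have key : fderiv ℝ (F C) x v - w = Pts.lin (foldGen C.r) Y := by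
    have h1 := hF.fderiv_natural (isOpen_redSet hO) C.foldHom hx'S v'
    have h2 : Pts.map C.foldHom x' = x := lin_fold_inclFst x
    have h3 : Pts.map C.foldHom v' = v := lin_fold_inclSnd v
    have h4 : (Pts.lin (foldGen C.r) w' : Pts m n C) = w := lin_fold_inclSnd w
    rw [h2, h3] at h1
    rw [hY, map_sub, h4, h1]
    rfl
  rw [key]
  apply fold_mem_vanish_of_proj
  · have h4 : ∀ c, (Pts.lin (scaleSnd C.r c) Y : Pts m n C.double) =
        fderiv ℝ (F C.double) x' (Pts.lin (inclSnd C.r) (Pts.scale c v)) -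
          Pts.lin (inclSnd C.r) (Pts.scale c w) := by
      intro c
      have h1 := hF.fderiv_natural (isOpen_redSet hO) (C.scaleHom c) hx'S v'
      have h2 : Pts.map (C.scaleHom c) x' = x' := lin_scaleSnd_inclFst c x
      have h3 : Pts.map (C.scaleHom c) v' = Pts.lin (inclSnd C.r) (Pts.scale c v) :=
        lin_scaleSnd_inclSnd c v
      rw [h2, h3] at h1
      rw [h1, hY, map_sub, hw', lin_scaleSnd_inclSnd]
      rfl
    simp only [h4]
    refine Asymptotics.IsBigO.sub (((fderiv ℝ (F C.double) x').isBigO_comp _ _).trans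
      (((Pts.lin (inclSnd C.r) : Pts m n C →L[ℝ] Pts m n C.double).isBigO_comp _ _).trans
        (Pts.mem_vanish_iff.1 hv))) ?_
    exact ((Pts.lin (inclSnd C.r) : Pts m n C →L[ℝ] Pts m n C.double).isBigO_comp _ _).trans
        (Pts.mem_vanish_iff.1 hw)
  -- Projecting to the second block replaces `x'` by its body and `v'` by `v`, so the projected
  -- error is A v - w = 0.
  · have h1 := hF.fderiv_natural (isOpen_redSet hO) C.projHom hx'S v'
    have h2 : Pts.map C.projHom x' = Pts.real _ (Pts.red x) := by
      change Pts.lin (projSnd C.r) (Pts.lin (inclFst C.r) x : Pts m n C.double) = _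
      rw [Pts.lin_lin, projSnd_inclFst]
      exact Pts.lin_zero_eq_real x
    have h5 : ∀ u : Pts m n C, (Pts.lin (projSnd C.r) (Pts.lin (inclSnd C.r) u : Pts m n C.double) :
        Pts m n C) = u := fun u => by
      rw [Pts.lin_lin, projSnd_inclSnd]; exact Pts.lin_id u
    have h3 : Pts.map C.projHom v' = v := h5 v
    rw [h2, h3, ← hA, hAv] at h1
    rw [hY, map_sub, hw', h5, sub_eq_zero]
    exact h1.symm

/-- The approximate solution is corrected degree by degree. The induction runs over the number `e`
of degrees still to be treated, and nothing is left above degree `C.r`. -/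
lemma IsSupersmoothOn.exists_fderiv_eq (hF : IsSupersmoothOn (redSet n O) F)
    (hO : IsOpen O) {C : SPoint s} {x : Pts m n C} (hx : x ∈ redSet n O C)
    (h : Function.Surjective (fderiv ℝ (F (SPoint.triv s 1)) (Pts.real _ (Pts.red x))))
    {d : ℕ} {w : Pts m n C} (hw : w ∈ Pts.vanish m n d C) :
    ∃ v ∈ Pts.vanish m n d C, fderiv ℝ (F C) x v = w := by
  obtain ⟨e, he⟩ : ∃ e, C.r < d + e := ⟨C.r + 1, by omega⟩
  induction e generalizing d w with
  | zero =>
    refine ⟨0, zero_mem _, ?_⟩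
    rw [map_zero, Pts.eq_zero_of_vanish hw he]
  | succ e ih =>
    obtain ⟨v, hv, hvw⟩ := hF.exists_fderiv_sub_mem_vanish hO hx h hw
    obtain ⟨v', hv', hvw'⟩ := ih hvw (by omega)
    refine ⟨v - v', sub_mem hv fun a ha => hv' a (by omega), ?_⟩
    rw [map_sub, hvw', sub_sub_cancel]

lemma IsSupersmoothOn.fderiv_bijective (hF : IsSupersmoothOn (redSet n O) F)
    (hO : IsOpen O) {C : SPoint s} {x : Pts m n C} (hx : x ∈ redSet n O C)
    (h : Function.Surjective (fderiv ℝ (F (SPoint.triv s 1)) (Pts.real _ (Pts.red x)))) :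
    Function.Bijective (fderiv ℝ (F C) x) := by
  have hs : Function.Surjective (fderiv ℝ (F C) x).toLinearMap := fun w => by
    obtain ⟨v, -, hv⟩ := hF.exists_fderiv_eq hO hx h (Pts.vanish_zero w)
    exact ⟨v, hv⟩
  exact ⟨LinearMap.injective_iff_surjective.2 hs, hs⟩

lemma Pts.redL_surjective (C : SPoint s) : Function.Surjective (Pts.redL C : Pts m n C →L[ℝ] _) :=
  fun x => ⟨Pts.real C x, Pts.red_real (n := n) C x⟩

lemma Pts.red_pt_injective : Function.Injective (Pts.red : Pts m n (SPoint.pt s) → _) := by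
  intro x y h
  rw [← sub_eq_zero]
  exact Pts.eq_zero_of_vanish (Pts.sub_mem_vanish_one h) one_pos

lemma exists_openPartialHomeomorph {E : Type*} [NormedAddCommGroup E] [NormedSpace ℝ E]
    [FiniteDimensional ℝ E] {f : E → E} {a : E} (hf : ContDiffAt ℝ ∞ f a)
    (h : Function.Bijective (fderiv ℝ f a)) :
    ∃ e : OpenPartialHomeomorph E E, a ∈ e.source ∧ (e : E → E) = f ∧
      ContDiffAt ℝ ∞ e.symm (f a) := by
  have : CompleteSpace E := FiniteDimensional.complete ℝ E
  let A := (LinearEquiv.ofBijective (fderiv ℝ f a).toLinearMap h).toContinuousLinearEquiv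
  have hA : HasFDerivAt f (A : E →L[ℝ] E) a := (hf.differentiableAt (by simp)).hasFDerivAt
  let e := hf.toOpenPartialHomeomorph f hA (by simp)
  have ha : a ∈ e.source := hf.mem_toOpenPartialHomeomorph_source hA (by simp)
  exact ⟨e, ha, rfl, hf.to_localInverse hA (by simp)⟩

/-- The inverse function theorem for supersmooth maps: injectivity is needed on reduced points
only, and the differential only has to be invertible over `ℝ^{0|1}`. -/
theorem IsSupersmoothOn.exists_inverse (hF : IsSupersmoothOn (redSet n O) F) (hO : IsOpen O)
    (hinj : InjOn (F (SPoint.pt s)) (redSet n O (SPoint.pt s)))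
    (hsurj : ∀ x ∈ O, Function.Surjective (fderiv ℝ (F (SPoint.triv s 1)) (Pts.real _ x))) :
    ∃ O' : Set (Fin m → ℝ), IsOpen O' ∧
      ∃ G : ∀ C : SPoint s, Pts m n C → Pts m n C, IsSupersmoothOn (redSet n O') G ∧
        ∀ C, MapsTo (F C) (redSet n O C) (redSet n O' C) ∧
          MapsTo (G C) (redSet n O' C) (redSet n O C) ∧
          InvOn (G C) (F C) (redSet n O C) (redSet n O' C) := by
  have hbij : ∀ C, ∀ x ∈ redSet n O C, Function.Bijective (fderiv ℝ (F C) x) := fun C x hx =>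
    hF.fderiv_bijective hO hx (hsurj _ hx)
  have hcd : ∀ C, ∀ x ∈ redSet n O C, ContDiffAt ℝ ∞ (F C) x := fun C x hx =>
    (hF.smooth C).contDiffAt ((isOpen_redSet hO C).mem_nhds hx)
  -- The image is prescribed by the reduced map. It is open because the reduced map is a local
  -- homeomorphism and `Pts.redL` is a surjective linear map.
  set O' : Set (Fin m → ℝ) := Pts.redL (SPoint.pt s) '' (F (SPoint.pt s) '' redSet n O (SPoint.pt s))
    with hO'
  have hO'o : IsOpen O' := by
    refine (Pts.redL (n := n) (SPoint.pt s)).isOpenMap (Pts.redL_surjective _) _ ?_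
    rw [isOpen_iff_mem_nhds]
    rintro _ ⟨x, hx, rfl⟩
    obtain ⟨e, hxe, he, -⟩ := exists_openPartialHomeomorph (hcd _ x hx) (hbij _ x hx)
    rw [← he, ← e.map_nhds_eq hxe]
    exact image_mem_map ((isOpen_redSet hO _).mem_nhds hx)
  have hred : ∀ C, ∀ x ∈ redSet n O C,
      Pts.red (F C x) = Pts.red (F (SPoint.pt s) (Pts.map C.toPt x)) := fun C x hx => by
    rw [(hF.natural C.toPt x hx).2, Pts.red_map]
  have hmaps : ∀ C, MapsTo (F C) (redSet n O C) (redSet n O' C) := fun C x hx => by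
    change Pts.red _ ∈ O'
    rw [hred C x hx]
    exact mem_image_of_mem _ (mem_image_of_mem _ (map_mem_redSet _ hx))
  have hinjC : ∀ C, InjOn (F C) (redSet n O C) := by
    intro C x hx y hy hxy
    have h1 : Pts.red y = Pts.red x := by
      have h2 : F (SPoint.pt s) (Pts.map C.toPt y) = F (SPoint.pt s) (Pts.map C.toPt x) := by
        rw [(hF.natural C.toPt x hx).2, (hF.natural C.toPt y hy).2, hxy]
      have h3 := hinj (map_mem_redSet _ hy) (map_mem_redSet _ hx) h2
      rw [← Pts.red_map C.toPt y, h3, Pts.red_map]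
    -- Equal values make the differential of `y - x` minus a Taylor remainder, of one degree more.
    -- Solving with the differential preserves degrees, so `y - x` gains a degree each time and is
    -- finally zero.
    have h2 : ∀ d, y - x ∈ Pts.vanish m n (d + 1) C := by
      intro d
      induction d with
      | zero => exact Pts.sub_mem_vanish_one h1
      | succ d ih =>
        have h3 := hF.taylor_mem_vanish hO hx (by omega) ih
        rw [add_sub_cancel, hxy, sub_self, zero_sub] at h3
        obtain ⟨v, hv, hvw⟩ := hF.exists_fderiv_eq hO hx (hsurj _ hx) (neg_mem h3)
        rw [neg_neg] at hvw
        rwa [(hbij C x hx).1 hvw] at hv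
    exact (sub_eq_zero.1 (Pts.eq_zero_of_vanish (h2 C.r) (by omega))).symm
  have hsurjC : ∀ C, ∀ w ∈ redSet n O' C, ∃ x ∈ redSet n O C, F C x = w := by
    rintro C w ⟨_, ⟨x₀, hx₀, rfl⟩, hw⟩
    -- Newton iteration starting at the real point over a reduced solution: the linearised equation
    -- is solved exactly, and the Taylor remainder leaves a residual of one degree more.
    have h1 : ∀ d, ∃ x ∈ redSet n O C, w - F C x ∈ Pts.vanish m n (d + 1) C := by
      intro d
      induction d with
      | zero =>
        have hmem : (Pts.real C (Pts.red x₀) : Pts m n C) ∈ redSet n O C := by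
          change Pts.red _ ∈ O
          rw [Pts.red_real]
          exact hx₀
        refine ⟨Pts.real C (Pts.red x₀), hmem, Pts.sub_mem_vanish_one ?_⟩
        rw [hred _ _ hmem, Pts.map_eq_coordMap, Pts.coordMap_real, ← hw, Pts.redL_apply]
        exact congrArg (fun z => Pts.red (F (SPoint.pt s) z))
          (Pts.red_pt_injective (Pts.red_real _ _)).symm
      | succ d ih =>
        obtain ⟨x, hx, hwx⟩ := ih
        obtain ⟨v, hv, hvw⟩ := hF.exists_fderiv_eq hO hx (hsurj _ hx) hwx
        refine ⟨x + v, add_mem_redSet hx (by omega) hv, ?_⟩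
        have h3 := neg_mem (hF.taylor_mem_vanish hO hx (by omega) hv)
        rw [hvw] at h3
        convert h3 using 1
        abel
    obtain ⟨x, hx, hwx⟩ := h1 C.r
    exact ⟨x, hx, (sub_eq_zero.1 (Pts.eq_zero_of_vanish hwx (by omega))).symm⟩
  let G : ∀ C : SPoint s, Pts m n C → Pts m n C := fun C => Function.invFunOn (F C) (redSet n O C)
  have hG : ∀ C, ∀ w ∈ redSet n O' C, G C w ∈ redSet n O C ∧ F C (G C w) = w := fun C w hw =>
    Function.invFunOn_pos (hsurjC C w hw)
  have hGF : ∀ C, LeftInvOn (G C) (F C) (redSet n O C) := fun C x hx =>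
    hinjC C (hG C _ (hmaps C hx)).1 hx (hG C _ (hmaps C hx)).2
  -- Injectivity on the whole set identifies the chosen inverse with the smooth local inverse, as
  -- soon as the latter takes values in the set.
  have hGcd : ∀ C, ∀ w ∈ redSet n O' C, ContDiffAt ℝ ∞ (G C) w := by
    intro C w hw
    obtain ⟨hx, hFx⟩ := hG C w hw
    obtain ⟨e, hxe, he, hes⟩ := exists_openPartialHomeomorph (hcd C _ hx) (hbij C _ hx)
    rw [hFx] at hes
    refine hes.congr_of_eventuallyEq ?_
    have hwt : w ∈ e.target := by
      rw [← hFx, ← he]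
      exact e.map_source hxe
    have hsymm : e.symm w = G C w := by
      rw [← e.left_inv hxe, he, hFx]
    have h1 : ∀ᶠ z in 𝓝 w, e.symm z ∈ redSet n O C :=
      (e.continuousAt_symm hwt).eventually (by
        rw [hsymm]
        exact (isOpen_redSet hO C).mem_nhds hx)
    filter_upwards [h1, e.open_target.mem_nhds hwt] with z hz hzt
    have h2 := hGF C hz
    rw [← he, e.right_inv hzt] at h2
    exact h2
  refine ⟨O', hO'o, G, ⟨fun C w hw => (hGcd C w hw).contDiffWithinAt, ?_, ?_⟩, fun C =>
    ⟨hmaps C, fun w hw => (hG C w hw).1, hGF C, fun w hw => (hG C w hw).2⟩⟩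
  · intro C D f w hw
    have hw' : Pts.map f w ∈ redSet n O' D := map_mem_redSet f hw
    refine ⟨hw', ?_⟩
    have h1 := hF.natural f _ (hG C w hw).1
    rw [(hG C w hw).2] at h1
    rw [← h1.2]
    exact hGF D h1.1
  · intro C w hw a v
    obtain ⟨hx, hFx⟩ := hG C w hw
    have h1 : (fderiv ℝ (F C) (G C w)).comp (fderiv ℝ (G C) w) = ContinuousLinearMap.id ℝ _ := by
      have h2 := ((hcd C _ hx).differentiableAt (by simp)).hasFDerivAt.comp w
        ((hGcd C w hw).differentiableAt (by simp)).hasFDerivAt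
      refine h2.unique ((hasFDerivAt_id w).congr_of_eventuallyEq ?_)
      filter_upwards [(isOpen_redSet hO'o C).mem_nhds hw] with z hz using (hG C z hz).2
    have h3 : ∀ u, fderiv ℝ (F C) (G C w) (fderiv ℝ (G C) w u) = u := fun u =>
      congrArg (fun A => A u) h1
    apply (hbij C _ hx).1
    rw [h3, hF.fderiv_esmul C _ hx, h3]

end InverseFunction

/-! ## The Koszul formula -/

variable {s m n k l : ℕ}

section Bilinear

/-- In a finite-dimensional space a minimal finite intersection of kernels is already the full
intersection. Non-degeneracy involves test vectors over all superpoints, and this reduces it to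
finitely many. -/
lemma exists_finset_iInf_ker_eq_bot {E ι : Type*} [AddCommGroup E] [Module ℝ E]
    [FiniteDimensional ℝ E] {V : ι → Type*} [∀ a, AddCommGroup (V a)] [∀ a, Module ℝ (V a)]
    (T : ∀ a, E →ₗ[ℝ] V a) (h : ∀ v, (∀ a, T a v = 0) → v = 0) :
    ∃ t : Finset ι, ∀ v, (∀ a ∈ t, T a v = 0) → v = 0 := by
  classical
  obtain ⟨W, ⟨t, rfl⟩, hmin⟩ := wellFounded_lt.has_min
    (Set.range fun t : Finset ι => t.inf fun a => LinearMap.ker (T a)) ⟨_, ∅, rfl⟩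
  refine ⟨t, fun v hv => h v fun a => ?_⟩
  by_contra ha
  have hvt : v ∈ t.inf fun a => LinearMap.ker (T a) := by
    rw [Submodule.mem_finsetInf]
    exact hv
  refine hmin _ ⟨insert a t, rfl⟩ (lt_of_le_of_ne ?_ ?_)
  · change (insert a t).inf _ ≤ t.inf _
    rw [Finset.inf_insert]
    exact inf_le_right
  · intro heq
    simp only at heq
    rw [← heq, Finset.inf_insert] at hvt
    exact ha hvt.1

/-! ### Smooth families of linear and bilinear maps. -/

section Generic

variable {X E E' : Type*} [NormedAddCommGroup X] [NormedSpace ℝ X]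
  [NormedAddCommGroup E] [NormedSpace ℝ E] [NormedAddCommGroup E'] [NormedSpace ℝ E']

/-- A linear system with smooth coefficients that determines its solution uniquely at a point has
smooth solutions near this point. -/
lemma contDiffAt_of_linear_system [FiniteDimensional ℝ E] {ι : Type*} {V : ι → Type*}
    [∀ a, NormedAddCommGroup (V a)] [∀ a, NormedSpace ℝ (V a)] [∀ a, FiniteDimensional ℝ (V a)]
    {U : Set X} (hU : IsOpen U) (T : ∀ a, X → E → V a) (K : ∀ a, X → V a) (z : X → E)
    (hadd : ∀ a, ∀ x ∈ U, ∀ v w, T a x (v + w) = T a x v + T a x w)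
    (hsmul : ∀ a, ∀ x ∈ U, ∀ (c : ℝ) (v), T a x (c • v) = c • T a x v)
    (hT : ∀ a v, ContDiffOn ℝ ∞ (fun x => T a x v) U) (hK : ∀ a, ContDiffOn ℝ ∞ (K a) U)
    (hz : ∀ a, ∀ x ∈ U, T a x (z x) = K a x) {x₀ : X} (hx₀ : x₀ ∈ U)
    (hinj : ∀ v, (∀ a, T a x₀ v = 0) → v = 0) : ContDiffAt ℝ ∞ z x₀ := by
  classical
  have : CompleteSpace E := FiniteDimensional.complete ℝ E
  let L : ∀ a, X → E →ₗ[ℝ] V a := fun a x => if hx : x ∈ U then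
    { toFun := T a x, map_add' := hadd a x hx, map_smul' := hsmul a x hx } else 0
  have hL : ∀ a, ∀ x ∈ U, ∀ v, L a x v = T a x v := fun a x hx v => by
    simp only [L, dif_pos hx]
    rfl
  obtain ⟨t, ht⟩ := exists_finset_iInf_ker_eq_bot (fun a => L a x₀) (fun v hv => hinj v fun a => by
    rw [← hL a x₀ hx₀]; exact hv a)
  let A : X → E →L[ℝ] (∀ a : t, V a) := fun x =>
    LinearMap.toContinuousLinearMap (LinearMap.pi fun a : t => L a x)
  have hA : ContDiffOn ℝ ∞ A U := by
    refine contDiffOn_clm_apply.2 fun v => contDiffOn_pi.2 fun a => ?_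
    exact (hT a v).congr fun x hx => hL a x hx v
  -- Composing with a left inverse at `x₀` gives a square system `B x` that is the identity at `x₀`,
  -- hence invertible nearby. The solution is then `B x`⁻¹ applied to smooth data.
  obtain ⟨P, hP⟩ := (A x₀).toLinearMap.exists_leftInverse_of_injective (by
    refine LinearMap.ker_eq_bot'.2 fun v hv => ht v fun a ha => congrFun hv ⟨a, ha⟩)
  let P' : (∀ a : t, V a) →L[ℝ] E := LinearMap.toContinuousLinearMap P
  let B : X → E →L[ℝ] E := fun x => P'.comp (A x)
  have hB : ContDiffAt ℝ ∞ B x₀ := by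
    refine ContDiffOn.contDiffAt (s := U) (contDiffOn_clm_apply.2 fun v => ?_) (hU.mem_nhds hx₀)
    exact P'.contDiff.comp_contDiffOn (contDiffOn_clm_apply.1 hA v)
  have hB0 : B x₀ = (ContinuousLinearEquiv.refl ℝ E : E →L[ℝ] E) := by
    ext v
    exact congrArg (fun Q => Q v) hP
  have hinv : ContDiffAt ℝ ∞ (fun x => ContinuousLinearMap.inverse (B x)) x₀ := by
    refine ContDiffAt.comp (g := fun Q : E →L[ℝ] E => ContinuousLinearMap.inverse Q) x₀ ?_ hB
    rw [hB0]
    exact contDiffAt_map_inverse (ContinuousLinearEquiv.refl ℝ E)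
  have hKt : ContDiffAt ℝ ∞ (fun x => P' fun a : t => K a x) x₀ :=
    P'.contDiff.contDiffAt.comp x₀
      (contDiffAt_pi.2 fun a => (hK a).contDiffAt (hU.mem_nhds hx₀))
  refine (hinv.clm_apply hKt).congr_of_eventuallyEq ?_
  have hev : ∀ᶠ x in 𝓝 x₀, (B x).IsInvertible := by
    refine hB.continuousAt.eventually (p := fun Q => Q.IsInvertible) ?_
    rw [hB0]
    exact (ContinuousLinearEquiv.isOpen (𝕜 := ℝ)).mem_nhds ⟨_, rfl⟩
  filter_upwards [hev, hU.mem_nhds hx₀] with x ⟨e, he⟩ hx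
  have h1 : B x (z x) = P' fun a : t => K a x := by
    change P' (A x (z x)) = _
    congr 1
    funext a
    exact (hL a x hx _).trans (hz a x hx)
  rw [← h1, ← he, ContinuousLinearMap.inverse_equiv]
  exact (e.symm_apply_apply _).symm

/-- A family of bilinear maps. -/
structure IsBilinOn (U : Set X) (Φ : X → E → E → E') : Prop where
  add_left : ∀ x ∈ U, ∀ v v' w, Φ x (v + v') w = Φ x v w + Φ x v' w
  add_right : ∀ x ∈ U, ∀ v w w', Φ x v (w + w') = Φ x v w + Φ x v w'
  smul_left : ∀ x ∈ U, ∀ (c : ℝ) (v w), Φ x (c • v) w = c • Φ x v w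
  smul_right : ∀ x ∈ U, ∀ (c : ℝ) (v w), Φ x v (c • w) = c • Φ x v w
  smooth : ∀ v w, ContDiffOn ℝ ∞ (fun x => Φ x v w) U

variable {U : Set X} {Φ : X → E → E → E'}

lemma IsBilinOn.exists_clm [FiniteDimensional ℝ E] [FiniteDimensional ℝ E']
    (h : IsBilinOn U Φ) : ∃ B : X → E →L[ℝ] E →L[ℝ] E',
      ContDiffOn ℝ ∞ B U ∧ ∀ x ∈ U, ∀ v w, B x v w = Φ x v w := by
  classical
  let B : X → E →L[ℝ] E →L[ℝ] E' := fun x => if hx : x ∈ U then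
    LinearMap.toContinuousLinearMap (LinearMap.toContinuousLinearMap.toLinearMap ∘ₗ
      LinearMap.mk₂ ℝ (Φ x) (h.add_left x hx) (h.smul_left x hx) (h.add_right x hx)
        (h.smul_right x hx)) else 0
  have hB : ∀ x ∈ U, ∀ v w, B x v w = Φ x v w := fun x hx v w => by
    simp only [B, dif_pos hx]
    rfl
  exact ⟨B, contDiffOn_clm_apply.2 fun v => contDiffOn_clm_apply.2 fun w =>
    (h.smooth v w).congr fun x hx => hB x hx v w, hB⟩

lemma IsBilinOn.contDiffOn_comp [FiniteDimensional ℝ E] [FiniteDimensional ℝ E']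
    {Y : Type*} [NormedAddCommGroup Y] [NormedSpace ℝ Y] (h : IsBilinOn U Φ)
    {W : Set Y} {φ : Y → X} {a b : Y → E} (hφ : ContDiffOn ℝ ∞ φ W) (hW : MapsTo φ W U)
    (ha : ContDiffOn ℝ ∞ a W) (hb : ContDiffOn ℝ ∞ b W) :
    ContDiffOn ℝ ∞ (fun y => Φ (φ y) (a y) (b y)) W := by
  obtain ⟨B, hB, hBΦ⟩ := h.exists_clm
  exact (((hB.comp hφ hW).clm_apply ha).clm_apply hb).congr fun y hy => (hBΦ _ (hW hy) _ _).symm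

lemma IsBilinOn.hasFDerivAt_comp [FiniteDimensional ℝ E] [FiniteDimensional ℝ E']
    {Y : Type*} [NormedAddCommGroup Y] [NormedSpace ℝ Y] (h : IsBilinOn U Φ) (hU : IsOpen U)
    {φ : Y → X} {a b : Y → E} {y : Y} (hy : φ y ∈ U) {φ' : Y →L[ℝ] X} {a' b' : Y →L[ℝ] E}
    (hφ : HasFDerivAt φ φ' y) (ha : HasFDerivAt a a' y) (hb : HasFDerivAt b b' y) :
    ∃ D : Y →L[ℝ] E', HasFDerivAt (fun y => Φ (φ y) (a y) (b y)) D y ∧ ∀ v, D v =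
      fderiv ℝ (fun x => Φ x (a y) (b y)) (φ y) (φ' v) + Φ (φ y) (a' v) (b y) +
        Φ (φ y) (a y) (b' v) := by
  obtain ⟨B, hB, hBΦ⟩ := h.exists_clm
  have hBd : HasFDerivAt B (fderiv ℝ B (φ y)) (φ y) :=
    ((hB.contDiffAt (hU.mem_nhds hy)).differentiableAt (by simp)).hasFDerivAt
  have hc := HasFDerivAt.comp (G := E →L[ℝ] E →L[ℝ] E') y hBd hφ
  have hc1 : HasFDerivAt (fun y => B (φ y) (a y)) _ y := hc.clm_apply ha
  have h1 := hc1.clm_apply hb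
  have h2 := (hBd.clm_apply (hasFDerivAt_const (a y) (φ y))).clm_apply
    (hasFDerivAt_const (b y) (φ y))
  have h3 : (fun x => Φ x (a y) (b y)) =ᶠ[𝓝 (φ y)] fun x => B x (a y) (b y) := by
    filter_upwards [hU.mem_nhds hy] with x hx using (hBΦ x hx _ _).symm
  refine ⟨_, h1.congr_of_eventuallyEq ?_, fun v => ?_⟩
  · filter_upwards [hφ.continuousAt (hU.mem_nhds hy)] with x hx using (hBΦ _ hx _ _).symm
  · rw [(h2.congr_of_eventuallyEq h3).fderiv, ← hBΦ _ hy, ← hBΦ _ hy]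
    simp only [Function.comp_apply, add_apply, ContinuousLinearMap.comp_apply,
      ContinuousLinearMap.flip_apply, ContinuousLinearMap.comp_zero]
    simp only [zero_apply, zero_add]
    abel

lemma half_sum_add (a a' b b' c c' : E) : (2⁻¹ : ℝ) • ((a + a') + (b + b') - (c + c')) =
    (2⁻¹ : ℝ) • (a + b - c) + (2⁻¹ : ℝ) • (a' + b' - c') := by
  module

lemma half_sum_sub (a b c x y z : E) : (2⁻¹ : ℝ) • ((a + x + y) + (b + x + z) - (c + y + z)) =
    (2⁻¹ : ℝ) • (a + b - c) + x := by
  module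

end Generic

/-- Multiplication by an even element as a continuous linear map. -/
def Pts.esmulL {C : SPoint s} (a : part 0 C.r) : Pts m n C →L[ℝ] Pts m n C :=
  LinearMap.toContinuousLinearMap
    { toFun := Pts.esmul a
      map_add' := fun v w => by
        apply Pts.ext_coord <;> intro i <;> exact mul_add _ _ _
      map_smul' := fun c v => by
        apply Pts.ext_coord <;> intro i <;> exact mul_smul_comm _ _ _ }

lemma Pts.esmul_add {C : SPoint s} (a : part 0 C.r) (v w : Pts m n C) :
    Pts.esmul a (v + w) = Pts.esmul a v + Pts.esmul a w := map_add (Pts.esmulL a) v w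

lemma Pts.esmul_sub {C : SPoint s} (a : part 0 C.r) (v w : Pts m n C) :
    Pts.esmul a (v - w) = Pts.esmul a v - Pts.esmul a w := map_sub (Pts.esmulL a) v w

lemma Pts.esmul_smul {C : SPoint s} (a : part 0 C.r) (c : ℝ) (v : Pts m n C) :
    Pts.esmul a (c • v) = c • Pts.esmul a v := map_smul (Pts.esmulL a) c v

lemma Pts.map_esmul {C D : SPoint s} (f : C ⟶ D) (a : part 0 C.r) (v : Pts m n C) :
    Pts.map f (Pts.esmul a v) = Pts.esmul (Pts.partMap f 0 a) (Pts.map f v) := by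
  apply Pts.ext_coord <;> intro i <;> exact map_mul (SPoint.Hom.alg f) _ _

/-- Real numbers as even elements. -/
def realEven (r : ℕ) (c : ℝ) : part 0 r := ⟨algebraMap ℝ _ c, SetLike.algebraMap_mem_graded _ _⟩

lemma Pts.esmul_realEven {C : SPoint s} (c : ℝ) (v : Pts m n C) :
    Pts.esmul (realEven C.r c) v = c • v := by
  apply Pts.ext_coord <;> intro i <;> exact (Algebra.smul_def _ _).symm

variable {S : ∀ C : SPoint s, Set (Pts m n C)}
  {Φ : ∀ C : SPoint s, Pts m n C → Pts m n C → Pts m n C → Pts k l C}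

lemma IsSuperBilinearOn.smul_left (h : IsSuperBilinearOn S Φ) {C : SPoint s} {x : Pts m n C}
    (hx : x ∈ S C) (c : ℝ) (v w : Pts m n C) : Φ C x (c • v) w = c • Φ C x v w := by
  rw [← Pts.esmul_realEven, h.esmul_left C x hx, Pts.esmul_realEven]

lemma IsSuperBilinearOn.smul_right (h : IsSuperBilinearOn S Φ) {C : SPoint s} {x : Pts m n C}
    (hx : x ∈ S C) (c : ℝ) (v w : Pts m n C) : Φ C x v (c • w) = c • Φ C x v w := by
  rw [← Pts.esmul_realEven, h.esmul_right C x hx, Pts.esmul_realEven]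

lemma IsSuperBilinearOn.isBilinOn (h : IsSuperBilinearOn S Φ) (C : SPoint s) :
    IsBilinOn (S C) (Φ C) where
  add_left := h.add_left C
  add_right := h.add_right C
  smul_left _ hx := h.smul_left hx
  smul_right _ hx := h.smul_right hx
  smooth := h.smooth C

lemma isSymm_fderiv_fderiv {E E' : Type*} [NormedAddCommGroup E] [NormedSpace ℝ E]
    [NormedAddCommGroup E'] [NormedSpace ℝ E'] {U : Set E} (hU : IsOpen U) {f : E → E'}
    (hf : ContDiffOn ℝ ∞ f U) {x : E} (hx : x ∈ U) (u v : E) :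
    fderiv ℝ (fderiv ℝ f) x u v = fderiv ℝ (fderiv ℝ f) x v u :=
  ((hf.contDiffAt (hU.mem_nhds hx)).isSymmSndFDerivAt (by
    rw [minSmoothness_of_isRCLikeNormedField]; exact WithTop.coe_le_coe.2 le_top)) u v

lemma hasFDerivAt_fderiv {E E' : Type*} [NormedAddCommGroup E] [NormedSpace ℝ E]
    [NormedAddCommGroup E'] [NormedSpace ℝ E'] {U : Set E} (hU : IsOpen U) {f : E → E'}
    (hf : ContDiffOn ℝ ∞ f U) {x : E} (hx : x ∈ U) :
    HasFDerivAt (fderiv ℝ f) (fderiv ℝ (fderiv ℝ f) x) x :=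
  ((((hf.contDiffAt (hU.mem_nhds hx)).fderiv_right (m := ∞) (by simp))).differentiableAt
    (by simp)).hasFDerivAt

lemma hasFDerivAt_fderiv_apply {E E' : Type*} [NormedAddCommGroup E] [NormedSpace ℝ E]
    [NormedAddCommGroup E'] [NormedSpace ℝ E'] {U : Set E} (hU : IsOpen U) {f : E → E'}
    (hf : ContDiffOn ℝ ∞ f U) {x : E} (hx : x ∈ U) (u : E) :
    HasFDerivAt (fun y => fderiv ℝ f y u) ((fderiv ℝ (fderiv ℝ f) x).flip u) x := by
  have h := (hasFDerivAt_fderiv hU hf hx).clm_apply (hasFDerivAt_const u x)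
  simpa using h

/-- A partial derivative of a map whose differential is linear over even elements has the same
property. -/
lemma fderiv_fderiv_esmul {C : SPoint s} {U : Set (Pts m n C)} (hU : IsOpen U)
    {f : Pts m n C → Pts k l C} (hf : ContDiffOn ℝ ∞ f U)
    (hlin : ∀ y ∈ U, ∀ a v, fderiv ℝ f y (Pts.esmul a v) = Pts.esmul a (fderiv ℝ f y v))
    {x : Pts m n C} (hx : x ∈ U) (u : Pts m n C) (a : part 0 C.r) (v : Pts m n C) :
    fderiv ℝ (fun y => fderiv ℝ f y u) x (Pts.esmul a v) =
      Pts.esmul a (fderiv ℝ (fun y => fderiv ℝ f y u) x v) := by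
  -- Symmetry of second derivatives moves the even factor into the inner derivative, where linearity
  -- is assumed on a whole neighbourhood.
  have h1 : ∀ w, fderiv ℝ (fun y => fderiv ℝ f y u) x w = fderiv ℝ (fun y => fderiv ℝ f y w) x u := by
    intro w
    rw [(hasFDerivAt_fderiv_apply hU hf hx u).fderiv, (hasFDerivAt_fderiv_apply hU hf hx w).fderiv]
    exact isSymm_fderiv_fderiv hU hf hx w u
  rw [h1, h1]
  have h2 : (fun y => fderiv ℝ f y (Pts.esmul a v)) =ᶠ[𝓝 x]
      fun y => Pts.esmulL a (fderiv ℝ f y v) := by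
    filter_upwards [hU.mem_nhds hx] with y hy using hlin y hy a v
  have h3 := (Pts.esmulL a).hasFDerivAt.comp x (hasFDerivAt_fderiv_apply hU hf hx v)
  rw [h2.fderiv_eq, (hasFDerivAt_fderiv_apply hU hf hx v).fderiv]
  exact congrArg (fun A => A u) h3.fderiv

lemma fderiv_natural_of_comm {C D : SPoint s} (f : C ⟶ D) {U : Set (Pts m n C)} (hU : IsOpen U)
    {φ : Pts m n C → Pts k l C} {ψ : Pts m n D → Pts k l D}
    (h : ∀ y ∈ U, ψ (Pts.map f y) = Pts.map f (φ y)) {x : Pts m n C} (hx : x ∈ U)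
    (hφ : DifferentiableAt ℝ φ x) (hψ : DifferentiableAt ℝ ψ (Pts.map f x)) (v : Pts m n C) :
    fderiv ℝ ψ (Pts.map f x) (Pts.map f v) = Pts.map f (fderiv ℝ φ x v) := by
  have h1 := hψ.hasFDerivAt.comp x (Pts.map f).hasFDerivAt
  have h2 := (Pts.map f).hasFDerivAt.comp x hφ.hasFDerivAt
  have h3 : (ψ ∘ Pts.map f) =ᶠ[𝓝 x] Pts.map f ∘ φ := by
    filter_upwards [hU.mem_nhds hx] with y hy using h y hy
  exact congrArg (fun A => A v) (h1.unique (h2.congr_of_eventuallyEq h3))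

end Bilinear

/-! ### The Koszul expression and its linearity. -/

section Koszul

variable {S : ∀ C : SPoint s, Set (Pts m n C)}
  {g : ∀ C : SPoint s, Pts m n C → Pts m n C → Pts m n C → Pts 1 0 C}

/-- The derivative of a family of bilinear forms. -/
def dForm (g : ∀ C : SPoint s, Pts m n C → Pts m n C → Pts m n C → Pts k l C) (C : SPoint s)
    (x u v w : Pts m n C) : Pts k l C := fderiv ℝ (fun y => g C y v w) x u

/-- The right hand side of the Koszul formula for `⟨∇_u v, w⟩`. -/
def koszul (g : ∀ C : SPoint s, Pts m n C → Pts m n C → Pts m n C → Pts 1 0 C) (C : SPoint s)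
    (x u v w : Pts m n C) : Pts 1 0 C :=
  (2⁻¹ : ℝ) • (dForm g C x u v w + dForm g C x v u w - dForm g C x w u v)

/-- The equation `⟨z, w⟩ = ⟨∇_u v, w⟩` over all superpoints over `C`. -/
def IsChristoffel (g : ∀ C : SPoint s, Pts m n C → Pts m n C → Pts m n C → Pts 1 0 C)
    (C : SPoint s) (x u v z : Pts m n C) : Prop :=
  ∀ (D : SPoint s) (f : C ⟶ D) (w : Pts m n D), g D (Pts.map f x) (Pts.map f z) w =
    koszul g D (Pts.map f x) (Pts.map f u) (Pts.map f v) w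

section

variable {Φ : ∀ C : SPoint s, Pts m n C → Pts m n C → Pts m n C → Pts k l C}
  (h : IsSuperBilinearOn S Φ) (hS : ∀ C, IsOpen (S C))
include h hS

omit hS in
lemma dForm_esmul₁ {C : SPoint s} {x : Pts m n C} (hx : x ∈ S C) (a) (u v w : Pts m n C) :
    dForm Φ C x (Pts.esmul a u) v w = Pts.esmul a (dForm Φ C x u v w) :=
  h.fderiv_esmul C x hx v w a u

lemma differentiableAt_form {C : SPoint s} {x : Pts m n C} (hx : x ∈ S C) (v w : Pts m n C) :
    DifferentiableAt ℝ (fun y => Φ C y v w) x :=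
  ((h.smooth C v w).contDiffAt ((hS C).mem_nhds hx)).differentiableAt (by simp)

lemma dForm_esmul₂ {C : SPoint s} {x : Pts m n C} (hx : x ∈ S C) (a) (u v w : Pts m n C) :
    dForm Φ C x u (Pts.esmul a v) w = Pts.esmul a (dForm Φ C x u v w) := by
  have h1 : (fun y => Φ C y (Pts.esmul a v) w) =ᶠ[𝓝 x] fun y => Pts.esmulL a (Φ C y v w) := by
    filter_upwards [(hS C).mem_nhds hx] with y hy using h.esmul_left C y hy a v w
  rw [dForm, h1.fderiv_eq]
  exact congrArg (fun A => A u) ((Pts.esmulL a).hasFDerivAt.comp x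
    (differentiableAt_form h hS hx v w).hasFDerivAt).fderiv

lemma dForm_esmul₃ {C : SPoint s} {x : Pts m n C} (hx : x ∈ S C) (a) (u v w : Pts m n C) :
    dForm Φ C x u v (Pts.esmul a w) = Pts.esmul a (dForm Φ C x u v w) := by
  have h1 : (fun y => Φ C y v (Pts.esmul a w)) =ᶠ[𝓝 x] fun y => Pts.esmulL a (Φ C y v w) := by
    filter_upwards [(hS C).mem_nhds hx] with y hy using h.esmul_right C y hy a v w
  rw [dForm, h1.fderiv_eq]
  exact congrArg (fun A => A u) ((Pts.esmulL a).hasFDerivAt.comp x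
    (differentiableAt_form h hS hx v w).hasFDerivAt).fderiv

omit h hS in
lemma dForm_add₁ (C : SPoint s) (x u u' v w : Pts m n C) :
    dForm Φ C x (u + u') v w = dForm Φ C x u v w + dForm Φ C x u' v w := map_add _ _ _

lemma dForm_add₂ {C : SPoint s} {x : Pts m n C} (hx : x ∈ S C) (u v v' w : Pts m n C) :
    dForm Φ C x u (v + v') w = dForm Φ C x u v w + dForm Φ C x u v' w := by
  have h1 : (fun y => Φ C y (v + v') w) =ᶠ[𝓝 x] fun y => Φ C y v w + Φ C y v' w := by
    filter_upwards [(hS C).mem_nhds hx] with y hy using h.add_left C y hy v v' w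
  rw [dForm, h1.fderiv_eq]
  exact congrArg (fun A => A u) ((differentiableAt_form h hS hx v w).hasFDerivAt.add
    (differentiableAt_form h hS hx v' w).hasFDerivAt).fderiv

lemma dForm_add₃ {C : SPoint s} {x : Pts m n C} (hx : x ∈ S C) (u v w w' : Pts m n C) :
    dForm Φ C x u v (w + w') = dForm Φ C x u v w + dForm Φ C x u v w' := by
  have h1 : (fun y => Φ C y v (w + w')) =ᶠ[𝓝 x] fun y => Φ C y v w + Φ C y v w' := by
    filter_upwards [(hS C).mem_nhds hx] with y hy using h.add_right C y hy v w w'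
  rw [dForm, h1.fderiv_eq]
  exact congrArg (fun A => A u) ((differentiableAt_form h hS hx v w).hasFDerivAt.add
    (differentiableAt_form h hS hx v w').hasFDerivAt).fderiv

lemma dForm_natural (hSm : ∀ {C D : SPoint s} (f : C ⟶ D), ∀ x ∈ S C, Pts.map f x ∈ S D)
    {C D : SPoint s} (f : C ⟶ D) {x : Pts m n C} (hx : x ∈ S C) (u v w : Pts m n C) :
    dForm Φ D (Pts.map f x) (Pts.map f u) (Pts.map f v) (Pts.map f w) =
      Pts.map f (dForm Φ C x u v w) :=
  fderiv_natural_of_comm f (hS C) (fun y hy => h.natural f y hy v w) hx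
    (differentiableAt_form h hS hx v w) (differentiableAt_form h hS (hSm f x hx) _ _) u

end

section

variable (h : IsSuperBilinearOn S g) (hS : ∀ C, IsOpen (S C))
  (hSm : ∀ {C D : SPoint s} (f : C ⟶ D), ∀ x ∈ S C, Pts.map f x ∈ S D)
include h hS

lemma koszul_add₁ {C : SPoint s} {x : Pts m n C} (hx : x ∈ S C) (u u' v w : Pts m n C) :
    koszul g C x (u + u') v w = koszul g C x u v w + koszul g C x u' v w := by
  simp only [koszul, dForm_add₁, dForm_add₂ h hS hx]
  exact half_sum_add _ _ _ _ _ _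

lemma koszul_add₂ {C : SPoint s} {x : Pts m n C} (hx : x ∈ S C) (u v v' w : Pts m n C) :
    koszul g C x u (v + v') w = koszul g C x u v w + koszul g C x u v' w := by
  simp only [koszul, dForm_add₁, dForm_add₂ h hS hx, dForm_add₃ h hS hx]
  exact half_sum_add _ _ _ _ _ _

lemma koszul_add₃ {C : SPoint s} {x : Pts m n C} (hx : x ∈ S C) (u v w w' : Pts m n C) :
    koszul g C x u v (w + w') = koszul g C x u v w + koszul g C x u v w' := by
  simp only [koszul, dForm_add₁, dForm_add₃ h hS hx]
  exact half_sum_add _ _ _ _ _ _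

lemma koszul_esmul₁ {C : SPoint s} {x : Pts m n C} (hx : x ∈ S C) (a) (u v w : Pts m n C) :
    koszul g C x (Pts.esmul a u) v w = Pts.esmul a (koszul g C x u v w) := by
  simp only [koszul, dForm_esmul₁ h hx, dForm_esmul₂ h hS hx, Pts.esmul_smul, Pts.esmul_add,
    Pts.esmul_sub]

lemma koszul_esmul₂ {C : SPoint s} {x : Pts m n C} (hx : x ∈ S C) (a) (u v w : Pts m n C) :
    koszul g C x u (Pts.esmul a v) w = Pts.esmul a (koszul g C x u v w) := by
  simp only [koszul, dForm_esmul₁ h hx, dForm_esmul₂ h hS hx, dForm_esmul₃ h hS hx,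
    Pts.esmul_smul, Pts.esmul_add, Pts.esmul_sub]

lemma koszul_esmul₃ {C : SPoint s} {x : Pts m n C} (hx : x ∈ S C) (a) (u v w : Pts m n C) :
    koszul g C x u v (Pts.esmul a w) = Pts.esmul a (koszul g C x u v w) := by
  simp only [koszul, dForm_esmul₁ h hx, dForm_esmul₃ h hS hx,
    Pts.esmul_smul, Pts.esmul_add, Pts.esmul_sub]

include hSm in
lemma koszul_natural {C D : SPoint s} (f : C ⟶ D) {x : Pts m n C} (hx : x ∈ S C)
    (u v w : Pts m n C) :
    koszul g D (Pts.map f x) (Pts.map f u) (Pts.map f v) (Pts.map f w) =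
      Pts.map f (koszul g C x u v w) := by
  simp only [koszul, dForm_natural h hS hSm f hx, map_smul, map_add, map_sub]

-- In a chart the Koszul formula is written for constant vector fields, so bracket terms are absent
-- and linearity in each slot reduces to that of the derivative of the form. This makes
-- non-degeneracy applicable.
include hSm in
lemma isCovector_koszul {C : SPoint s} {x : Pts m n C} (hx : x ∈ S C) (u v : Pts m n C) :
    IsCovector C fun D f w => koszul g D (Pts.map f x) (Pts.map f u) (Pts.map f v) w where
  add D f w w' := koszul_add₃ h hS (hSm f x hx) (Pts.map f u) (Pts.map f v) w w'
  esmul D f a w := koszul_esmul₃ h hS (hSm f x hx) a (Pts.map f u) (Pts.map f v) w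
  natural f g' w := by
    simp only [Pts.map_comp]
    exact koszul_natural h hS hSm g' (hSm f x hx) (Pts.map f u) (Pts.map f v) w

end

end Koszul

/-! ## The Levi-Civita connection of a superdomain -/

section

variable {s m n k l : ℕ}

lemma fderiv_fderiv_apply {E E' : Type*} [NormedAddCommGroup E] [NormedSpace ℝ E]
    [NormedAddCommGroup E'] [NormedSpace ℝ E'] {U : Set E} (hU : IsOpen U) {f : E → E'}
    (hf : ContDiffOn ℝ ∞ f U) {x : E} (hx : x ∈ U) (u v : E) :
    fderiv ℝ (fun y => fderiv ℝ f y v) x u = fderiv ℝ (fderiv ℝ f) x u v := by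
  rw [(hasFDerivAt_fderiv_apply hU hf hx v).fderiv]
  rfl

lemma contDiffOn_fderiv_apply {E E' : Type*} [NormedAddCommGroup E] [NormedSpace ℝ E]
    [NormedAddCommGroup E'] [NormedSpace ℝ E'] {U : Set E} (hU : IsOpen U) {f : E → E'}
    (hf : ContDiffOn ℝ ∞ f U) (u : E) : ContDiffOn ℝ ∞ (fun y => fderiv ℝ f y u) U :=
  (hf.fderiv_of_isOpen hU (by simp)).clm_apply contDiffOn_const

/-- A metric on a superdomain in `ℝ^{m|n}`. -/
structure IsMetricOn (S : ∀ C : SPoint s, Set (Pts m n C))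
    (g : ∀ C : SPoint s, Pts m n C → Pts m n C → Pts m n C → Pts 1 0 C) : Prop where
  bilinear : IsSuperBilinearOn S g
  isOpen : ∀ C, IsOpen (S C)
  map_mem : ∀ {C D : SPoint s} (f : C ⟶ D), ∀ x ∈ S C, Pts.map f x ∈ S D
  symm : ∀ C, ∀ x ∈ S C, ∀ v w, g C x v w = g C x w v
  nondegenerate : ∀ C, ∀ x ∈ S C, ∀ K, IsCovector C K →
    ∃! v : Pts m n C, ∀ D (f : C ⟶ D) w, g D (Pts.map f x) (Pts.map f v) w = K D f w

/-- The Christoffel symbols of the Levi-Civita connection. -/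
def leviCivita (g : ∀ C : SPoint s, Pts m n C → Pts m n C → Pts m n C → Pts 1 0 C)
    (C : SPoint s) (x u v : Pts m n C) : Pts m n C :=
  Classical.epsilon fun z => IsChristoffel g C x u v z

namespace IsMetricOn

variable {S : ∀ C : SPoint s, Set (Pts m n C)}
  {g : ∀ C : SPoint s, Pts m n C → Pts m n C → Pts m n C → Pts 1 0 C} (hg : IsMetricOn S g)
  {C : SPoint s} {x : Pts m n C} (hx : x ∈ S C)
include hg hx

lemma existsUnique_christoffel (u v : Pts m n C) : ∃! z, IsChristoffel g C x u v z :=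
  hg.nondegenerate C x hx _ (isCovector_koszul hg.bilinear hg.isOpen hg.map_mem hx u v)

lemma isChristoffel_leviCivita (u v : Pts m n C) :
    IsChristoffel g C x u v (leviCivita g C x u v) :=
  Classical.epsilon_spec (hg.existsUnique_christoffel hx u v).exists

lemma leviCivita_eq {u v z : Pts m n C} (hz : IsChristoffel g C x u v z) :
    leviCivita g C x u v = z :=
  (hg.existsUnique_christoffel hx u v).unique (hg.isChristoffel_leviCivita hx u v) hz

/-- Pairing with `z'` is a covector, and both vectors represent it. All later identities for the
Christoffel symbols are checked in this way after pairing. -/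
lemma eq_of_forall {z z' : Pts m n C} (h : ∀ D (f : C ⟶ D) w,
    g D (Pts.map f x) (Pts.map f z) w = g D (Pts.map f x) (Pts.map f z') w) : z = z' := by
  have hK : IsCovector C fun D f w => g D (Pts.map f x) (Pts.map f z') w :=
    { add := fun D f w w' => hg.bilinear.add_right D _ (hg.map_mem f x hx) _ _ _
      esmul := fun D f a w => hg.bilinear.esmul_right D _ (hg.map_mem f x hx) _ _ _
      natural := fun f g' w => by
        simp only [Pts.map_comp]
        exact hg.bilinear.natural g' _ (hg.map_mem f x hx) _ _ }
  exact (hg.nondegenerate C x hx _ hK).unique h fun _ _ _ => rfl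

-- Testing over every superpoint over `C`, and not over `C` alone, makes the defining equation
-- stable under base change. Naturality of the Christoffel symbols then follows from uniqueness.
omit hg hx in
lemma isChristoffel_map {D : SPoint s} (f : C ⟶ D) {u v z : Pts m n C}
    (hz : IsChristoffel g C x u v z) :
    IsChristoffel g D (Pts.map f x) (Pts.map f u) (Pts.map f v) (Pts.map f z) :=
  fun E g' w => hz E (f ≫ g') w

lemma koszul_comm (u v w : Pts m n C) : koszul g C x u v w = koszul g C x v u w := by
  have h1 : (fun y => g C y u v) =ᶠ[𝓝 x] fun y => g C y v u := by
    filter_upwards [(hg.isOpen C).mem_nhds hx] with y hy using hg.symm C y hy u v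
  rw [koszul, koszul, add_comm (dForm g C x u v w), dForm, dForm, dForm, dForm, h1.fderiv_eq]

/-- By symmetry of the form four of the six terms cancel. This is the metric property before it is
expressed with Christoffel symbols. -/
lemma koszul_add_koszul (u v w : Pts m n C) :
    koszul g C x u v w + koszul g C x u w v = dForm g C x u v w := by
  have h1 : ∀ a b c, dForm g C x a b c = dForm g C x a c b := by
    intro a b c
    have h : (fun y => g C y b c) =ᶠ[𝓝 x] fun y => g C y c b := by
      filter_upwards [(hg.isOpen C).mem_nhds hx] with y hy using hg.symm C y hy b c
    rw [dForm, dForm, h.fderiv_eq]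
  rw [koszul, koszul, h1 u w v, h1 v u w, h1 w u v]
  module

lemma leviCivita_natural {D : SPoint s} (f : C ⟶ D) (u v : Pts m n C) :
    leviCivita g D (Pts.map f x) (Pts.map f u) (Pts.map f v) =
      Pts.map f (leviCivita g C x u v) :=
  hg.leviCivita_eq (hg.map_mem f x hx) (isChristoffel_map f (hg.isChristoffel_leviCivita hx u v))

lemma leviCivita_comm (u v : Pts m n C) : leviCivita g C x u v = leviCivita g C x v u :=
  hg.leviCivita_eq hx fun D f w => by
    rw [hg.koszul_comm (hg.map_mem f x hx)]
    exact hg.isChristoffel_leviCivita hx v u D f w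

lemma form_leviCivita (u v w : Pts m n C) :
    g C x (leviCivita g C x u v) w = koszul g C x u v w :=
  hg.isChristoffel_leviCivita hx u v C (𝟙 C) w

lemma dForm_eq_leviCivita (u v w : Pts m n C) :
    dForm g C x u v w =
      g C x (leviCivita g C x u v) w + g C x v (leviCivita g C x u w) := by
  rw [hg.symm C x hx v, hg.form_leviCivita hx, hg.form_leviCivita hx, hg.koszul_add_koszul hx]

omit hx

lemma contDiffOn_koszul (C : SPoint s) (u v w : Pts m n C) :
    ContDiffOn ℝ ∞ (fun y => koszul g C y u v w) (S C) :=
  (((contDiffOn_fderiv_apply (hg.isOpen C) (hg.bilinear.smooth C v w) u).add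
    (contDiffOn_fderiv_apply (hg.isOpen C) (hg.bilinear.smooth C u w) v)).sub
    (contDiffOn_fderiv_apply (hg.isOpen C) (hg.bilinear.smooth C u v) w)).const_smul _

include hx

lemma fderiv_koszul_esmul (u v w : Pts m n C) (a : part 0 C.r) (h : Pts m n C) :
    fderiv ℝ (fun y => koszul g C y u v w) x (Pts.esmul a h) =
      Pts.esmul a (fderiv ℝ (fun y => koszul g C y u v w) x h) := by
  have hd : ∀ u v w, DifferentiableAt ℝ (fun y => dForm g C y u v w) x := fun u v w =>
    ((contDiffOn_fderiv_apply (hg.isOpen C) (hg.bilinear.smooth C v w) u).contDiffAt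
      ((hg.isOpen C).mem_nhds hx)).differentiableAt (by simp)
  have hl : ∀ u v w, fderiv ℝ (fun y => dForm g C y u v w) x (Pts.esmul a h) =
      Pts.esmul a (fderiv ℝ (fun y => dForm g C y u v w) x h) := fun u v w =>
    fderiv_fderiv_esmul (hg.isOpen C) (hg.bilinear.smooth C v w)
      (fun y hy b q => hg.bilinear.fderiv_esmul C y hy v w b q) hx u a h
  have hk : ∀ q, fderiv ℝ (fun y => koszul g C y u v w) x q =
      (2⁻¹ : ℝ) • (fderiv ℝ (fun y => dForm g C y u v w) x q +
        fderiv ℝ (fun y => dForm g C y v u w) x q - fderiv ℝ (fun y => dForm g C y w u v) x q) :=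
    fun q => congrArg (fun A => A q) ((((hd u v w).hasFDerivAt.add (hd v u w).hasFDerivAt).sub
      (hd w u v).hasFDerivAt).const_smul (2⁻¹ : ℝ)).fderiv
  rw [hk, hk, hl, hl, hl, Pts.esmul_smul, Pts.esmul_sub, Pts.esmul_add]

/-- The defining equation is a linear system indexed by all triples of a superpoint over `C`, a
morphism to it and a test vector. Its coefficients are smooth and non-degeneracy makes it injective.
-/
lemma contDiffAt_leviCivita (u v : Pts m n C) :
    ContDiffAt ℝ ∞ (fun y => leviCivita g C y u v) x := by
  refine contDiffAt_of_linear_system (ι := Σ D : SPoint s, (C ⟶ D) × Pts m n D)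
    (V := fun a => Pts 1 0 a.1) (hg.isOpen C)
    (fun a y z => g a.1 (Pts.map a.2.1 y) (Pts.map a.2.1 z) a.2.2)
    (fun a y => koszul g a.1 (Pts.map a.2.1 y) (Pts.map a.2.1 u) (Pts.map a.2.1 v) a.2.2)
    _ ?_ ?_ ?_ ?_ ?_ hx ?_
  · intro a y hy p q
    rw [map_add]
    exact hg.bilinear.add_left _ _ (hg.map_mem _ y hy) _ _ _
  · intro a y hy c p
    rw [map_smul]
    exact hg.bilinear.smul_left (hg.map_mem _ y hy) _ _ _
  · intro a p
    exact (hg.bilinear.smooth a.1 _ _).comp (Pts.map a.2.1).contDiff.contDiffOn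
      (hg.map_mem a.2.1)
  · intro a
    exact (hg.contDiffOn_koszul a.1 _ _ _).comp (Pts.map a.2.1).contDiff.contDiffOn
      (hg.map_mem a.2.1)
  · intro a y hy
    exact hg.isChristoffel_leviCivita hy u v a.1 a.2.1 a.2.2
  · intro p hp
    refine hg.eq_of_forall hx fun D f w => ?_
    rw [hp ⟨D, f, w⟩, map_zero]
    have := hg.bilinear.smul_left (hg.map_mem f x hx) 0 0 w
    rw [zero_smul, zero_smul] at this
    exact this.symm

/-- Differentiating the defining equation expresses the pairing with the derivative of the symbols
through derivatives of the Koszul expression and of the form. Both are even linear in the direction,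
and `eq_of_forall` removes the pairing. -/
lemma fderiv_leviCivita_esmul (u v : Pts m n C) (a : part 0 C.r) (h : Pts m n C) :
    fderiv ℝ (fun y => leviCivita g C y u v) x (Pts.esmul a h) =
      Pts.esmul a (fderiv ℝ (fun y => leviCivita g C y u v) x h) := by
  have hz : HasFDerivAt (fun y => leviCivita g C y u v)
      (fderiv ℝ (fun y => leviCivita g C y u v) x) x :=
    ((hg.contDiffAt_leviCivita hx u v).differentiableAt (by simp)).hasFDerivAt
  have key : ∀ (D : SPoint s) (f : C ⟶ D) (w : Pts m n D) (q : Pts m n C),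
      g D (Pts.map f x) (Pts.map f (fderiv ℝ (fun y => leviCivita g C y u v) x q)) w =
        fderiv ℝ (fun y => koszul g D y (Pts.map f u) (Pts.map f v) w) (Pts.map f x)
          (Pts.map f q) -
        dForm g D (Pts.map f x) (Pts.map f q) (Pts.map f (leviCivita g C x u v)) w := by
    intro D f w q
    have hfx := hg.map_mem f x hx
    obtain ⟨L, hL, hLq⟩ := (hg.bilinear.isBilinOn D).hasFDerivAt_comp (hg.isOpen D)
      (φ := Pts.map f) (y := x) hfx (Pts.map f).hasFDerivAt
      ((Pts.map f).hasFDerivAt.comp x hz) (hasFDerivAt_const w x)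
    have hk : HasFDerivAt ((fun y => koszul g D y (Pts.map f u) (Pts.map f v) w) ∘ Pts.map f) _ x :=
      (((hg.contDiffOn_koszul D (Pts.map f u) (Pts.map f v) w).contDiffAt
        ((hg.isOpen D).mem_nhds hfx)).differentiableAt (by simp)).hasFDerivAt.comp x
        (Pts.map f).hasFDerivAt
    have he : (fun y => g D (Pts.map f y) ((Pts.map f ∘ fun y => leviCivita g C y u v) y) w) =ᶠ[𝓝 x]
        (fun y => koszul g D y (Pts.map f u) (Pts.map f v) w) ∘ Pts.map f := by
      filter_upwards [(hg.isOpen C).mem_nhds hx] with y hy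
        using hg.isChristoffel_leviCivita hy u v D f w
    have h1 := congrArg (fun A => A q) (hL.unique (hk.congr_of_eventuallyEq he))
    have h0 : g D (Pts.map f x) (Pts.map f (leviCivita g C x u v)) 0 = 0 := by
      have := hg.bilinear.smul_right hfx 0 (Pts.map f (leviCivita g C x u v)) 0
      rwa [zero_smul, zero_smul] at this
    have h2 := hLq q
    rw [h1] at h2
    rw [eq_sub_iff_add_eq, add_comm]
    refine Eq.trans ?_ h2.symm
    change _ = _ + g D (Pts.map f x) (Pts.map f (leviCivita g C x u v)) 0
    rw [h0, add_zero]
    rfl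
  refine hg.eq_of_forall hx fun D f w => ?_
  have hfx := hg.map_mem f x hx
  rw [key, Pts.map_esmul, Pts.map_esmul, hg.bilinear.esmul_left D _ hfx, key,
    hg.fderiv_koszul_esmul hfx, dForm_esmul₁ hg.bilinear hfx, Pts.esmul_sub]

omit hx in
lemma isSuperBilinearOn_leviCivita : IsSuperBilinearOn S (leviCivita g) where
  add_left C x hx v v' w := hg.leviCivita_eq hx fun D f q => by
    have hfx := hg.map_mem f x hx
    rw [map_add, map_add, hg.bilinear.add_left D _ hfx, koszul_add₁ hg.bilinear hg.isOpen hfx,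
      hg.isChristoffel_leviCivita hx, hg.isChristoffel_leviCivita hx]
  add_right C x hx v w w' := hg.leviCivita_eq hx fun D f q => by
    have hfx := hg.map_mem f x hx
    rw [map_add, map_add, hg.bilinear.add_left D _ hfx, koszul_add₂ hg.bilinear hg.isOpen hfx,
      hg.isChristoffel_leviCivita hx, hg.isChristoffel_leviCivita hx]
  esmul_left C x hx a v w := hg.leviCivita_eq hx fun D f q => by
    have hfx := hg.map_mem f x hx
    rw [Pts.map_esmul, Pts.map_esmul, hg.bilinear.esmul_left D _ hfx,
      koszul_esmul₁ hg.bilinear hg.isOpen hfx, hg.isChristoffel_leviCivita hx]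
  esmul_right C x hx a v w := hg.leviCivita_eq hx fun D f q => by
    have hfx := hg.map_mem f x hx
    rw [Pts.map_esmul, Pts.map_esmul, hg.bilinear.esmul_left D _ hfx,
      koszul_esmul₂ hg.bilinear hg.isOpen hfx, hg.isChristoffel_leviCivita hx]
  natural f x hx v w := hg.leviCivita_natural hx f v w
  smooth C v w := fun x hx => (hg.contDiffAt_leviCivita hx v w).contDiffWithinAt
  fderiv_esmul C x hx v w a h := hg.fderiv_leviCivita_esmul hx v w a h

end IsMetricOn

/-- The second differentials of a supersmooth map are natural. -/
lemma IsSupersmoothOn.fderiv_fderiv_natural {S : ∀ C : SPoint s, Set (Pts m n C)}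
    {F : ∀ C : SPoint s, Pts m n C → Pts k l C} (hF : IsSupersmoothOn S F)
    (hS : ∀ C, IsOpen (S C)) {C D : SPoint s} (f : C ⟶ D) {x : Pts m n C} (hx : x ∈ S C)
    (u v : Pts m n C) :
    fderiv ℝ (fun y => fderiv ℝ (F D) y (Pts.map f v)) (Pts.map f x) (Pts.map f u) =
      Pts.map f (fderiv ℝ (fun y => fderiv ℝ (F C) y v) x u) := by
  refine fderiv_natural_of_comm f (hS C) (fun y hy => hF.fderiv_natural hS f hy v) hx ?_ ?_ u
  · exact ((contDiffOn_fderiv_apply (hS C) (hF.smooth C) v).contDiffAt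
      ((hS C).mem_nhds hx)).differentiableAt (by simp)
  · exact ((contDiffOn_fderiv_apply (hS D) (hF.smooth D) _).contDiffAt
      ((hS D).mem_nhds (hF.natural f x hx).1)).differentiableAt (by simp)

/-- The Koszul expression of a metric that is the pullback of another one. -/
lemma IsMetricOn.koszul_pullback {S' : ∀ C : SPoint s, Set (Pts m n C)}
    {g g' : ∀ C : SPoint s, Pts m n C → Pts m n C → Pts m n C → Pts 1 0 C}
    (hg' : IsMetricOn S' g') {D : SPoint s} {T : Set (Pts m n D)} {φ : Pts m n D → Pts m n D}
    (hT : IsOpen T) (hφ : ContDiffOn ℝ ∞ φ T) (hφT : MapsTo φ T (S' D))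
    (hφg : ∀ x ∈ T, ∀ v w, g D x v w = g' D (φ x) (fderiv ℝ φ x v) (fderiv ℝ φ x w))
    {y : Pts m n D} (hy : y ∈ T) (p q r : Pts m n D) : koszul g D y p q r =
      koszul g' D (φ y) (fderiv ℝ φ y p) (fderiv ℝ φ y q) (fderiv ℝ φ y r) +
      g' D (φ y) (fderiv ℝ (fun y => fderiv ℝ φ y q) y p) (fderiv ℝ φ y r) := by
  -- The product rule for a pulled back form gives the pulled back derivative and two terms with
  -- second derivatives of φ.
  have hd : ∀ p q r, dForm g D y p q r =
      dForm g' D (φ y) (fderiv ℝ φ y p) (fderiv ℝ φ y q) (fderiv ℝ φ y r) +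
      g' D (φ y) (fderiv ℝ (fun y => fderiv ℝ φ y q) y p) (fderiv ℝ φ y r) +
      g' D (φ y) (fderiv ℝ (fun y => fderiv ℝ φ y r) y p) (fderiv ℝ φ y q) := by
    intro p q r
    have hd2 : ∀ q, HasFDerivAt (fun y => fderiv ℝ φ y q)
        (fderiv ℝ (fun y => fderiv ℝ φ y q) y) y := fun q =>
      (((contDiffOn_fderiv_apply hT hφ q).contDiffAt
        (hT.mem_nhds hy)).differentiableAt (by simp)).hasFDerivAt
    obtain ⟨L, hL, hLp⟩ := (hg'.bilinear.isBilinOn D).hasFDerivAt_comp (hg'.isOpen D) (hφT hy)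
      ((hφ.contDiffAt (hT.mem_nhds hy)).differentiableAt (by simp)).hasFDerivAt
      (hd2 q) (hd2 r)
    have he : (fun y => g D y q r) =ᶠ[𝓝 y] fun y =>
        g' D (φ y) (fderiv ℝ φ y q) (fderiv ℝ φ y r) := by
      filter_upwards [hT.mem_nhds hy] with z hz using hφg z hz q r
    have h1 : dForm g D y p q r = L p :=
      congrArg (fun A => A p) (hL.congr_of_eventuallyEq he).fderiv
    rw [h1, hLp p, hg'.symm D (φ y) (hφT hy) (fderiv ℝ φ y q)
      (fderiv ℝ (fun y => fderiv ℝ φ y r) y p)]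
    rfl
  have hsy : ∀ p q, fderiv ℝ (fun y => fderiv ℝ φ y q) y p =
      fderiv ℝ (fun y => fderiv ℝ φ y p) y q := fun p q => by
    rw [fderiv_fderiv_apply hT hφ hy, fderiv_fderiv_apply hT hφ hy]
    exact isSymm_fderiv_fderiv hT hφ hy p q
  have h1 := hd p q r
  have h2 := hd q p r
  have h3 := hd r p q
  -- After second derivatives are symmetrised, three different extra terms occur, each twice. In the
  -- signed Koszul sum two of them cancel and the remaining one survives with coefficient 1.
  rw [hsy q p] at h2
  rw [hsy r p, hsy r q] at h3
  rw [koszul, koszul, h1, h2, h3]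
  exact half_sum_sub _ _ _ _ _ _

/-- The transformation rule of the Levi-Civita connection under isometries. -/
lemma IsMetricOn.fderiv_leviCivita {S S' T : ∀ C : SPoint s, Set (Pts m n C)}
    {g g' : ∀ C : SPoint s, Pts m n C → Pts m n C → Pts m n C → Pts 1 0 C}
    (hg : IsMetricOn S g) (hg' : IsMetricOn S' g') {φ : ∀ C : SPoint s, Pts m n C → Pts m n C}
    (hT : ∀ C, IsOpen (T C)) (hTS : ∀ C, T C ⊆ S C) (hφ : IsSupersmoothOn T φ)
    (hφT : ∀ C, MapsTo (φ C) (T C) (S' C))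
    (hφs : ∀ C, ∀ x ∈ T C, Function.Surjective (fderiv ℝ (φ C) x))
    (hφg : ∀ C, ∀ x ∈ T C, ∀ v w, g C x v w =
      g' C (φ C x) (fderiv ℝ (φ C) x v) (fderiv ℝ (φ C) x w))
    {C : SPoint s} {x : Pts m n C} (hx : x ∈ T C) (u v : Pts m n C) :
    fderiv ℝ (φ C) x (leviCivita g C x u v) = fderiv ℝ (fun y => fderiv ℝ (φ C) y v) x u +
      leviCivita g' C (φ C x) (fderiv ℝ (φ C) x u) (fderiv ℝ (φ C) x v) := by
  rw [← sub_eq_iff_eq_add']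
  refine (hg'.leviCivita_eq (hφT C hx) fun D f w => ?_).symm
  obtain ⟨hfx, hφf⟩ := hφ.natural f x hx
  -- Surjectivity of the differential allows testing only against images, where the pullback formula
  -- for the Koszul expression applies.
  obtain ⟨w, rfl⟩ := hφs D _ hfx w
  have e1 := hφ.fderiv_natural hT f hx u
  have e2 := hφ.fderiv_natural hT f hx v
  have e3 := hφ.fderiv_natural hT f hx (leviCivita g C x u v)
  have e4 := hφ.fderiv_fderiv_natural hT f hx u v
  rw [← hg.leviCivita_natural (hTS C hx)] at e3
  have h1 := hg.form_leviCivita (hTS D hfx) (Pts.map f u) (Pts.map f v) w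
  rw [hφg D _ hfx, hg'.koszul_pullback (hT D) (hφ.smooth D) (hφT D) (hφg D) hfx,
    ← sub_eq_iff_eq_add, e1, e2, e3, e4] at h1
  rw [← hφf, map_sub, ← h1, eq_sub_iff_add_eq, ← hg'.bilinear.add_left D _ (hφT D hfx),
    sub_add_cancel]

end

/-! ## The Levi-Civita connection of a supermanifold -/

section

variable {s m n k l : ℕ}

/-! ### Charts, reduced points and coordinate changes. -/

namespace Supermanifold

variable (M : Supermanifold.{u} s m n)

lemma target_eq (i : M.ι) : M.target i = redSet n (M.dom i) :=
  funext fun C => M.chart_target i C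

lemma isOpen_target (i : M.ι) (C : SPoint s) : IsOpen (M.target i C) := by
  rw [M.target_eq]
  exact isOpen_redSet (M.isOpen_dom i) C

lemma map_mem_target (i : M.ι) {C D : SPoint s} (f : C ⟶ D) {x : Pts m n C}
    (hx : x ∈ M.target i C) : Pts.map f x ∈ M.target i D := by
  rw [M.target_eq] at hx ⊢
  exact map_mem_redSet f hx

lemma trans_mem_target {i j : M.ι} {C : SPoint s} {x : Pts m n C} (hx : x ∈ M.overlap i j C) :
    M.trans i j C x ∈ M.target j C := (M.chart j C).map_source hx.2

lemma trans_mem_overlap {i j : M.ι} {C : SPoint s} {x : Pts m n C} (hx : x ∈ M.overlap i j C) :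
    M.trans i j C x ∈ M.overlap j i C := by
  refine ⟨M.trans_mem_target hx, ?_⟩
  have h2 : (M.chart i C).symm x ∈ (M.chart j C).source := hx.2
  change (M.chart j C).symm (M.chart j C ((M.chart i C).symm x)) ∈ (M.chart i C).source
  rw [(M.chart j C).left_inv h2]
  exact (M.chart i C).map_target hx.1

lemma trans_trans {i j : M.ι} {C : SPoint s} {x : Pts m n C} (hx : x ∈ M.overlap i j C) :
    M.trans j i C (M.trans i j C x) = x := by
  have h2 : (M.chart i C).symm x ∈ (M.chart j C).source := hx.2
  change M.chart i C ((M.chart j C).symm (M.chart j C ((M.chart i C).symm x))) = x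
  rw [(M.chart j C).left_inv h2]
  exact (M.chart i C).right_inv hx.1

lemma fderiv_trans_fderiv_trans {i j : M.ι} {C : SPoint s} {x : Pts m n C}
    (hx : x ∈ M.overlap i j C) (v : Pts m n C) :
    fderiv ℝ (M.trans j i C) (M.trans i j C x) (fderiv ℝ (M.trans i j C) x v) = v := by
  have h1 := (differentiableAt_trans j i C (M.trans_mem_overlap hx)).hasFDerivAt.comp x
    (differentiableAt_trans i j C hx).hasFDerivAt
  have h2 : M.trans j i C ∘ M.trans i j C =ᶠ[𝓝 x] id := by
    filter_upwards [(M.isOpen_overlap i j C).mem_nhds hx] with y hy using M.trans_trans hy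
  exact congrArg (fun A => A v) (h1.unique ((hasFDerivAt_id x).congr_of_eventuallyEq h2))

lemma fderiv_trans_surjective {i j : M.ι} {C : SPoint s} {x : Pts m n C}
    (hx : x ∈ M.overlap i j C) : Function.Surjective (fderiv ℝ (M.trans i j C) x) := by
  intro v
  have h := M.fderiv_trans_fderiv_trans (M.trans_mem_overlap hx) v
  rw [M.trans_trans hx] at h
  exact ⟨_, h⟩

lemma map_toPt_map {C D : SPoint s} (f : C ⟶ D) (q : M.pts.obj C) :
    M.pts.map D.toPt (M.pts.map f q) = M.pts.map C.toPt q := by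
  have h : f ≫ D.toPt = C.toPt := by
    refine SPoint.Hom.ext ?_
    change (bodyHom D.r 0).comp (SPoint.Hom.alg f) = bodyHom C.r 0
    exact bodyHom_comp_eq f.parity _
  rw [← h, Functor.map_comp_apply]

/-- Chart domains are determined by reduced points, and a morphism of superpoints does not change
the reduced point. -/
lemma map_mem_source_iff (i : M.ι) {C D : SPoint s} (f : C ⟶ D) (q : M.pts.obj C) :
    M.pts.map f q ∈ (M.chart i D).source ↔ q ∈ (M.chart i C).source := by
  rw [M.mem_source_iff, M.map_toPt_map, ← M.mem_source_iff]

lemma exists_mem_source {C : SPoint s} (q : M.pts.obj C) : ∃ i, q ∈ (M.chart i C).source := by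
  obtain ⟨i, hi⟩ := M.cover (M.pts.map C.toPt q)
  exact ⟨i, (M.mem_source_iff i C q).2 hi⟩

lemma chart_mem_overlap {i j : M.ι} {C : SPoint s} {q : M.pts.obj C}
    (hi : q ∈ (M.chart i C).source) (hj : q ∈ (M.chart j C).source) :
    M.chart i C q ∈ M.overlap i j C := by
  refine ⟨(M.chart i C).map_source hi, ?_⟩
  change (M.chart i C).symm (M.chart i C q) ∈ (M.chart j C).source
  rwa [(M.chart i C).left_inv hi]

lemma trans_chart {i j : M.ι} {C : SPoint s} {q : M.pts.obj C}
    (hi : q ∈ (M.chart i C).source) : M.trans i j C (M.chart i C q) = M.chart j C q := by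
  change M.chart j C ((M.chart i C).symm (M.chart i C q)) = _
  rw [(M.chart i C).left_inv hi]

lemma continuousOn_chart_symm (i : M.ι) (C : SPoint s) :
    ContinuousOn (M.chart i C).symm (M.chart i C).target := by
  rw [continuousOn_iff_continuous_domRestrict, continuous_def]
  intro V hV
  exact (isOpen_coinduced.1 (isOpen_iSup_iff.1 hV i))

/-- The part of the domain of a chart that is given by an open set of reduced coordinates. -/
def chartSet (i : M.ι) (O : Set (Fin m → ℝ)) (C : SPoint s) : Set (M.pts.obj C) :=
  {q | q ∈ (M.chart i C).source ∧ Pts.red (M.chart i C q) ∈ O}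

lemma isOpen_chartSet (i : M.ι) {O : Set (Fin m → ℝ)} (hO : IsOpen O) (C : SPoint s) :
    IsOpen (M.chartSet i O C) := by
  refine isOpen_iSup_iff.2 fun j => isOpen_coinduced.2 ?_
  have h1 : IsOpen (M.overlap j i C ∩ M.trans j i C ⁻¹' redSet n O C) :=
    ((M.transition j i).smooth C).continuousOn.isOpen_inter_preimage (M.isOpen_overlap j i C)
      (isOpen_redSet hO C)
  convert h1.preimage continuous_subtype_val using 1
  ext ⟨x, hx⟩
  exact ⟨fun h => ⟨⟨hx, h.1⟩, h.2⟩, fun h => ⟨h.1.2, h.2⟩⟩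

lemma restrict_chartSet (i : M.ι) (O : Set (Fin m → ℝ)) (C : SPoint s) :
    M.restrict (M.chartSet i O (SPoint.pt s)) C = M.chartSet i O C := by
  ext q
  change M.pts.map C.toPt q ∈ _ ∧ _ ↔ _
  rw [map_mem_source_iff]
  refine and_congr_right fun hq => ?_
  rw [(M.chart_natural i C.toPt q hq).2, Pts.red_map]

end Supermanifold

open Supermanifold

variable {M : Supermanifold.{u} s m n}

lemma RiemannianMetric.isMetricOn (g : RiemannianMetric M) (i : M.ι) :
    IsMetricOn (M.target i) (g.form i) where
  bilinear := g.bilinear i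
  isOpen := M.isOpen_target i
  map_mem f _ hx := M.map_mem_target i f hx
  symm := g.symm i
  nondegenerate := g.nondegenerate i

/-- The Levi-Civita connection of a Riemannian metric. -/
def RiemannianMetric.leviCivita (g : RiemannianMetric M) : Connection M where
  Γ i := SuperGeometry.leviCivita (g.form i)
  bilinear i := (g.isMetricOn i).isSuperBilinearOn_leviCivita
  compat i j C x hx v w := by
    have h := (g.isMetricOn i).fderiv_leviCivita (g.isMetricOn j) (M.isOpen_overlap i j)
      (fun C x hx => hx.1) (M.transition i j) (fun C x hx => M.trans_mem_target hx)
      (fun C x hx => M.fderiv_trans_surjective hx) (g.compat i j) hx v w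
    refine h.trans ?_
    rw [fderiv_fderiv_apply (M.isOpen_overlap i j C) ((M.transition i j).smooth C) hx]
    rfl

lemma RiemannianMetric.isLeviCivita_leviCivita (g : RiemannianMetric M) :
    g.leviCivita.IsLeviCivita g where
  torsion_free i _ _ hx v w := (g.isMetricOn i).leviCivita_comm hx v w
  metric i _ _ hx u v w := (g.isMetricOn i).dForm_eq_leviCivita hx u v w

end

/-! ## The geodesic vector field -/

section

variable {s m n k l : ℕ}

/-! ### Regularity and second derivatives of curves. -/

section Curves

variable {E E' : Type} [NormedAddCommGroup E] [NormedSpace ℝ E] [NormedAddCommGroup E']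
  [NormedSpace ℝ E']

/-- Bootstrapping: if `u` is C^k then so is its derivative F ∘ u. -/
lemma contDiffOn_of_hasDerivAt {S : Set E} {F : E → E} (hF : ContDiffOn ℝ ∞ F S) {J : Set ℝ}
    (hJ : IsOpen J) {u : ℝ → E} (hu : ∀ t ∈ J, u t ∈ S ∧ HasDerivAt u (F (u t)) t) :
    ContDiffOn ℝ ∞ u J := by
  refine contDiffOn_infty.2 fun k => ?_
  induction k with
  | zero => exact contDiffOn_zero.2 fun t ht => (hu t ht).2.continuousAt.continuousWithinAt
  | succ k ih =>
    rw [Nat.cast_succ, contDiffOn_succ_iff_deriv_of_isOpen hJ]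
    refine ⟨fun t ht => (hu t ht).2.differentiableAt.differentiableWithinAt, by simp, ?_⟩
    exact (((hF.of_le (by exact_mod_cast le_top)).comp ih fun t ht => (hu t ht).1)).congr
      fun t ht => (hu t ht).2.deriv

lemma hasDerivAt_deriv {c : ℝ → E} {t : ℝ} (hc : ContDiffAt ℝ ∞ c t) :
    HasDerivAt (deriv c) (deriv (deriv c) t) t := by
  have h1 : ContDiffAt ℝ ∞ (deriv c) t := by
    have h := (hc.fderiv_right (m := ∞) (by simp)).clm_apply (contDiffAt_const (c := (1 : ℝ)))
    exact h
  exact (h1.differentiableAt (by simp)).hasDerivAt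

lemma contDiffAt_deriv_comp {T : Set E} (hT : IsOpen T) {φ : E → E'} (hφ : ContDiffOn ℝ ∞ φ T)
    {c : ℝ → E} {t : ℝ} (hc : ContDiffAt ℝ ∞ c t) (ht : c t ∈ T) :
    ContDiffAt ℝ ∞ (fun r => φ (c r)) t ∧
      deriv (fun r => φ (c r)) t = fderiv ℝ φ (c t) (deriv c t) ∧
      deriv (deriv fun r => φ (c r)) t =
        fderiv ℝ (fderiv ℝ φ) (c t) (deriv c t) (deriv c t) +
          fderiv ℝ φ (c t) (deriv (deriv c) t) := by
  have hd : ∀ᶠ r in 𝓝 t, HasDerivAt (fun r => φ (c r)) (fderiv ℝ φ (c r) (deriv c r)) r := by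
    have h1 : ∀ᶠ r in 𝓝 t, DifferentiableAt ℝ c r := by
      filter_upwards [(hc.of_le (m := 1) (by simp)).eventually (by simp)] with r hr
        using hr.differentiableAt (by simp)
    filter_upwards [h1, hc.continuousAt (hT.mem_nhds ht)] with r hr hrT
    exact ((hφ.contDiffAt (hT.mem_nhds hrT)).differentiableAt
      (by simp)).hasFDerivAt.comp_hasDerivAt r hr.hasDerivAt
  refine ⟨(hφ.contDiffAt (hT.mem_nhds ht)).comp t hc, hd.self_of_nhds.deriv, ?_⟩
  have he : (deriv fun r => φ (c r)) =ᶠ[𝓝 t] fun r => fderiv ℝ φ (c r) (deriv c r) := by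
    filter_upwards [hd] with r hr using hr.deriv
  rw [he.deriv_eq]
  have h2 : HasDerivAt (fun r => fderiv ℝ φ (c r)) (fderiv ℝ (fderiv ℝ φ) (c t) (deriv c t)) t :=
    (hasFDerivAt_fderiv hT hφ ht).comp_hasDerivAt t (hc.differentiableAt (by simp)).hasDerivAt
  exact (h2.clm_apply (hasDerivAt_deriv hc)).deriv

end Curves

section Spray

/-- The functor `T ℝ^{m|n}` on morphisms of superpoints. -/
def Pts.map₂ {C D : SPoint s} (f : C ⟶ D) : Pts m n C × Pts m n C →L[ℝ] Pts m n D × Pts m n D :=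
  (Pts.map f).prodMap (Pts.map f)

/-- The geodesic vector field. -/
def spray (Γ : ∀ C : SPoint s, Pts m n C → Pts m n C → Pts m n C → Pts m n C) (C : SPoint s)
    (y : Pts m n C × Pts m n C) : Pts m n C × Pts m n C := (y.2, -Γ C y.1 y.2 y.2)

/-- The tangent bundle of a superdomain. -/
def phaseSet (n : ℕ) (O : Set (Fin m → ℝ)) (C : SPoint s) : Set (Pts m n C × Pts m n C) :=
  {y | y.1 ∈ redSet n O C}

variable {O : Set (Fin m → ℝ)}
  {Γ : ∀ C : SPoint s, Pts m n C → Pts m n C → Pts m n C → Pts m n C}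

lemma isOpen_phaseSet (hO : IsOpen O) (C : SPoint s) : IsOpen (phaseSet n O C) :=
  (isOpen_redSet hO C).preimage continuous_fst

lemma contDiffOn_spray (h : IsSuperBilinearOn (redSet n O) Γ) (C : SPoint s) :
    ContDiffOn ℝ ∞ (spray Γ C) (phaseSet n O C) :=
  contDiff_snd.contDiffOn.prodMk ((h.isBilinOn C).contDiffOn_comp contDiff_fst.contDiffOn
    (fun _ hy => hy) contDiff_snd.contDiffOn contDiff_snd.contDiffOn).neg

lemma spray_map₂ (h : IsSuperBilinearOn (redSet n O) Γ) {C D : SPoint s} (f : C ⟶ D)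
    {y : Pts m n C × Pts m n C} (hy : y ∈ phaseSet n O C) :
    spray Γ D (Pts.map₂ f y) = Pts.map₂ f (spray Γ C y) :=
  Prod.ext rfl (by
    change -Γ D (Pts.map f y.1) (Pts.map f y.2) (Pts.map f y.2) = Pts.map f (-_)
    rw [h.natural f y.1 hy, map_neg])

lemma hasDerivAt_map₂ (h : IsSuperBilinearOn (redSet n O) Γ) {C D : SPoint s} (f : C ⟶ D)
    {u : ℝ → Pts m n C × Pts m n C} {t : ℝ} (hu : u t ∈ phaseSet n O C)
    (hd : HasDerivAt u (spray Γ C (u t)) t) :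
    HasDerivAt (fun r => Pts.map₂ f (u r)) (spray Γ D (Pts.map₂ f (u t))) t := by
  rw [spray_map₂ h f hu]
  exact (Pts.map₂ f).hasFDerivAt.comp_hasDerivAt t hd

lemma Pts.continuous_real (C : SPoint s) :
    Continuous (Pts.real C : (Fin m → ℝ) → Pts m n C) := by
  let L : (Fin m → ℝ) →ₗ[ℝ] Pts m n C :=
    { toFun := Pts.real C
      map_add' := fun x y => by
        apply Pts.ext_coord <;> intro i
        · exact map_add (algebraMap ℝ (Grassmann C.r)) (x i) (y i)
        · exact (add_zero (0 : Grassmann C.r)).symm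
      map_smul' := fun c x => by
        apply Pts.ext_coord <;> intro i
        · exact (map_mul (algebraMap ℝ (Grassmann C.r)) c (x i)).trans (Algebra.smul_def _ _).symm
        · exact (smul_zero c).symm }
  exact L.continuous_of_finiteDimensional

lemma map_scaleHom_inclSnd {C : SPoint s} (c : ℝ) (x : Pts m n C) :
    Pts.map (C.scaleHom c) (Pts.lin (inclSnd C.r) x : Pts m n C.double) =
      (Pts.lin (inclSnd C.r) (Pts.scale c x) : Pts m n C.double) :=
  lin_scaleSnd_inclSnd c x

lemma Pts.continuous_scale {C : SPoint s} (x : Pts m n C) :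
    Continuous fun c : ℝ => Pts.scale c x := by
  have h := (Pts.contDiff_lin_affine (C := C) (D := C) 0 LinearMap.id x).continuous
  simp only [zero_add] at h
  exact h

lemma continuous_scaleHom_inclSnd {C : SPoint s} (x : Pts m n C) : Continuous fun c : ℝ =>
    Pts.map (C.scaleHom c) (Pts.lin (inclSnd C.r) x : Pts m n C.double) := by
  simp only [map_scaleHom_inclSnd]
  exact (Pts.lin (inclSnd C.r) : Pts m n C →L[ℝ] Pts m n C.double).continuous.comp
    (Pts.continuous_scale x)

lemma map_scaleHom_zero_inclSnd {C : SPoint s} (x : Pts m n C) :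
    Pts.map (C.scaleHom 0) (Pts.lin (inclSnd C.r) x : Pts m n C.double) =
      Pts.real C.double (Pts.red x) := by
  rw [map_scaleHom_inclSnd, Pts.scale, zero_smul, Pts.lin_zero_eq_real]
  exact Pts.coordMap_real _ _ _

lemma map_fold_scaleHom_inclSnd {C : SPoint s} {c : ℝ} (hc : c ≠ 0) (x : Pts m n C) :
    Pts.map C.foldHom (Pts.map (C.scaleHom c⁻¹)
      (Pts.map (C.scaleHom c) (Pts.lin (inclSnd C.r) x : Pts m n C.double))) = x := by
  have h1 : Pts.map (C.scaleHom c⁻¹)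
      (Pts.map (C.scaleHom c) (Pts.lin (inclSnd C.r) x : Pts m n C.double)) =
      (Pts.lin (inclSnd C.r) x : Pts m n C.double) := by
    refine (Pts.lin_lin (C := C.double) (D := C.double) (E := C.double) (scaleSnd C.r c)
      (scaleSnd C.r c⁻¹) _).trans ?_
    rw [scaleSnd_scaleSnd, inv_mul_cancel₀ hc, scaleSnd_one]
    exact Pts.lin_id _
  rw [h1]
  exact lin_fold_inclSnd x

/-- The geodesics whose initial conditions lie over a neighbourhood of a reduced point exist on a
common interval. -/
lemma exists_solution_near (hO : IsOpen O) (h : IsSuperBilinearOn (redSet n O) Γ) (C : SPoint s)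
    {a : Fin m → ℝ} (ha : a ∈ O) (b : Fin m → ℝ) :
    ∃ ε > 0, ∃ N : Set ((Fin m → ℝ) × (Fin m → ℝ)), IsOpen N ∧ (a, b) ∈ N ∧
      ∀ y : Pts m n C × Pts m n C, (Pts.red y.1, Pts.red y.2) ∈ N →
        ∃ u : ℝ → Pts m n C × Pts m n C, u 0 = y ∧ ∀ t ∈ Ioo (-ε) ε,
          u t ∈ phaseSet n O C ∧ HasDerivAt u (spray Γ C (u t)) t := by
  have ha' : ((Pts.real C.double a, Pts.real C.double b) : Pts m n C.double × Pts m n C.double) ∈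
      phaseSet n O C.double := by
    change Pts.red (Pts.real C.double a : Pts m n C.double) ∈ O
    rwa [Pts.red_real]
  obtain ⟨ε, hε, N, hN, haN, Φ, hΦ⟩ := exists_local_flow (isOpen_phaseSet hO C.double)
    (contDiffOn_spray h C.double) ha'
  refine ⟨ε, hε, {q | (Pts.real C.double q.1, Pts.real C.double q.2) ∈ N}, ?_, haN, fun y hy => ?_⟩
  · exact hN.preimage (((Pts.continuous_real _).comp continuous_fst).prodMk
      ((Pts.continuous_real _).comp continuous_snd))
  -- The initial value sits in the second block, scaled by `c`. At c = 0 it is the real point of its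
  -- body, which is in `N`, so it stays in `N` for some c ≠ 0. Scaling back by c⁻¹ and identifying
  -- the blocks are morphisms over `B` and carry solutions to solutions, with the same ε.
  let Y : ℝ → Pts m n C.double × Pts m n C.double := fun c =>
    (Pts.map (C.scaleHom c) (Pts.lin (inclSnd C.r) y.1),
      Pts.map (C.scaleHom c) (Pts.lin (inclSnd C.r) y.2))
  have hY : Continuous Y := (continuous_scaleHom_inclSnd y.1).prodMk (continuous_scaleHom_inclSnd y.2)
  have hY0 : Y 0 ∈ N := by
    simp only [Y, map_scaleHom_zero_inclSnd]
    exact hy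
  have hev : ∀ᶠ c in 𝓝[≠] (0 : ℝ), Y c ∈ N :=
    (hY.continuousAt.eventually (hN.mem_nhds hY0)).filter_mono nhdsWithin_le_nhds
  obtain ⟨c, hcN, hc⟩ := (hev.and self_mem_nhdsWithin).exists
  obtain ⟨h0, hsol⟩ := hΦ (Y c) hcN
  refine ⟨fun t => Pts.map₂ C.foldHom (Pts.map₂ (C.scaleHom c⁻¹) (Φ (Y c) t)), ?_, fun t ht => ?_⟩
  · change Pts.map₂ C.foldHom (Pts.map₂ (C.scaleHom c⁻¹) (Φ (Y c) 0)) = y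
    rw [h0]
    exact Prod.ext (map_fold_scaleHom_inclSnd hc y.1) (map_fold_scaleHom_inclSnd hc y.2)
  · obtain ⟨h1, h2, -⟩ := hsol t ht
    have h3 : Pts.map₂ (C.scaleHom c⁻¹) (Φ (Y c) t) ∈ phaseSet n O C.double :=
      map_mem_redSet _ h1
    exact ⟨map_mem_redSet (C.foldHom) h3, hasDerivAt_map₂ h C.foldHom h3
      (hasDerivAt_map₂ h (C.scaleHom c⁻¹) h1 h2)⟩

end Spray

end

/-! ## Geodesics -/

section

open Supermanifold

variable {s m n : ℕ} {M : Supermanifold.{u} s m n}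

namespace Connection

variable (nabla : Connection M)

lemma isSuperBilinearOn (i : M.ι) : IsSuperBilinearOn (redSet n (M.dom i)) (nabla.Γ i) := by
  rw [← M.target_eq]
  exact nabla.bilinear i

/-- The geodesic equation at a time `t` in the chart `i`. -/
structure IsGeodesicAt {C : SPoint s} (i : M.ι) (γ : ℝ → M.pts.obj C) (t : ℝ) : Prop where
  mem_source : ∀ᶠ r in 𝓝 t, γ r ∈ (M.chart i C).source
  contDiffAt : ContDiffAt ℝ ∞ (fun r => M.chart i C (γ r)) t
  equation : deriv (deriv fun r => M.chart i C (γ r)) t +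
      nabla.Γ i C (M.chart i C (γ t)) (deriv (fun r => M.chart i C (γ r)) t)
        (deriv (fun r => M.chart i C (γ r)) t) = 0

end Connection

/-- Coordinates of position and velocity of a curve. -/
def phase {C : SPoint s} (i : M.ι) (γ : ℝ → M.pts.obj C) (t : ℝ) : Pts m n C × Pts m n C :=
  (M.chart i C (γ t), deriv (fun r => M.chart i C (γ r)) t)

lemma phase_congr {C : SPoint s} (i : M.ι) {γ γ' : ℝ → M.pts.obj C} {t : ℝ}
    (h : γ =ᶠ[𝓝 t] γ') : phase i γ t = phase i γ' t := by
  have h1 : (fun r => M.chart i C (γ r)) =ᶠ[𝓝 t] fun r => M.chart i C (γ' r) := by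
    filter_upwards [h] with r hr
    rw [hr]
  exact Prod.ext h1.self_of_nhds h1.deriv_eq

variable {nabla : Connection M} {C : SPoint s} {i j : M.ι} {γ γ' : ℝ → M.pts.obj C} {t : ℝ}

lemma deriv_chart_change (h : ∀ᶠ r in 𝓝 t, γ r ∈ (M.chart i C).source)
    (hc : ContDiffAt ℝ ∞ (fun r => M.chart i C (γ r)) t) (hj : γ t ∈ (M.chart j C).source) :
    (∀ᶠ r in 𝓝 t, γ r ∈ (M.chart j C).source) ∧
      ContDiffAt ℝ ∞ (fun r => M.chart j C (γ r)) t ∧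
      deriv (fun r => M.chart j C (γ r)) t =
        fderiv ℝ (M.trans i j C) (M.chart i C (γ t)) (deriv (fun r => M.chart i C (γ r)) t) ∧
      deriv (deriv fun r => M.chart j C (γ r)) t =
        fderiv ℝ (fderiv ℝ (M.trans i j C)) (M.chart i C (γ t))
          (deriv (fun r => M.chart i C (γ r)) t) (deriv (fun r => M.chart i C (γ r)) t) +
        fderiv ℝ (M.trans i j C) (M.chart i C (γ t))
          (deriv (deriv fun r => M.chart i C (γ r)) t) := by
  have hmem := M.chart_mem_overlap h.self_of_nhds hj
  have hT := M.isOpen_overlap i j C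
  have he : (fun r => M.chart j C (γ r)) =ᶠ[𝓝 t]
      fun r => M.trans i j C (M.chart i C (γ r)) := by
    filter_upwards [h] with r hr using (M.trans_chart hr).symm
  have h1 : ∀ᶠ r in 𝓝 t, γ r ∈ (M.chart j C).source := by
    filter_upwards [h, hc.continuousAt.eventually (hT.mem_nhds hmem)] with r hr hrT
    have h2 : (M.chart i C).symm (M.chart i C (γ r)) ∈ (M.chart j C).source := hrT.2
    rwa [(M.chart i C).left_inv hr] at h2
  obtain ⟨a, b, c⟩ := contDiffAt_deriv_comp hT ((M.transition i j).smooth C) hc hmem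
  exact ⟨h1, a.congr_of_eventuallyEq he, he.deriv_eq.trans b, he.deriv.deriv_eq.trans c⟩

namespace Connection.IsGeodesicAt

lemma congr (h : nabla.IsGeodesicAt i γ t) (he : γ =ᶠ[𝓝 t] γ') : nabla.IsGeodesicAt i γ' t := by
  have h1 : (fun r => M.chart i C (γ' r)) =ᶠ[𝓝 t] fun r => M.chart i C (γ r) := by
    filter_upwards [he] with r hr
    rw [hr]
  refine ⟨?_, h.contDiffAt.congr_of_eventuallyEq h1, ?_⟩
  · filter_upwards [he, h.mem_source] with r hr hr2
    rwa [← hr]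
  · rw [h1.deriv.deriv_eq, h1.deriv_eq, ← he.self_of_nhds]
    exact h.equation

/-- The second derivative of the coordinate change produced by the chain rule is the inhomogeneous
term in `Connection.compat`. -/
lemma change (h : nabla.IsGeodesicAt i γ t) (hj : γ t ∈ (M.chart j C).source) :
    nabla.IsGeodesicAt j γ t := by
  obtain ⟨h1, h2, h3, h4⟩ := deriv_chart_change h.mem_source h.contDiffAt hj
  refine ⟨h1, h2, ?_⟩
  have hmem := M.chart_mem_overlap h.mem_source.self_of_nhds hj
  rw [h4, h3, ← M.trans_chart (j := j) h.mem_source.self_of_nhds, add_right_comm, ← nabla.compat i j C _ hmem,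
    ← map_add, add_comm, h.equation, map_zero]

lemma hasDerivAt_phase (h : nabla.IsGeodesicAt i γ t) :
    HasDerivAt (phase i γ) (spray (nabla.Γ i) C (phase i γ t)) t := by
  refine HasDerivAt.prodMk (h.contDiffAt.differentiableAt (by simp)).hasDerivAt ?_
  have h1 := hasDerivAt_deriv h.contDiffAt
  rwa [eq_neg_of_add_eq_zero_left h.equation] at h1

lemma phase_mem (h : nabla.IsGeodesicAt i γ t) : phase i γ t ∈ phaseSet n (M.dom i) C := by
  change M.chart i C (γ t) ∈ redSet n (M.dom i) C
  rw [← M.target_eq]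
  exact (M.chart i C).map_source h.mem_source.self_of_nhds

lemma continuousAt (h : nabla.IsGeodesicAt i γ t) : ContinuousAt γ t := by
  have h1 : ContinuousAt (fun r => (M.chart i C).symm (M.chart i C (γ r))) t := by
    refine ContinuousAt.comp (f := fun r => M.chart i C (γ r)) (g := (M.chart i C).symm) ?_
      h.contDiffAt.continuousAt
    exact (M.continuousOn_chart_symm i C).continuousAt ((M.isOpen_target i C).mem_nhds
      ((M.chart i C).map_source h.mem_source.self_of_nhds))
  refine h1.congr ?_
  filter_upwards [h.mem_source] with r hr using (M.chart i C).left_inv hr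

end Connection.IsGeodesicAt

/-- Solutions of the geodesic equation in a chart are geodesics. -/
lemma isGeodesicAt_of_solution {J : Set ℝ} (hJ : IsOpen J) {u : ℝ → Pts m n C × Pts m n C}
    (hu : ∀ t ∈ J, u t ∈ phaseSet n (M.dom i) C ∧ HasDerivAt u (spray (nabla.Γ i) C (u t)) t)
    (hγ : ∀ t ∈ J, γ t = (M.chart i C).symm (u t).1) (ht : t ∈ J) :
    nabla.IsGeodesicAt i γ t ∧ phase i γ t = u t := by
  have htar : ∀ r ∈ J, (u r).1 ∈ (M.chart i C).target := fun r hr => by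
    have h := (hu r hr).1
    rw [M.chart_target]
    exact h
  have h1 : ∀ r ∈ J, M.chart i C (γ r) = (u r).1 := fun r hr => by
    rw [hγ r hr, (M.chart i C).right_inv (htar r hr)]
  have he : ∀ r ∈ J, (fun r => M.chart i C (γ r)) =ᶠ[𝓝 r] fun r => (u r).1 := fun r hr => by
    filter_upwards [hJ.mem_nhds hr] with q hq using h1 q hq
  have hd1 : ∀ r ∈ J, deriv (fun r => M.chart i C (γ r)) r = (u r).2 := fun r hr => by
    rw [(he r hr).deriv_eq]
    exact (hasFDerivAt_fst.comp_hasDerivAt r (hu r hr).2).deriv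
  have he2 : (deriv fun r => M.chart i C (γ r)) =ᶠ[𝓝 t] fun r => (u r).2 := by
    filter_upwards [hJ.mem_nhds ht] with q hq using hd1 q hq
  refine ⟨⟨?_, ?_, ?_⟩, Prod.ext (h1 t ht) (hd1 t ht)⟩
  · filter_upwards [hJ.mem_nhds ht] with r hr
    rw [hγ r hr]
    exact (M.chart i C).map_target (htar r hr)
  · have h2 := contDiffOn_of_hasDerivAt (contDiffOn_spray (nabla.isSuperBilinearOn i) C) hJ hu
    exact ((h2.contDiffAt (hJ.mem_nhds ht)).fst).congr_of_eventuallyEq (he t ht)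
  · have h3 : HasDerivAt (fun r => (u r).2) (spray (nabla.Γ i) C (u t)).2 t :=
      (hasFDerivAt_snd (𝕜 := ℝ) (p := u t)).comp_hasDerivAt t (hu t ht).2
    rw [he2.deriv_eq, h1 t ht, hd1 t ht, h3.deriv]
    exact neg_add_cancel _

lemma isGeodesicOn_of_at {I : Set ℝ} (h : ∀ t ∈ I, ∃ i, nabla.IsGeodesicAt i γ t) :
    nabla.IsGeodesicOn I γ := by
  have h1 : ∀ t ∈ I, ∀ j, γ t ∈ (M.chart j C).source → nabla.IsGeodesicAt j γ t :=
    fun t ht j hj => (h t ht).choose_spec.change hj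
  exact ⟨fun t ht j hj => ⟨(h1 t ht j hj).mem_source, (h1 t ht j hj).contDiffAt⟩,
    fun t ht j hj => (h1 t ht j hj).equation⟩

namespace Connection.IsGeodesicOn

variable {I J : Set ℝ}

lemma at_ (h : nabla.IsGeodesicOn I γ) (ht : t ∈ I) (hi : γ t ∈ (M.chart i C).source) :
    nabla.IsGeodesicAt i γ t :=
  ⟨(h.1 t ht i hi).1, (h.1 t ht i hi).2, h.2 t ht i hi⟩

lemma mono (h : nabla.IsGeodesicOn I γ) (hJ : J ⊆ I) : nabla.IsGeodesicOn J γ :=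
  ⟨fun t ht => h.1 t (hJ ht), fun t ht => h.2 t (hJ ht)⟩

lemma of_eventuallyEq (h : ∀ t ∈ I, ∃ γ' : ℝ → M.pts.obj C, ∃ J, t ∈ J ∧
    nabla.IsGeodesicOn J γ' ∧ γ' =ᶠ[𝓝 t] γ) : nabla.IsGeodesicOn I γ := by
  refine isGeodesicOn_of_at fun t ht => ?_
  obtain ⟨γ', J, htJ, h', he⟩ := h t ht
  obtain ⟨i, hi⟩ := M.exists_mem_source (γ' t)
  exact ⟨i, (h'.at_ htJ hi).congr he⟩

/-- Two geodesics with the same initial data agree near this point. -/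
lemma eventuallyEq_of_phase_eq (h : nabla.IsGeodesicOn I γ) (h' : nabla.IsGeodesicOn I γ')
    (hI : IsOpen I) (ht : t ∈ I) (hi : γ t ∈ (M.chart i C).source)
    (hi' : γ' t ∈ (M.chart i C).source) (he : phase i γ t = phase i γ' t) : γ =ᶠ[𝓝 t] γ' := by
  have key : ∀ {δ : ℝ → M.pts.obj C}, nabla.IsGeodesicOn I δ → δ t ∈ (M.chart i C).source →
      ∀ᶠ r in 𝓝 t, δ r ∈ (M.chart i C).source ∧
        HasDerivAt (phase i δ) (spray (nabla.Γ i) C (phase i δ r)) r := fun hδ hδi => by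
    filter_upwards [hI.mem_nhds ht, (hδ.at_ ht hδi).mem_source] with r hr hr2
      using ⟨hr2, (hδ.at_ hr hr2).hasDerivAt_phase⟩
  have h1 := ode_unique_near (isOpen_phaseSet (M.isOpen_dom i) C)
    (contDiffOn_spray (nabla.isSuperBilinearOn i) C) ((key h hi).mono fun _ hr => hr.2)
    ((key h' hi').mono fun _ hr => hr.2) (h.at_ ht hi).phase_mem he
  filter_upwards [h1, key h hi, key h' hi'] with r hr hr1 hr2
  exact (M.chart i C).injOn hr1.1 hr2.1 (congrArg Prod.fst hr)

lemma map_at (h : nabla.IsGeodesicOn I γ) (hI : IsOpen I) {D : SPoint s} (f : C ⟶ D)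
    (ht : t ∈ I) (hi : γ t ∈ (M.chart i C).source) :
    nabla.IsGeodesicAt i (fun t => M.pts.map f (γ t)) t ∧
      phase i (fun t => M.pts.map f (γ t)) t = Pts.map₂ f (phase i γ t) := by
  obtain ⟨J, hJ, hJo, htJ⟩ := mem_nhds_iff.1
    ((hI.eventually_mem ht).and (h.at_ ht hi).mem_source)
  have hg : ∀ r ∈ J, nabla.IsGeodesicAt i γ r := fun r hr => h.at_ (hJ hr).1 (hJ hr).2
  refine isGeodesicAt_of_solution hJo (u := fun r => Pts.map₂ f (phase i γ r))
    (fun r hr => ⟨map_mem_redSet f (hg r hr).phase_mem,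
      hasDerivAt_map₂ (nabla.isSuperBilinearOn i) f (hg r hr).phase_mem
        (hg r hr).hasDerivAt_phase⟩) (fun r hr => ?_) htJ
  change _ = (M.chart i D).symm (Pts.map f (M.chart i C (γ r)))
  obtain ⟨h1, h2⟩ := M.chart_natural i f _ (hJ hr).2
  rw [← h2, (M.chart i D).left_inv h1]

lemma map (h : nabla.IsGeodesicOn I γ) (hI : IsOpen I) {D : SPoint s} (f : C ⟶ D) :
    nabla.IsGeodesicOn I (fun t => M.pts.map f (γ t)) := by
  refine isGeodesicOn_of_at fun t ht => ?_
  obtain ⟨i, hi⟩ := M.exists_mem_source (γ t)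
  exact ⟨i, (h.map_at hI f ht hi).1⟩

/-- Two geodesics that agree near one point agree everywhere. -/
lemma eqOn [T2Space (M.pts.obj (SPoint.pt s))] (h : nabla.IsGeodesicOn I γ)
    (h' : nabla.IsGeodesicOn I γ') (hI : IsOpen I) (hc : I.OrdConnected) {t₀ : ℝ} (ht₀ : t₀ ∈ I)
    (h0 : γ =ᶠ[𝓝 t₀] γ') : EqOn γ γ' I := by
  have key : I ⊆ {t | γ =ᶠ[𝓝 t] γ'} := by
    refine hc.isPreconnected.subset_of_closure_inter_subset ?_ ⟨t₀, ht₀, h0⟩ ?_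
    · exact isOpen_iff_mem_nhds.2 fun t ht => eventually_eventually_nhds.2 ht
    rintro t ⟨htc, ht⟩
    have hfr : ∃ᶠ r in 𝓝 t, γ =ᶠ[𝓝 r] γ' := mem_closure_iff_frequently.1 htc
    obtain ⟨i, hi⟩ := M.exists_mem_source (γ t)
    have hcont : ∀ {δ : ℝ → M.pts.obj C}, nabla.IsGeodesicOn I δ →
        Tendsto (fun r => M.pts.map C.toPt (δ r)) (𝓝 t) (𝓝 (M.pts.map C.toPt (δ t))) := fun hδ => by
      obtain ⟨j, hj⟩ := M.exists_mem_source _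
      exact (hδ.map_at hI C.toPt ht hj).1.continuousAt
    -- At a limit of times of agreement the reduced points agree, by the Hausdorff property of the
    -- reduced space. As chart domains see only reduced points, both curves are then in one chart,
    -- where position and velocity agree by continuity.
    have hred : M.pts.map C.toPt (γ t) = M.pts.map C.toPt (γ' t) :=
      tendsto_nhds_unique_of_frequently_eq (hcont h) (hcont h')
        (hfr.mono fun r hr => by rw [hr.self_of_nhds])
    have hi' : γ' t ∈ (M.chart i C).source := by
      rwa [M.mem_source_iff, ← hred, ← M.mem_source_iff]
    refine h.eventuallyEq_of_phase_eq h' hI ht hi hi' ?_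
    exact tendsto_nhds_unique_of_frequently_eq
      (h.at_ ht hi).hasDerivAt_phase.continuousAt.tendsto
      (h'.at_ ht hi').hasDerivAt_phase.continuousAt.tendsto
      (hfr.mono fun r hr => phase_congr i hr)
  exact fun t ht => (key ht).self_of_nhds

end Connection.IsGeodesicOn

/-- Local existence of geodesics, uniformly in the initial data over a neighbourhood. -/
lemma exists_geodesic_near (nabla : Connection M) (C : SPoint s) (i : M.ι) {a : Fin m → ℝ}
    (ha : a ∈ M.dom i) (b : Fin m → ℝ) :
    ∃ ε > 0, ∃ N : Set ((Fin m → ℝ) × (Fin m → ℝ)), IsOpen N ∧ (a, b) ∈ N ∧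
      ∀ (t₀ : ℝ) (y : Pts m n C × Pts m n C), (Pts.red y.1, Pts.red y.2) ∈ N →
        ∃ γ : ℝ → M.pts.obj C, nabla.IsGeodesicOn (Ioo (t₀ - ε) (t₀ + ε)) γ ∧
          (∀ t ∈ Ioo (t₀ - ε) (t₀ + ε), γ t ∈ (M.chart i C).source) ∧ phase i γ t₀ = y := by
  obtain ⟨ε, hε, N, hN, haN, h⟩ := exists_solution_near (M.isOpen_dom i)
    (nabla.isSuperBilinearOn i) C ha b
  refine ⟨ε, hε, N, hN, haN, fun t₀ y hy => ?_⟩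
  obtain ⟨u, hu0, hu⟩ := h y hy
  have hmem : ∀ t ∈ Ioo (t₀ - ε) (t₀ + ε), t - t₀ ∈ Ioo (-ε) ε := fun t ht =>
    ⟨by linarith [ht.1], by linarith [ht.2]⟩
  have key : ∀ t ∈ Ioo (t₀ - ε) (t₀ + ε), _ := fun t ht =>
    isGeodesicAt_of_solution (nabla := nabla) (i := i) isOpen_Ioo (u := fun t => u (t - t₀))
      (γ := fun t => (M.chart i C).symm (u (t - t₀)).1)
      (fun r hr => ⟨(hu _ (hmem r hr)).1, (hu _ (hmem r hr)).2.comp_sub_const r t₀⟩)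
      (fun r hr => rfl) ht
  refine ⟨fun t => (M.chart i C).symm (u (t - t₀)).1,
    isGeodesicOn_of_at fun t ht => ⟨i, (key t ht).1⟩,
    fun t ht => (key t ht).1.mem_source.self_of_nhds, ?_⟩
  rw [(key t₀ ⟨by linarith, by linarith⟩).2, sub_self, hu0]

end

/-! ## Existence and uniqueness of geodesics -/

section

open Supermanifold

variable {s m n : ℕ} {M : Supermanifold.{u} s m n} {nabla : Connection M} {C : SPoint s}
  {γ γ' : ℝ → M.pts.obj C} {I J : Set ℝ} {p : M.pts.obj (SPoint.base s)} {v : TangentVec p C}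

lemma nonempty_chartsAt (p : M.pts.obj (SPoint.base s)) : Nonempty (ChartsAt p) :=
  let ⟨i, hi⟩ := M.exists_mem_source p
  ⟨⟨i, hi⟩⟩

namespace Connection.IsGeodesicFrom

lemma mem_source (h : nabla.IsGeodesicFrom I p v γ) (i : ChartsAt p) :
    γ 0 ∈ (M.chart i.1 C).source := by
  rw [h.2.1]
  exact at_mem p i C

lemma phase_zero (h : nabla.IsGeodesicFrom I p v γ) (i : ChartsAt p) :
    phase i.1 γ 0 = (M.chart i.1 C (at_ p C), v.coord i) :=
  Prod.ext (congrArg (M.chart i.1 C) h.2.1) (h.2.2 i)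

/-- Velocities and tangent vectors change coordinates by the same differential, so one chart is
enough to check the initial condition. -/
lemma of_phase (h : nabla.IsGeodesicOn I γ) (hI : (0 : ℝ) ∈ I) (i : ChartsAt p)
    (hi : γ 0 ∈ (M.chart i.1 C).source)
    (hp : phase i.1 γ 0 = (M.chart i.1 C (at_ p C), v.coord i)) :
    nabla.IsGeodesicFrom I p v γ := by
  have h0 : γ 0 = Supermanifold.at_ p C :=
    (M.chart i.1 C).injOn hi (at_mem p i C) (congrArg Prod.fst hp)
  refine ⟨h, h0, fun j => ?_⟩
  have hg := h.at_ hI hi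
  have hj : γ 0 ∈ (M.chart j.1 C).source := by
    rw [h0]
    exact at_mem p j C
  have hv : deriv (fun r => M.chart i.1 C (γ r)) 0 = v.coord i := congrArg Prod.snd hp
  rw [(deriv_chart_change hg.mem_source hg.contDiffAt hj).2.2.1, hv, h0, v.compat i j]

lemma of_eventuallyEq (h : nabla.IsGeodesicFrom J p v γ) (h' : nabla.IsGeodesicOn I γ')
    (hI : (0 : ℝ) ∈ I) (he : γ =ᶠ[𝓝 0] γ') : nabla.IsGeodesicFrom I p v γ' := by
  obtain ⟨i⟩ := nonempty_chartsAt p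
  refine of_phase h' hI i ?_ ?_
  · rw [← he.self_of_nhds]
    exact h.mem_source i
  · rw [← phase_congr i.1 he, h.phase_zero i]

lemma mono (h : nabla.IsGeodesicFrom I p v γ) (hJ : J ⊆ I) : nabla.IsGeodesicFrom J p v γ :=
  ⟨h.1.mono hJ, h.2⟩

lemma map (h : nabla.IsGeodesicFrom I p v γ) (hI : IsOpen I) (h0 : (0 : ℝ) ∈ I) {D : SPoint s}
    (f : C ⟶ D) : nabla.IsGeodesicFrom I p (TangentVec.map p f v) (fun t => M.pts.map f (γ t)) := by
  obtain ⟨i⟩ := nonempty_chartsAt p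
  refine of_phase (h.1.map hI f) h0 i ?_ ?_
  · exact (M.chart_natural i.1 f _ (h.mem_source i)).1
  · rw [(h.1.map_at hI f h0 (h.mem_source i)).2, h.phase_zero i, ← map_at p f,
      (M.chart_natural i.1 f _ (at_mem p i C)).2]
    rfl

lemma eventuallyEq (h : nabla.IsGeodesicFrom I p v γ) (h' : nabla.IsGeodesicFrom I p v γ')
    (hI : IsOpen I) (h0 : (0 : ℝ) ∈ I) : γ =ᶠ[𝓝 0] γ' := by
  obtain ⟨i⟩ := nonempty_chartsAt p
  exact h.1.eventuallyEq_of_phase_eq h'.1 hI h0 (h.mem_source i) (h'.mem_source i)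
    ((h.phase_zero i).trans (h'.phase_zero i).symm)

variable [T2Space (M.pts.obj (SPoint.pt s))]

lemma eqOn (h : nabla.IsGeodesicFrom I p v γ) (h' : nabla.IsGeodesicFrom I p v γ')
    (hI : IsOpen I) (hc : I.OrdConnected) (h0 : (0 : ℝ) ∈ I) : EqOn γ γ' I :=
  h.1.eqOn h'.1 hI hc h0 (h.eventuallyEq h' hI h0)

end Connection.IsGeodesicFrom

open Connection

lemma exists_isGeodesicFrom (nabla : Connection M) (v : TangentVec p C) :
    ∃ T > (0 : ℝ), ∃ γ : ℝ → M.pts.obj C, nabla.IsGeodesicFrom (Ioo (-T) T) p v γ := by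
  obtain ⟨i⟩ := nonempty_chartsAt p
  have ha : Pts.red (M.chart i.1 C (at_ p C)) ∈ M.dom i.1 := by
    have h := (M.chart i.1 C).map_source (at_mem p i C)
    rwa [M.chart_target] at h
  obtain ⟨ε, hε, N, -, haN, h⟩ := exists_geodesic_near nabla C i.1 ha (Pts.red (v.coord i))
  obtain ⟨γ, hγ, hi, hp⟩ := h 0 (_, _) haN
  rw [zero_sub, zero_add] at hγ hi
  have h0 : (0 : ℝ) ∈ Ioo (-ε) ε := ⟨by linarith, hε⟩
  exact ⟨ε, hε, γ, IsGeodesicFrom.of_phase hγ h0 i (hi 0 h0) hp⟩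

variable [T2Space (M.pts.obj (SPoint.pt s))]

/-- A geodesic can be extended across a point to which the reduced geodesic extends. -/
lemma exists_geodesic_extension (hI : IsOpen I) (hIc : I.OrdConnected)
    {γ₀ : ℝ → M.pts.obj (SPoint.pt s)}
    (hγ₀ : nabla.IsGeodesicFrom I p (TangentVec.map p C.toPt v) γ₀) {t : ℝ} (ht : t ∈ I)
    (hcl : ∃ᶠ r in 𝓝 t, ∃ J, IsOpen J ∧ J.OrdConnected ∧ J ⊆ I ∧ 0 ∈ J ∧ r ∈ J ∧
      ∃ γ, nabla.IsGeodesicFrom J p v γ) :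
    ∃ J, IsOpen J ∧ J.OrdConnected ∧ J ⊆ I ∧ 0 ∈ J ∧ t ∈ J ∧
      ∃ γ, nabla.IsGeodesicFrom J p v γ := by
  classical
  obtain ⟨i, hi⟩ := M.exists_mem_source (γ₀ t)
  have hg := hγ₀.1.at_ ht hi
  have ha : Pts.red (phase i γ₀ t).1 ∈ M.dom i := hg.phase_mem
  -- Both ε and `N` are chosen from the reduced geodesic at time `t`; the nilpotent parts of the
  -- initial data have no influence on them.
  obtain ⟨ε, hε, N, hN, haN, h⟩ := exists_geodesic_near nabla C i ha (Pts.red (phase i γ₀ t).2)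
  have hcont : ContinuousAt (fun r => (Pts.red (phase i γ₀ r).1, Pts.red (phase i γ₀ r).2)) t :=
    ((Pts.redL _).continuous.continuousAt.comp hg.hasDerivAt_phase.continuousAt.fst).prodMk
      ((Pts.redL _).continuous.continuousAt.comp hg.hasDerivAt_phase.continuousAt.snd)
  have hdist : ∀ᶠ r in 𝓝 t, t ∈ Ioo (r - ε) (r + ε) := by
    filter_upwards [Ioo_mem_nhds (show t - ε < t by linarith) (show t < t + ε by linarith)]
      with r hr using ⟨by linarith [hr.2], by linarith [hr.1]⟩
  -- A time `r` already reached, with reduced phase in `N` and within ε of `t`: a geodesic restarted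
  -- at `r` passes `t`.
  obtain ⟨r, ⟨J, hJ, hJc, hJI, h0J, hrJ, γ, hγ⟩, hrN, hri, hrt⟩ := (hcl.and_eventually
    ((hcont.eventually (hN.mem_nhds haN)).and (hg.mem_source.and hdist))).exists
  have heq : EqOn (fun t => M.pts.map C.toPt (γ t)) γ₀ J :=
    (hγ.map hJ h0J C.toPt).eqOn (hγ₀.mono hJI) hJ hJc h0J
  have hγi : γ r ∈ (M.chart i C).source := by
    rw [M.mem_source_iff]
    change (fun t => M.pts.map C.toPt (γ t)) r ∈ _
    rwa [heq hrJ]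
  have hph : phase i γ₀ r = Pts.map₂ C.toPt (phase i γ r) := by
    rw [← (hγ.1.map_at hJ C.toPt hrJ hγi).2]
    exact phase_congr i ((heq.eventuallyEq_of_mem (hJ.mem_nhds hrJ)).symm)
  have hrN' : (Pts.red (phase i γ r).1, Pts.red (phase i γ r).2) ∈ N := by
    rw [hph] at hrN
    change (Pts.red (Pts.map C.toPt (phase i γ r).1), Pts.red (Pts.map C.toPt (phase i γ r).2)) ∈ N
      at hrN
    rwa [Pts.red_map, Pts.red_map] at hrN
  obtain ⟨δ, hδ, hδi, hδp⟩ := h r _ hrN'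
  have hrK : r ∈ Ioo (r - ε) (r + ε) ∩ I := ⟨⟨by linarith, by linarith⟩, hJI hrJ⟩
  have hK : IsOpen (Ioo (r - ε) (r + ε) ∩ I) := isOpen_Ioo.inter hI
  have hKc : (Ioo (r - ε) (r + ε) ∩ I).OrdConnected := ordConnected_Ioo.inter hIc
  have hJK : IsOpen (J ∩ (Ioo (r - ε) (r + ε) ∩ I)) := hJ.inter hK
  have h1 : nabla.IsGeodesicOn (J ∩ (Ioo (r - ε) (r + ε) ∩ I)) γ := hγ.1.mono inter_subset_left
  have h2 : nabla.IsGeodesicOn (J ∩ (Ioo (r - ε) (r + ε) ∩ I)) δ := hδ.mono fun q hq => hq.2.1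
  have hEq : EqOn γ δ (J ∩ (Ioo (r - ε) (r + ε) ∩ I)) :=
    h1.eqOn h2 hJK (hJc.inter hKc) ⟨hrJ, hrK⟩
      (h1.eventuallyEq_of_phase_eq h2 hJK ⟨hrJ, hrK⟩ hγi (hδi r hrK.1) hδp.symm)
  -- The old and restarted geodesics agree on the overlap by uniqueness, so this gluing is locally
  -- one of the two.
  let γ' : ℝ → M.pts.obj C := fun q => if q ∈ J then γ q else δ q
  have hγ' : ∀ q ∈ J, γ =ᶠ[𝓝 q] γ' := fun q hq => by
    filter_upwards [hJ.mem_nhds hq] with x hx using (if_pos hx).symm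
  refine ⟨J ∪ (Ioo (r - ε) (r + ε) ∩ I), hJ.union hK,
    (IsPreconnected.union r hrJ hrK hJc.isPreconnected hKc.isPreconnected).ordConnected,
    union_subset hJI inter_subset_right, Or.inl h0J, Or.inr ⟨hrt, ht⟩, γ',
    hγ.of_eventuallyEq (IsGeodesicOn.of_eventuallyEq fun q hq => ?_) (Or.inl h0J) (hγ' 0 h0J)⟩
  rcases hq with hq | hq
  · exact ⟨γ, J, hq, hγ.1, hγ' q hq⟩
  · refine ⟨δ, _, hq.1, hδ, ?_⟩
    filter_upwards [hK.mem_nhds hq] with x hx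
    by_cases hxJ : x ∈ J
    · exact (hEq ⟨hxJ, hx⟩).symm.trans (if_pos hxJ).symm
    · exact (if_neg hxJ).symm

/-- A geodesic is defined on every interval on which the reduced geodesic is defined. -/
lemma exists_isGeodesicFrom_of_reduced (hI : IsOpen I) (hIc : I.OrdConnected) (h0 : (0 : ℝ) ∈ I)
    {γ₀ : ℝ → M.pts.obj (SPoint.pt s)}
    (hγ₀ : nabla.IsGeodesicFrom I p (TangentVec.map p C.toPt v) γ₀) :
    ∃ γ : ℝ → M.pts.obj C, nabla.IsGeodesicFrom I p v γ := by
  classical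
  -- The set of reachable times contains 0, is open, and is closed in `I` by
  -- `exists_geodesic_extension`; `I` is connected.
  have key : I ⊆ {t | ∃ J, IsOpen J ∧ J.OrdConnected ∧ J ⊆ I ∧ 0 ∈ J ∧ t ∈ J ∧
      ∃ γ, nabla.IsGeodesicFrom J p v γ} := by
    refine hIc.isPreconnected.subset_of_closure_inter_subset ?_ ⟨0, h0, ?_⟩ ?_
    · refine isOpen_iff_mem_nhds.2 fun t ⟨J, hJ, hJc, hJI, h0J, htJ, hγ⟩ => ?_
      filter_upwards [hJ.mem_nhds htJ] with r hr using ⟨J, hJ, hJc, hJI, h0J, hr, hγ⟩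
    · obtain ⟨T, hT, γ, hγ⟩ := exists_isGeodesicFrom nabla v
      have h0T : (0 : ℝ) ∈ Ioo (-T) T := ⟨by linarith, hT⟩
      exact ⟨Ioo (-T) T ∩ I, isOpen_Ioo.inter hI, ordConnected_Ioo.inter hIc, inter_subset_right,
        ⟨h0T, h0⟩, ⟨h0T, h0⟩, γ, hγ.mono inter_subset_left⟩
    · exact fun t ⟨htc, ht⟩ =>
        exists_geodesic_extension hI hIc hγ₀ ht (mem_closure_iff_frequently.1 htc)
  have : Nonempty (M.pts.obj C) := ⟨at_ p C⟩
  replace key : ∀ t ∈ I, ∃ J, IsOpen J ∧ J.OrdConnected ∧ J ⊆ I ∧ 0 ∈ J ∧ t ∈ J ∧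
      ∃ γ, nabla.IsGeodesicFrom J p v γ := fun t ht => key ht
  -- One geodesic is chosen for each time; near `t` the diagonal r ↦ `γ r r` equals `γ t`, by
  -- uniqueness on `J t ∩ J r`.
  choose! J hJ hJc hJI h0J hmem γ hγ using key
  have hev : ∀ t ∈ I, γ t =ᶠ[𝓝 t] fun r => γ r r := fun t ht => by
    filter_upwards [(hJ t ht).mem_nhds (hmem t ht)] with r hr
    have hrI := hJI t ht hr
    exact ((hγ t ht).mono inter_subset_left).eqOn ((hγ r hrI).mono inter_subset_right)
      ((hJ t ht).inter (hJ r hrI)) ((hJc t ht).inter (hJc r hrI)) ⟨h0J t ht, h0J r hrI⟩ ⟨hr, hmem r hrI⟩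
  exact ⟨fun r => γ r r, (hγ 0 h0).of_eventuallyEq (IsGeodesicOn.of_eventuallyEq fun t ht =>
    ⟨γ t, J t, hmem t ht, (hγ t ht).1, hev t ht⟩) h0 (hev 0 h0)⟩

end

/-! ## Smooth dependence on initial conditions -/

section

section SmoothDependence

variable {E W : Type} [NormedAddCommGroup E] [NormedSpace ℝ E] [FiniteDimensional ℝ E]
  [NormedAddCommGroup W] [NormedSpace ℝ W] {S : Set E} {F : E → E}

omit [FiniteDimensional ℝ E] in
lemma ode_unique_on [CompleteSpace E] (hS : IsOpen S) (hF : ContDiffOn ℝ ∞ F S) {J : Set ℝ}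
    (hJ : IsOpen J) (hJc : J.OrdConnected) {u w : ℝ → E}
    (hu : ∀ t ∈ J, u t ∈ S ∧ HasDerivAt u (F (u t)) t) (hw : ∀ t ∈ J, HasDerivAt w (F (w t)) t)
    {t₀ : ℝ} (ht₀ : t₀ ∈ J) (h0 : u t₀ = w t₀) : EqOn u w J := by
  have hloc : ∀ t ∈ J, u t = w t → u =ᶠ[𝓝 t] w := fun t ht h =>
    ode_unique_near hS hF ((hJ.eventually_mem ht).mono fun r hr => (hu r hr).2)
      ((hJ.eventually_mem ht).mono hw) (hu t ht).1 h
  have key : J ⊆ {t | u =ᶠ[𝓝 t] w} := by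
    refine hJc.isPreconnected.subset_of_closure_inter_subset ?_ ⟨t₀, ht₀, hloc t₀ ht₀ h0⟩ ?_
    · exact isOpen_iff_mem_nhds.2 fun t ht => eventually_eventually_nhds.2 ht
    · rintro t ⟨htc, ht⟩
      exact hloc t ht (tendsto_nhds_unique_of_frequently_eq (hu t ht).2.continuousAt.tendsto
        (hw t ht).continuousAt.tendsto ((mem_closure_iff_frequently.1 htc).mono
          fun r hr => hr.self_of_nhds))
  exact fun t ht => (key ht).self_of_nhds

/-- Linear endomorphisms commuting with the differential of a vector field commute with the
differential of its flow. -/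
lemma fderiv_flow_comm (hF : ContDiffOn ℝ ∞ F S) (hS : IsOpen S) {N : Set E} (hN : IsOpen N)
    {ε : ℝ} {Φ : E → ℝ → E} (hΦ : ∀ x ∈ N, Φ x 0 = x ∧ ∀ t ∈ Ioo (-ε) ε, Φ x t ∈ S ∧
      HasDerivAt (Φ x) (F (Φ x t)) t ∧ ContDiffAt ℝ ∞ (fun z => Φ z t) x ∧
        ∀ h, HasDerivAt (fun τ => fderiv ℝ (fun z => Φ z τ) x h)
          (fderiv ℝ F (Φ x t) (fderiv ℝ (fun z => Φ z t) x h)) t)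
    {B : E →L[ℝ] E} (hB : ∀ y ∈ S, ∀ h, fderiv ℝ F y (B h) = B (fderiv ℝ F y h))
    {x : E} (hx : x ∈ N) {t : ℝ} (ht : t ∈ Ioo (-ε) ε) (h : E) :
    fderiv ℝ (fun z => Φ z t) x (B h) = B (fderiv ℝ (fun z => Φ z t) x h) := by
  have hΦx := (hΦ x hx).2
  have h0 : fderiv ℝ (fun z => Φ z 0) x = ContinuousLinearMap.id ℝ E := by
    have he : (fun z => Φ z 0) =ᶠ[𝓝 x] id := by
      filter_upwards [hN.mem_nhds hx] with z hz using (hΦ z hz).1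
    rw [he.fderiv_eq, fderiv_id]
  -- Both sides solve the linearised equation along the flow line of `x`, and at time 0 the
  -- differential of the flow is the identity.
  refine linear_ode_unique (A := fun τ => fderiv ℝ F (Φ x τ)) (ε := ε)
    (u := fun τ => fderiv ℝ (fun z => Φ z τ) x (B h))
    (w := fun τ => B (fderiv ℝ (fun z => Φ z τ) x h)) ?_ (fun τ hτ => (hΦx τ hτ).2.2.2 _)
    (fun τ hτ => ?_) ?_ ht
  · exact (hF.continuousOn_fderiv_of_isOpen hS (by simp)).comp
      (fun τ hτ => (hΦx τ hτ).2.1.continuousAt.continuousWithinAt) fun τ hτ => (hΦx τ hτ).1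
  · have h1 := B.hasFDerivAt.comp_hasDerivAt τ ((hΦx τ hτ).2.2.2 h)
    rwa [← hB _ (hΦx τ hτ).1] at h1
  · simp only [h0, ContinuousLinearMap.id_apply]

/-- Smooth dependence of solutions of differential equations on parameters. -/
lemma contDiffAt_solution (hS : IsOpen S) (hF : ContDiffOn ℝ ∞ F S) {J : Set ℝ} (hJ : IsOpen J)
    (hJc : J.OrdConnected) {D : Set W} (hD : IsOpen D) {Ψ : ℝ → W → E}
    (hΨ : ∀ w ∈ D, ∀ t ∈ J, Ψ t w ∈ S ∧ HasDerivAt (fun r => Ψ r w) (F (Ψ t w)) t)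
    {κ : Type} (A : κ → W →L[ℝ] W) (B : κ → E →L[ℝ] E)
    (hB : ∀ a, ∀ y ∈ S, ∀ h, fderiv ℝ F y (B a h) = B a (fderiv ℝ F y h)) {t₀ : ℝ} (ht₀ : t₀ ∈ J)
    {w : W} (hw : w ∈ D) (h0 : ContDiffAt ℝ ∞ (Ψ t₀) w)
    (h0B : ∀ a h, fderiv ℝ (Ψ t₀) w (A a h) = B a (fderiv ℝ (Ψ t₀) w h)) {t : ℝ} (ht : t ∈ J) :
    ContDiffAt ℝ ∞ (Ψ t) w ∧
      ∀ a h, fderiv ℝ (Ψ t) w (A a h) = B a (fderiv ℝ (Ψ t) w h) := by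
  have : CompleteSpace E := FiniteDimensional.complete ℝ E
  let Q : ℝ → Prop := fun t => ContDiffAt ℝ ∞ (Ψ t) w ∧
      ∀ a h, fderiv ℝ (Ψ t) w (A a h) = B a (fderiv ℝ (Ψ t) w h)
  -- Smoothness and even linearity are transported between any two nearby times. The radius is
  -- independent of where they are already known, so the set of good times is both open and closed
  -- in `J`.
  have step : ∀ t ∈ J, ∃ δ > 0, ∀ t₁ ∈ Ioo (t - δ) (t + δ), ∀ t₂ ∈ Ioo (t - δ) (t + δ),
      Q t₁ → Q t₂ := by
    intro t ht
    obtain ⟨ε, hε, N, hN, hxN, Φ, hΦ⟩ := exists_local_flow hS hF (hΨ w hw t ht).1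
    have hev : ∀ᶠ r in 𝓝 t, r ∈ J ∧ Ψ r w ∈ N := (hJ.eventually_mem ht).and
      ((hΨ w hw t ht).2.continuousAt.eventually (hN.mem_nhds hxN))
    obtain ⟨δ', hδ', hball⟩ := Metric.eventually_nhds_iff_ball.1 hev
    -- Two times within δ of `t` differ by less than 2δ ≤ ε, the lifetime of the local flow.
    let δ := min δ' (ε / 2)
    have hδ : 0 < δ := lt_min hδ' (by linarith)
    have hδε : 2 * δ ≤ ε := by
      have := min_le_right δ' (ε / 2)
      change δ ≤ ε / 2 at this
      linarith
    have hsub : ∀ r ∈ Ioo (t - δ) (t + δ), r ∈ J ∧ Ψ r w ∈ N := fun r hr => by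
      refine hball r ?_
      rw [Real.ball_eq_Ioo]
      have := min_le_left δ' (ε / 2)
      change δ ≤ δ' at this
      exact ⟨by linarith [hr.1], by linarith [hr.2]⟩
    refine ⟨δ, hδ, fun t₁ ht₁ t₂ ht₂ ⟨hQ1, hQ2⟩ => ?_⟩
    have hτ : ∀ r ∈ Ioo (t - δ) (t + δ), r - t₁ ∈ Ioo (-ε) ε := fun r hr =>
      ⟨by linarith [hr.1, ht₁.2], by linarith [hr.2, ht₁.1]⟩
    -- Only continuity of `Ψ t₁` in the parameter is available here; it keeps nearby parameters in
    -- the domain of the flow, and uniqueness of integral curves gives the factorisation.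
    have he : Ψ t₂ =ᶠ[𝓝 w] (fun x => Φ x (t₂ - t₁)) ∘ Ψ t₁ := by
      filter_upwards [hQ1.continuousAt.eventually (hN.mem_nhds (hsub t₁ ht₁).2), hD.mem_nhds hw]
        with z hz hzD
      refine ode_unique_on hS hF isOpen_Ioo ordConnected_Ioo (u := fun r => Ψ r z)
        (w := fun r => Φ (Ψ t₁ z) (r - t₁)) (fun r hr => hΨ z hzD r (hsub r hr).1)
        (fun r hr => ((hΦ _ hz).2 _ (hτ r hr)).2.1.comp_sub_const r t₁) ht₁ ?_ ht₂
      simp only [sub_self, (hΦ _ hz).1]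
    have hx := (hsub t₁ ht₁).2
    have hΦd : ContDiffAt ℝ ∞ (fun x => Φ x (t₂ - t₁)) (Ψ t₁ w) :=
      ((hΦ _ hx).2 _ (hτ t₂ ht₂)).2.2.1
    have hfd : fderiv ℝ (Ψ t₂) w =
        (fderiv ℝ (fun x => Φ x (t₂ - t₁)) (Ψ t₁ w)).comp (fderiv ℝ (Ψ t₁) w) := by
      rw [he.fderiv_eq]
      exact fderiv_comp w (hΦd.differentiableAt (by simp)) (hQ1.differentiableAt (by simp))
    refine ⟨(hΦd.comp w hQ1).congr_of_eventuallyEq he, fun a h => ?_⟩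
    rw [hfd, ContinuousLinearMap.comp_apply, hQ2,
      fderiv_flow_comm hF hS hN hΦ (hB a) hx (hτ t₂ ht₂)]
    rfl
  have key : J ⊆ {t | t ∈ J ∧ Q t} := by
    refine hJc.isPreconnected.subset_of_closure_inter_subset ?_ ⟨t₀, ht₀, ht₀, h0, h0B⟩ ?_
    · refine isOpen_iff_mem_nhds.2 fun t ⟨ht, hQ⟩ => ?_
      obtain ⟨δ, hδ, h⟩ := step t ht
      filter_upwards [hJ.mem_nhds ht, Ioo_mem_nhds (sub_lt_self t hδ) (lt_add_of_pos_right t hδ)]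
        with r hrJ hr
      exact ⟨hrJ, h t ⟨sub_lt_self t hδ, lt_add_of_pos_right t hδ⟩ r hr hQ⟩
    · rintro t ⟨htc, ht⟩
      obtain ⟨δ, hδ, h⟩ := step t ht
      obtain ⟨r, ⟨-, hQ⟩, hr⟩ := ((mem_closure_iff_frequently.1 htc).and_eventually
        (Ioo_mem_nhds (sub_lt_self t hδ) (lt_add_of_pos_right t hδ))).exists
      exact ⟨ht, h r hr t ⟨sub_lt_self t hδ, lt_add_of_pos_right t hδ⟩ hQ⟩
  exact (key ht).2

end SmoothDependence

/-! ### Even linearity and homogeneity of the geodesic vector field. -/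

section SpraySolutions

variable {s m n : ℕ} {O : Set (Fin m → ℝ)}
  {Γ : ∀ C : SPoint s, Pts m n C → Pts m n C → Pts m n C → Pts m n C}

/-- The spray is quadratic in the velocity, but each term of its differential contains one
increment, linearly over even elements. This is the commutation required by `contDiffAt_solution`.
-/
lemma fderiv_spray_esmul (hO : IsOpen O) (h : IsSuperBilinearOn (redSet n O) Γ) {C : SPoint s}
    {y : Pts m n C × Pts m n C} (hy : y ∈ phaseSet n O C) (a : part 0 C.r)
    (q : Pts m n C × Pts m n C) :
    fderiv ℝ (spray Γ C) y ((Pts.esmulL a).prodMap (Pts.esmulL a) q) =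
      (Pts.esmulL a).prodMap (Pts.esmulL a) (fderiv ℝ (spray Γ C) y q) := by
  obtain ⟨D, hD, hDv⟩ := (h.isBilinOn C).hasFDerivAt_comp (isOpen_redSet hO C)
    (φ := Prod.fst) (y := y) hy hasFDerivAt_fst (hasFDerivAt_snd (𝕜 := ℝ) (p := y))
    (hasFDerivAt_snd (𝕜 := ℝ) (p := y))
  have h1 : HasFDerivAt (spray Γ C) ((ContinuousLinearMap.snd ℝ _ _).prod (-D)) y :=
    (hasFDerivAt_snd (𝕜 := ℝ) (p := y)).prodMk hD.neg
  rw [h1.fderiv]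
  refine Prod.ext rfl ?_
  change -D (Pts.esmul a q.1, Pts.esmul a q.2) = Pts.esmulL a (-D q)
  rw [map_neg, hDv, hDv]
  change -(fderiv ℝ (fun x => Γ C x y.2 y.2) y.1 (Pts.esmul a q.1) +
    Γ C y.1 (Pts.esmul a q.2) y.2 + Γ C y.1 y.2 (Pts.esmul a q.2)) = -(Pts.esmulL a _)
  rw [h.fderiv_esmul C y.1 hy, h.esmul_left C y.1 hy, h.esmul_right C y.1 hy, map_add, map_add]
  rfl

/-- Reparametrization of geodesics. -/
lemma hasDerivAt_rescale (h : IsSuperBilinearOn (redSet n O) Γ) {C : SPoint s}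
    {u : ℝ → Pts m n C × Pts m n C} {c t : ℝ} (hu : u (c * t) ∈ phaseSet n O C)
    (hd : HasDerivAt u (spray Γ C (u (c * t))) (c * t)) :
    HasDerivAt (fun r => ((u (c * r)).1, c • (u (c * r)).2))
      (spray Γ C ((u (c * t)).1, c • (u (c * t)).2)) t := by
  have hm : HasDerivAt (fun r : ℝ => c * r) c t := by
    simpa using (hasDerivAt_id t).const_mul c
  have h1 : HasDerivAt (fun r => u (c * r)) (c • spray Γ C (u (c * t))) t := hd.scomp t hm
  have h2 := ((hasFDerivAt_fst (𝕜 := ℝ) (p := u (c * t))).comp_hasDerivAt t h1).prodMk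
    (((hasFDerivAt_snd (𝕜 := ℝ) (p := u (c * t))).comp_hasDerivAt t h1).const_smul c)
  have h3 : HasDerivAt (fun r => ((u (c * r)).1, c • (u (c * r)).2)) _ t := h2
  refine h3.congr_deriv (Prod.ext rfl (Eq.symm ?_))
  change -Γ C _ (c • _) (c • _) = c • (c • -Γ C _ _ _)
  rw [h.smul_left hu, h.smul_right hu, smul_neg, smul_neg]

end SpraySolutions

end

/-! ## Morphisms given in charts and the domain of the exponential map -/

section

open Supermanifold

variable {s m n k l : ℕ}

lemma IsSupersmoothOn.comp {k' l' : ℕ} {S : ∀ C : SPoint s, Set (Pts m n C)}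
    {T : ∀ C : SPoint s, Set (Pts k l C)} {F : ∀ C : SPoint s, Pts m n C → Pts k l C}
    {G : ∀ C : SPoint s, Pts k l C → Pts k' l' C} (hG : IsSupersmoothOn T G)
    (hF : IsSupersmoothOn S F) (hS : ∀ C, IsOpen (S C)) (hT : ∀ C, IsOpen (T C)) :
    IsSupersmoothOn (fun C => S C ∩ F C ⁻¹' T C) (fun C x => G C (F C x)) ∧
      ∀ C, IsOpen (S C ∩ F C ⁻¹' T C) := by
  refine ⟨⟨fun C => (hG.smooth C).comp ((hF.smooth C).mono inter_subset_left)
    fun x hx => hx.2, fun f x hx => ?_, fun C x hx a v => ?_⟩, fun C =>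
    (hF.smooth C).continuousOn.isOpen_inter_preimage (hS C) (hT C)⟩
  · obtain ⟨h1, h2⟩ := hF.natural f x hx.1
    obtain ⟨h3, h4⟩ := hG.natural f _ hx.2
    rw [← h2] at h3 h4
    exact ⟨⟨h1, h3⟩, h4⟩
  · have h1 := ((hF.smooth C).contDiffAt ((hS C).mem_nhds hx.1)).differentiableAt
      (by simp)
    have h2 := ((hG.smooth C).contDiffAt ((hT C).mem_nhds hx.2)).differentiableAt
      (by simp)
    have h3 : fderiv ℝ (fun x => G C (F C x)) x = (fderiv ℝ (G C) (F C x)).comp (fderiv ℝ (F C) x) :=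
      fderiv_comp x h2 h1
    rw [h3]
    change fderiv ℝ (G C) (F C x) (fderiv ℝ (F C) x (Pts.esmul a v)) = _
    rw [hF.fderiv_esmul C x hx.1, hG.fderiv_esmul C _ hx.2]
    rfl

lemma IsSupersmoothOn.congr {S S' : ∀ C : SPoint s, Set (Pts m n C)}
    {F F' : ∀ C : SPoint s, Pts m n C → Pts k l C} (hF : IsSupersmoothOn S F)
    (hS : ∀ C, IsOpen (S C)) (hSS' : ∀ C, S' C = S C) (hFF' : ∀ C, EqOn (F' C) (F C) (S C)) :
    IsSupersmoothOn S' F' := by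
  obtain rfl : S' = S := funext hSS'
  refine ⟨fun C => (hF.smooth C).congr (hFF' C), fun f x hx => ?_, fun C x hx a v => ?_⟩
  · obtain ⟨h1, h2⟩ := hF.natural f x hx
    exact ⟨h1, by rw [hFF' _ h1, hFF' _ hx, h2]⟩
  · rw [((hFF' C).eventuallyEq_of_mem ((hS C).mem_nhds hx)).fderiv_eq]
    exact hF.fderiv_esmul C x hx a v

lemma IsSupersmoothOn.mono {O O' : Set (Fin m → ℝ)} {F : ∀ C : SPoint s, Pts m n C → Pts k l C}
    (hF : IsSupersmoothOn (redSet n O) F) (h : O' ⊆ O) : IsSupersmoothOn (redSet n O') F :=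
  ⟨fun C => (hF.smooth C).mono fun _ hx => h hx,
    fun f x hx => ⟨map_mem_redSet f hx, (hF.natural f x (h hx)).2⟩,
    fun C x hx => hF.fderiv_esmul C x (h hx)⟩

lemma Supermanifold.map_chart_symm (M : Supermanifold.{u} s m n) (i : M.ι) {C D : SPoint s}
    (f : C ⟶ D) {x : Pts m n C} (hx : x ∈ (M.chart i C).target) :
    M.pts.map f ((M.chart i C).symm x) = (M.chart i D).symm (Pts.map f x) := by
  obtain ⟨h1, h2⟩ := M.chart_natural i f _ ((M.chart i C).map_target hx)
  rw [(M.chart i C).right_inv hx] at h2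
  rw [← h2, (M.chart i D).left_inv h1]

/-- A map of open subfunctors given by a supersmooth map in one pair of charts is a morphism of
supermanifolds. -/
lemma isMorphismOn_of_chart {M : Supermanifold.{u} s m n} {N : Supermanifold.{u} s k l}
    (i : M.ι) (j : N.ι) {O : Set (Fin m → ℝ)} (hO : IsOpen O)
    {F : ∀ C : SPoint s, Pts m n C → Pts k l C} (hF : IsSupersmoothOn (redSet n O) F)
    (hFj : ∀ C, ∀ x ∈ redSet n O C, F C x ∈ (N.chart j C).target)
    {Φ : ∀ C, M.pts.obj C → N.pts.obj C}
    (hΦ : ∀ C, ∀ q ∈ M.chartSet i O C, Φ C q = (N.chart j C).symm (F C (M.chart i C q))) :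
    IsMorphismOn (M.chartSet i O (SPoint.pt s)) Φ := by
  -- In another pair of charts the map is `F` between two coordinate changes; its domain is the
  -- natural domain of that composite.
  have hset : ∀ i' j' C, {x ∈ M.target i' C |
      (M.chart i' C).symm x ∈ M.restrict (M.chartSet i O (SPoint.pt s)) C ∧
        Φ C ((M.chart i' C).symm x) ∈ (N.chart j' C).source} =
      (M.overlap i' i C ∩ M.trans i' i C ⁻¹' redSet n O C) ∩
        (fun x => F C (M.trans i' i C x)) ⁻¹' N.overlap j j' C := by
    intro i' j' C
    rw [M.restrict_chartSet]
    ext x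
    constructor
    · rintro ⟨hx, hxO, hxj⟩
      rw [hΦ C _ hxO] at hxj
      exact ⟨⟨⟨hx, hxO.1⟩, hxO.2⟩, ⟨hFj C _ hxO.2, hxj⟩⟩
    · rintro ⟨⟨⟨hx, hxi⟩, hxO⟩, -, hxj⟩
      have hxO' : (M.chart i' C).symm x ∈ M.chartSet i O C := ⟨hxi, hxO⟩
      refine ⟨hx, hxO', ?_⟩
      rw [hΦ C _ hxO']
      exact hxj
  have hcomp : ∀ i' j', _ := fun i' j' =>
    (N.transition j j').comp (hF.comp (M.transition i' i) (M.isOpen_overlap i' i)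
      (isOpen_redSet hO)).1 (hF.comp (M.transition i' i) (M.isOpen_overlap i' i)
      (isOpen_redSet hO)).2 (N.isOpen_overlap j j')
  refine ⟨fun {C D} f q hq => ?_, fun i' j' C => ?_, fun i' j' => ?_⟩
  · rw [M.restrict_chartSet] at hq
    obtain ⟨h1, h2⟩ := M.chart_natural i f q hq.1
    have hq' : M.pts.map f q ∈ M.chartSet i O D := by
      refine ⟨h1, ?_⟩
      rw [h2, Pts.red_map]
      exact hq.2
    rw [hΦ C q hq, hΦ D _ hq', N.map_chart_symm j f (hFj C _ hq.2), h2, (hF.natural f _ hq.2).2]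
  · rw [hset]
    exact (hcomp i' j').2 C
  · refine (hcomp i' j').1.congr (hcomp i' j').2 (hset i' j') fun C x hx => ?_
    have hxO' : (M.chart i' C).symm x ∈ M.chartSet i O C := ⟨hx.1.1.2, hx.1.2⟩
    change N.chart j' C (Φ C _) = _
    rw [hΦ C _ hxO']
    rfl

section Exp

variable {M : Supermanifold.{u} s m n} (nabla : Connection M) {p : M.pts.obj (SPoint.base s)}

/-- The geodesic with a given initial velocity on the interval `(-2, 2)`. -/
def expCurve {C : SPoint s} (v : TangentVec p C) : ℝ → M.pts.obj C :=
  @Classical.epsilon _ ⟨fun _ => at_ p C⟩ fun γ => nabla.IsGeodesicFrom (Ioo (-2) 2) p v γ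

/-- Over reduced velocities in `O` the geodesics exist on `(-2, 2)` and stay in the chart `i`. -/
def IsExpDomain (i : ChartsAt p) (O : Set (Fin m → ℝ)) : Prop :=
  ∀ (C : SPoint s) (v : TangentVec p C), Pts.red (v.coord i) ∈ O →
    nabla.IsGeodesicFrom (Ioo (-2) 2) p v (expCurve nabla v) ∧
      ∀ t ∈ Ioo (-2 : ℝ) 2, expCurve nabla v t ∈ (M.chart i.1 C).source

lemma red_chart_at_mem (i : ChartsAt p) (C : SPoint s) :
    Pts.red (M.chart i.1 C (at_ p C)) ∈ M.dom i.1 := by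
  have h := (M.chart i.1 C).map_source (at_mem p i C)
  rwa [M.chart_target] at h

/-- Near zero velocity geodesics live on a common (-ε, ε). Running the one with velocity (2 / ε)w at
speed ε / 2 gives velocity w and lifetime (-2, 2), an interval that contains [-1, 1] in its
interior. -/
lemma exists_reduced_geodesic (i : ChartsAt p) : ∃ O : Set (Fin m → ℝ), IsOpen O ∧ 0 ∈ O ∧
    ∀ v : TangentVec p (SPoint.pt s), Pts.red (v.coord i) ∈ O →
      ∃ γ, nabla.IsGeodesicFrom (Ioo (-2) 2) p v γ ∧
        ∀ t ∈ Ioo (-2 : ℝ) 2, γ t ∈ (M.chart i.1 (SPoint.pt s)).source := by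
  obtain ⟨ε, hε, N, hN, haN, h⟩ := exists_solution_near (M.isOpen_dom i.1)
    (nabla.isSuperBilinearOn i.1) (SPoint.pt s) (red_chart_at_mem i (SPoint.pt s)) 0
  refine ⟨{w | (Pts.red (M.chart i.1 (SPoint.pt s) (at_ p (SPoint.pt s))), (2 / ε) • w) ∈ N},
    hN.preimage (by fun_prop), by simpa using haN, fun v hv => ?_⟩
  have hred : Pts.red ((2 / ε) • v.coord i) = (2 / ε) • Pts.red (v.coord i) :=
    map_smul (Pts.redL _) _ _
  change (_, _) ∈ N at hv
  rw [← hred] at hv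
  obtain ⟨u, hu0, hu⟩ := h (_, _) hv
  have hmem : ∀ t ∈ Ioo (-2 : ℝ) 2, ε / 2 * t ∈ Ioo (-ε) ε := fun t ht =>
    ⟨by nlinarith [ht.1], by nlinarith [ht.2]⟩
  have key : ∀ t ∈ Ioo (-2 : ℝ) 2, _ := fun t ht =>
    isGeodesicAt_of_solution (nabla := nabla) (i := i.1) isOpen_Ioo
      (u := fun r => ((u (ε / 2 * r)).1, (ε / 2) • (u (ε / 2 * r)).2))
      (γ := fun r => (M.chart i.1 (SPoint.pt s)).symm (u (ε / 2 * r)).1)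
      (fun r hr => ⟨(hu _ (hmem r hr)).1, hasDerivAt_rescale (nabla.isSuperBilinearOn i.1)
        (hu _ (hmem r hr)).1 (hu _ (hmem r hr)).2⟩) (fun r hr => rfl) ht
  have h0 : (0 : ℝ) ∈ Ioo (-2 : ℝ) 2 := by norm_num
  refine ⟨_, Connection.IsGeodesicFrom.of_phase
    (isGeodesicOn_of_at fun t ht => ⟨i.1, (key t ht).1⟩) h0 i
    (key 0 h0).1.mem_source.self_of_nhds ?_,
    fun t ht => (key t ht).1.mem_source.self_of_nhds⟩
  rw [(key 0 h0).2, mul_zero, hu0, smul_smul, div_mul_div_comm, mul_comm ε 2, div_self (by positivity),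
    one_smul]

/-- Both the interval of existence and membership in a chart domain are reduced conditions, so the
reduced case decides for all superpoints. -/
lemma exists_isExpDomain [T2Space (M.pts.obj (SPoint.pt s))] (i : ChartsAt p) :
    ∃ O : Set (Fin m → ℝ), IsOpen O ∧ 0 ∈ O ∧ IsExpDomain nabla i O := by
  obtain ⟨O, hO, h0O, h⟩ := exists_reduced_geodesic nabla i
  refine ⟨O, hO, h0O, fun C v hv => ?_⟩
  have h0 : (0 : ℝ) ∈ Ioo (-2 : ℝ) 2 := by norm_num
  have hv' : Pts.red ((TangentVec.map p C.toPt v).coord i) ∈ O := by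
    change Pts.red (Pts.map C.toPt (v.coord i)) ∈ O
    rwa [Pts.red_map]
  obtain ⟨γ₀, hγ₀, hi⟩ := h _ hv'
  have hex := exists_isGeodesicFrom_of_reduced isOpen_Ioo ordConnected_Ioo h0 hγ₀
  have hg : nabla.IsGeodesicFrom (Ioo (-2) 2) p v (expCurve nabla v) :=
    Classical.epsilon_spec_aux _ _ hex
  refine ⟨hg, fun t ht => ?_⟩
  rw [M.mem_source_iff]
  change (fun t => M.pts.map C.toPt (expCurve nabla v t)) t ∈ _
  rw [(hg.map isOpen_Ioo h0 C.toPt).eqOn hγ₀ isOpen_Ioo ordConnected_Ioo h0 ht]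
  exact hi t ht

end Exp

end

/-! ## The exponential map in coordinates -/

section

open Supermanifold

section ExpCoord

variable {s m n : ℕ} {M : Supermanifold.{u} s m n} (nabla : Connection M)
  {p : M.pts.obj (SPoint.base s)} (i : ChartsAt p)

/-- Position and velocity at time `t` of the geodesic with a given initial velocity. -/
def expPhase (C : SPoint s) (t : ℝ) (w : Pts m n C) : Pts m n C × Pts m n C :=
  phase i.1 (expCurve nabla (TangentVec.ofCoord p i w)) t

/-- The exponential map in the chart `i`. -/
def expCoord (C : SPoint s) (w : Pts m n C) : Pts m n C := (expPhase nabla i C 1 w).1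

lemma zero_mem_redSet {O : Set (Fin m → ℝ)} (h : 0 ∈ O) (C : SPoint s) :
    (0 : Pts m n C) ∈ redSet n O C := by
  have h0 : Pts.red (0 : Pts m n C) = 0 := map_zero (Pts.redL (n := n) C)
  change Pts.red (0 : Pts m n C) ∈ O
  rwa [h0]

lemma coord_ofCoord {C : SPoint s} (w : Pts m n C) : (TangentVec.ofCoord p i w).coord i = w :=
  tangentTrans_self p i C w

lemma map_ofCoord {C D : SPoint s} (f : C ⟶ D) (w : Pts m n C) :
    TangentVec.map p f (TangentVec.ofCoord p i w) = TangentVec.ofCoord p i (Pts.map f w) :=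
  TangentVec.ext (funext fun j => (tangentTrans_map p i j f w).symm)

variable {nabla i} {O : Set (Fin m → ℝ)} (h : IsExpDomain nabla i O) {C : SPoint s} {w : Pts m n C}
  (hw : w ∈ redSet n O C)
include h hw

lemma IsExpDomain.ofCoord :
    nabla.IsGeodesicFrom (Ioo (-2) 2) p (TangentVec.ofCoord p i w)
      (expCurve nabla (TangentVec.ofCoord p i w)) ∧
      ∀ t ∈ Ioo (-2 : ℝ) 2, expCurve nabla (TangentVec.ofCoord p i w) t ∈ (M.chart i.1 C).source :=
  h C _ (by rwa [coord_ofCoord])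

lemma expPhase_zero : expPhase nabla i C 0 w = (M.chart i.1 C (at_ p C), w) := by
  rw [expPhase, (h.ofCoord hw).1.phase_zero i, coord_ofCoord]

lemma expPhase_solution {t : ℝ} (ht : t ∈ Ioo (-2 : ℝ) 2) :
    expPhase nabla i C t w ∈ phaseSet n (M.dom i.1) C ∧
      HasDerivAt (fun r => expPhase nabla i C r w)
        (spray (nabla.Γ i.1) C (expPhase nabla i C t w)) t :=
  have hg := (h.ofCoord hw).1.1.at_ ht ((h.ofCoord hw).2 t ht)
  ⟨hg.phase_mem, hg.hasDerivAt_phase⟩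

lemma expCoord_natural [T2Space (M.pts.obj (SPoint.pt s))] {D : SPoint s} (f : C ⟶ D) :
    expCoord nabla i D (Pts.map f w) = Pts.map f (expCoord nabla i C w) := by
  have h0 : (0 : ℝ) ∈ Ioo (-2 : ℝ) 2 := by norm_num
  have h1 : (1 : ℝ) ∈ Ioo (-2 : ℝ) 2 := by norm_num
  have hm := (h.ofCoord hw).1.map isOpen_Ioo h0 f
  rw [map_ofCoord] at hm
  have he := (h.ofCoord (map_mem_redSet f hw)).1.eqOn hm isOpen_Ioo ordConnected_Ioo h0 h1
  change M.chart i.1 D _ = Pts.map f (M.chart i.1 C _)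
  rw [he, (M.chart_natural i.1 f _ ((h.ofCoord hw).2 1 h1)).2]

omit hw

variable (hO : IsOpen O)
include hO

/-- At time 0 the phase is (p, w), affine in w with even linear differential. `contDiffAt_solution`
carries both properties to time t. -/
lemma contDiffAt_expPhase (hw : w ∈ redSet n O C) {t : ℝ} (ht : t ∈ Ioo (-2 : ℝ) 2) :
    ContDiffAt ℝ ∞ (expPhase nabla i C t) w ∧ ∀ (a : part 0 C.r) (v : Pts m n C),
      fderiv ℝ (expPhase nabla i C t) w (Pts.esmulL a v) =
        (Pts.esmulL a).prodMap (Pts.esmulL a) (fderiv ℝ (expPhase nabla i C t) w v) := by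
  have h0 : (0 : ℝ) ∈ Ioo (-2 : ℝ) 2 := by norm_num
  have he : expPhase nabla i C 0 =ᶠ[𝓝 w] fun w => (M.chart i.1 C (at_ p C), w) := by
    filter_upwards [(isOpen_redSet hO C).mem_nhds hw] with z hz using expPhase_zero h hz
  refine contDiffAt_solution (isOpen_phaseSet (M.isOpen_dom i.1) C)
    (contDiffOn_spray (nabla.isSuperBilinearOn i.1) C) isOpen_Ioo ordConnected_Ioo
    (isOpen_redSet hO C) (fun w hw t ht => expPhase_solution h hw ht) Pts.esmulL
    (fun a : part 0 C.r => (Pts.esmulL a).prodMap (Pts.esmulL a))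
    (fun a y hy q => fderiv_spray_esmul (M.isOpen_dom i.1) (nabla.isSuperBilinearOn i.1) hy a q)
    h0 hw ?_ (fun a q => ?_) ht
  · exact (contDiffAt_const.prodMk contDiffAt_id).congr_of_eventuallyEq he
  · have hd : HasFDerivAt (fun w => (M.chart i.1 C (at_ p C), w))
        ((0 : Pts m n C →L[ℝ] Pts m n C).prod (ContinuousLinearMap.id ℝ _)) w :=
      (hasFDerivAt_const _ _).prodMk (hasFDerivAt_id w)
    rw [he.fderiv_eq, hd.fderiv]
    exact Prod.ext (map_zero (Pts.esmulL a)).symm rfl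

lemma isSupersmoothOn_expCoord [T2Space (M.pts.obj (SPoint.pt s))] :
    IsSupersmoothOn (redSet n O) (expCoord nabla i) := by
  have h1 : (1 : ℝ) ∈ Ioo (-2 : ℝ) 2 := by norm_num
  refine ⟨fun C w hw => ?_, fun f w hw => ⟨map_mem_redSet f hw, expCoord_natural h hw f⟩,
    fun C w hw a v => ?_⟩
  · exact (contDiffAt_fst.comp w (contDiffAt_expPhase h hO hw h1).1).contDiffWithinAt
  · obtain ⟨h2, h3⟩ := contDiffAt_expPhase h hO hw h1
    have hd : HasFDerivAt (expCoord nabla i C)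
        ((ContinuousLinearMap.fst ℝ _ _).comp (fderiv ℝ (expPhase nabla i C 1) w)) w :=
      hasFDerivAt_fst.comp w (h2.differentiableAt (by simp)).hasFDerivAt
    rw [hd.fderiv]
    exact congrArg Prod.fst (h3 a v)

-- Homogeneity of the spray: w's geodesic run at speed c has initial velocity c • w, so uniqueness
-- applies. The bound on |c| keeps c * t inside (-2, 2).
omit hO in
lemma expCoord_smul (hw : w ∈ redSet n O C) {c : ℝ} (hc : |c| ≤ 1)
    (hcw : c • w ∈ redSet n O C) : expCoord nabla i C (c • w) = (expPhase nabla i C c w).1 := by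
  have h0 : (0 : ℝ) ∈ Ioo (-2 : ℝ) 2 := by norm_num
  have h1 : (1 : ℝ) ∈ Ioo (-2 : ℝ) 2 := by norm_num
  have hm : ∀ t ∈ Ioo (-2 : ℝ) 2, c * t ∈ Ioo (-2 : ℝ) 2 := fun t ht => by
    have ht' : |t| < 2 := abs_lt.2 ht
    refine abs_lt.1 ?_
    rw [abs_mul]
    nlinarith [abs_nonneg t, abs_nonneg c]
  have he := ode_unique_on (isOpen_phaseSet (M.isOpen_dom i.1) C)
    (contDiffOn_spray (nabla.isSuperBilinearOn i.1) C) isOpen_Ioo ordConnected_Ioo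
    (fun t ht => expPhase_solution h hcw ht)
    (fun t ht => hasDerivAt_rescale (nabla.isSuperBilinearOn i.1)
      (u := fun r => expPhase nabla i C r w)
      (expPhase_solution h hw (hm t ht)).1 (expPhase_solution h hw (hm t ht)).2) h0
    (by
      rw [mul_zero, expPhase_zero h hw, expPhase_zero h hcw]) h1
  have h2 : expPhase nabla i C 1 (c • w) =
    ((expPhase nabla i C (c * 1) w).1, c • (expPhase nabla i C (c * 1) w).2) := he
  rw [expCoord, h2, mul_one]

omit hO in
lemma expCoord_zero (h0O : 0 ∈ O) : expCoord nabla i C 0 = M.chart i.1 C (at_ p C) := by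
  have h1 := zero_mem_redSet (n := n) h0O C
  have h2 := expCoord_smul h h1 (c := 0) (by simp) (by rwa [zero_smul])
  rwa [zero_smul, expPhase_zero h h1] at h2

/-- The differential of the exponential map at `0` is the identity. -/
lemma fderiv_expCoord_zero (h0O : 0 ∈ O) :
    fderiv ℝ (expCoord nabla i C) 0 = ContinuousLinearMap.id ℝ (Pts m n C) := by
  have h00 : (0 : ℝ) ∈ Ioo (-2 : ℝ) 2 := by norm_num
  have h0 : (0 : Pts m n C) ∈ redSet n O C := zero_mem_redSet h0O C
  have hdF : DifferentiableAt ℝ (expCoord nabla i C) 0 :=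
    differentiableAt_fst.comp _
      ((contDiffAt_expPhase h hO h0 (t := 1) (by norm_num)).1.differentiableAt (by simp))
  have hsm : ∀ w : Pts m n C, ∀ᶠ c in 𝓝 (0 : ℝ), c • w ∈ redSet n O C := fun w => by
    have hc : ContinuousAt (fun c : ℝ => c • w) 0 := by fun_prop
    refine hc.eventually ((isOpen_redSet hO C).mem_nhds ?_)
    change (0 : ℝ) • w ∈ _
    rwa [zero_smul]
  -- By `expCoord_smul` the curve c ↦ exp(c • w) is near c = 0 the geodesic of w, whose velocity at
  -- 0 is w.
  have key : ∀ w ∈ redSet n O C, fderiv ℝ (expCoord nabla i C) 0 w = w := by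
    intro w hw
    have h1 : HasDerivAt (fun c : ℝ => c • w) w 0 := by
      simpa using (hasDerivAt_id (0 : ℝ)).smul_const w
    have hdF' : HasFDerivAt (expCoord nabla i C) (fderiv ℝ (expCoord nabla i C) 0)
        ((0 : ℝ) • w) := by
      rw [zero_smul]
      exact hdF.hasFDerivAt
    have h2 := hdF'.comp_hasDerivAt 0 h1
    have h3 : HasDerivAt (fun c => (expPhase nabla i C c w).1)
        (spray (nabla.Γ i.1) C (expPhase nabla i C 0 w)).1 0 :=
      (hasFDerivAt_fst (𝕜 := ℝ) (p := expPhase nabla i C 0 w)).comp_hasDerivAt 0 (expPhase_solution h hw h00).2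
    have he : (expCoord nabla i C ∘ fun c : ℝ => c • w) =ᶠ[𝓝 0]
        fun c => (expPhase nabla i C c w).1 := by
      filter_upwards [hsm w, Metric.closedBall_mem_nhds (0 : ℝ) one_pos] with c hc hc1
      exact expCoord_smul h hw (by simpa using hc1) hc
    rw [h2.unique (h3.congr_of_eventuallyEq he), expPhase_zero h hw]
    rfl
  refine ContinuousLinearMap.ext fun w => ?_
  -- An arbitrary vector is scaled into the domain by some c ≠ 0, which linearity of the
  -- differential cancels.
  obtain ⟨c, hc, hc0⟩ := (((hsm w).filter_mono nhdsWithin_le_nhds).and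
    (self_mem_nhdsWithin : {0}ᶜ ∈ 𝓝[≠] (0 : ℝ))).exists
  have h1 := key _ hc
  rw [map_smul] at h1
  exact smul_right_injective _ hc0 h1

end ExpCoord

lemma eventually_surjective {X E : Type*} [TopologicalSpace X] [NormedAddCommGroup E]
    [NormedSpace ℝ E] [CompleteSpace E] {A : X → E →L[ℝ] E} {x : X} (hA : ContinuousAt A x)
    (hx : A x = ContinuousLinearMap.id ℝ E) : ∀ᶠ y in 𝓝 x, Function.Surjective (A y) := by
  have hev : ∀ᶠ y in 𝓝 x, A y ∈ range ((↑) : (E ≃L[ℝ] E) → E →L[ℝ] E) :=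
    hA.eventually ((ContinuousLinearEquiv.isOpen (𝕜 := ℝ)).mem_nhds (by
      rw [hx]
      exact ⟨ContinuousLinearEquiv.refl ℝ _, rfl⟩))
  filter_upwards [hev] with y ⟨e, he⟩
  rw [← he]
  exact e.surjective

section ExpInverse

variable {s m n : ℕ} {M : Supermanifold.{u} s m n} [T2Space (M.pts.obj (SPoint.pt s))]
  {nabla : Connection M} {p : M.pts.obj (SPoint.base s)} {i : ChartsAt p} {O : Set (Fin m → ℝ)}

/-- The exponential map is invertible near `0`. -/
lemma exists_expCoord_inverse (h : IsExpDomain nabla i O) (hO : IsOpen O) (h0O : 0 ∈ O) :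
    ∃ O₁ ⊆ O, IsOpen O₁ ∧ 0 ∈ O₁ ∧ ∃ O' : Set (Fin m → ℝ), IsOpen O' ∧
      ∃ G : ∀ C : SPoint s, Pts m n C → Pts m n C, IsSupersmoothOn (redSet n O') G ∧
        ∀ C, MapsTo (expCoord nabla i C) (redSet n O₁ C) (redSet n O' C) ∧
          MapsTo (G C) (redSet n O' C) (redSet n O₁ C) ∧
          InvOn (G C) (expCoord nabla i C) (redSet n O₁ C) (redSet n O' C) := by
  have hF := isSupersmoothOn_expCoord h hO
  have hreal : ∀ C : SPoint s, (Pts.real C 0 : Pts m n C) = 0 := fun C => by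
    apply Pts.ext_coord <;> intro i
    · exact map_zero (algebraMap ℝ (Grassmann C.r))
    · rfl
  have h0 : ∀ C : SPoint s, (0 : Pts m n C) ∈ redSet n O C := zero_mem_redSet h0O
  obtain ⟨e, he0, hef, -⟩ := exists_openPartialHomeomorph
    ((hF.smooth (SPoint.pt s)).contDiffAt ((isOpen_redSet hO _).mem_nhds (h0 _)))
    (by rw [fderiv_expCoord_zero h hO h0O]; exact Function.bijective_id)
  have hinv : ∀ᶠ x in 𝓝 (0 : Fin m → ℝ), Function.Surjective
      (fderiv ℝ (expCoord nabla i (SPoint.triv s 1)) (Pts.real _ x)) := by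
    have hc : ContinuousAt (fun x : Fin m → ℝ =>
        fderiv ℝ (expCoord nabla i (SPoint.triv s 1)) (Pts.real _ x)) 0 := by
      refine ContinuousAt.comp (f := fun x : Fin m → ℝ => (Pts.real _ x : Pts m n _)) ?_
        (Pts.continuous_real _).continuousAt
      refine ((hF.smooth _).continuousOn_fderiv_of_isOpen (isOpen_redSet hO _)
        (by simp)).continuousAt ((isOpen_redSet hO _).mem_nhds ?_)
      rw [hreal]
      exact h0 _
    refine eventually_surjective hc ?_
    rw [hreal, fderiv_expCoord_zero h hO h0O]
  have hsrc : ∀ᶠ x in 𝓝 (0 : Fin m → ℝ), (Pts.real (SPoint.pt s) x : Pts m n _) ∈ e.source :=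
    (Pts.continuous_real _).continuousAt.eventually
      (e.open_source.mem_nhds (by rw [hreal]; exact he0))
  -- Both hypotheses of the inverse function theorem are open near 0: the source of a local inverse
  -- gives injectivity on reduced points, and surjectivity of the differential over ℝ^{0|1} persists
  -- from the identity.
  obtain ⟨O₁, hO₁, hO₁o, h0O₁⟩ := mem_nhds_iff.1 ((hO.eventually_mem h0O).and (hinv.and hsrc))
  have hsub : O₁ ⊆ O := fun x hx => (hO₁ hx).1
  refine ⟨O₁, hsub, hO₁o, h0O₁, (hF.mono hsub).exists_inverse hO₁o ?_ fun x hx => (hO₁ hx).2.1⟩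
  have hmem : ∀ x ∈ redSet n O₁ (SPoint.pt s), x ∈ e.source := fun x hx => by
    have h1 := (hO₁ hx).2.2
    rwa [Pts.red_pt_injective (Pts.red_real (n := n) (SPoint.pt s) (Pts.red x))] at h1
  rw [← hef]
  exact e.injOn.mono hmem

end ExpInverse

end

/-! ## The exponential map -/

section

open Supermanifold

section ExpMap

variable {s m n : ℕ} {M : Supermanifold.{u} s m n}

/-- The exponential map at `p`. -/
def expMap (nabla : Connection M) (p : M.pts.obj (SPoint.base s)) (C : SPoint s)
    (v : (tangentAt p).pts.obj C) : M.pts.obj C := expCurve nabla (C := C) (p := p) v 1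

variable {nabla : Connection M} {p : M.pts.obj (SPoint.base s)} {i : ChartsAt p}
  {O : Set (Fin m → ℝ)}

lemma zero_mem_chartSet (h : 0 ∈ O) : (0 : TangentVec p (SPoint.pt s)) ∈
    (tangentAt p).chartSet i O (SPoint.pt s) := ⟨trivial, zero_mem_redSet (n := n) h (SPoint.pt s)⟩

lemma ofCoord_coord {C : SPoint s} (v : TangentVec p C) :
    TangentVec.ofCoord p i (v.coord i) = v :=
  (TangentVec.chart p i C).left_inv (x := v) trivial

lemma IsExpDomain.expCoord_mem_target (h : IsExpDomain nabla i O) {C : SPoint s} {x : Pts m n C}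
    (hx : x ∈ redSet n O C) : expCoord nabla i C x ∈ (M.chart i.1 C).target :=
  (M.chart i.1 C).map_source ((h.ofCoord hx).2 1 (by norm_num))

lemma IsExpDomain.expMap_eq (h : IsExpDomain nabla i O) {C : SPoint s}
    {v : (tangentAt p).pts.obj C} (hv : v ∈ (tangentAt p).chartSet i O C) :
    expMap nabla p C v =
      (M.chart i.1 C).symm (expCoord nabla i C ((tangentAt p).chart i C v)) := by
  have h2 : TangentVec.ofCoord p i (TangentVec.coord v i) = v := ofCoord_coord v
  have h3 := (h C v hv.2).2 1 (by norm_num)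
  change expCurve nabla (C := C) v 1 = (M.chart i.1 C).symm (M.chart i.1 C
    (expCurve nabla (TangentVec.ofCoord p i (TangentVec.coord v i)) 1))
  rw [h2, (M.chart i.1 C).left_inv h3]

lemma IsExpDomain.mono (h : IsExpDomain nabla i O) {O₁ : Set (Fin m → ℝ)} (h₁ : O₁ ⊆ O) :
    IsExpDomain nabla i O₁ := fun C v hv => h C v (h₁ hv)

lemma restrict_tangentAt_chartSet (i : ChartsAt p) (O : Set (Fin m → ℝ)) (C : SPoint s) :
    (tangentAt p).restrict ((tangentAt p).chartSet i O (SPoint.pt s)) C =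
      (tangentAt p).chartSet i O C := (tangentAt p).restrict_chartSet i O C

variable [T2Space (M.pts.obj (SPoint.pt s))]

lemma IsExpDomain.isMorphismOn (h : IsExpDomain nabla i O) (hO : IsOpen O) :
    IsMorphismOn ((tangentAt p).chartSet i O (SPoint.pt s)) (expMap nabla p) :=
  isMorphismOn_of_chart (M := tangentAt p) i i.1 hO (isSupersmoothOn_expCoord h hO)
    (fun _ _ hx => h.expCoord_mem_target hx) fun _ _ hv => h.expMap_eq hv

lemma IsExpDomain.isIsomorphismOn (h : IsExpDomain nabla i O) (hO : IsOpen O)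
    {O' : Set (Fin m → ℝ)} (hO' : IsOpen O') {G : ∀ C : SPoint s, Pts m n C → Pts m n C}
    (hG : IsSupersmoothOn (redSet n O') G)
    (hFG : ∀ C, MapsTo (expCoord nabla i C) (redSet n O C) (redSet n O' C) ∧
      MapsTo (G C) (redSet n O' C) (redSet n O C) ∧
        InvOn (G C) (expCoord nabla i C) (redSet n O C) (redSet n O' C)) :
    IsIsomorphismOn ((tangentAt p).chartSet i O (SPoint.pt s))
      (M.chartSet i.1 O' (SPoint.pt s)) (expMap nabla p) := by
  let Ψ : ∀ C, M.pts.obj C → (tangentAt p).pts.obj C :=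
    fun C q => TangentVec.ofCoord p i (G C (M.chart i.1 C q))
  have hΨ : ∀ C q, (tangentAt p).chart i C (Ψ C q) = G C (M.chart i.1 C q) :=
    fun C q => coord_ofCoord i _
  refine ⟨h.isMorphismOn hO, Ψ, isMorphismOn_of_chart (N := tangentAt p) i.1 i hO' hG
    (fun C x _ => trivial) fun C q _ => rfl, fun C => ?_⟩
  rw [restrict_tangentAt_chartSet, restrict_chartSet]
  obtain ⟨h2, h3, h4⟩ := hFG C
  have hmaps : ∀ v ∈ (tangentAt p).chartSet i O C,
      expMap nabla p C v ∈ (M.chart i.1 C).source ∧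
      M.chart i.1 C (expMap nabla p C v) =
        expCoord nabla i C ((tangentAt p).chart i C v) := fun v hv => by
    have h5 := h.expCoord_mem_target hv.2
    rw [h.expMap_eq hv]
    exact ⟨(M.chart i.1 C).map_target h5, (M.chart i.1 C).right_inv h5⟩
  have hΨm : MapsTo (Ψ C) (M.chartSet i.1 O' C) ((tangentAt p).chartSet i O C) := fun q hq =>
    ⟨trivial, by rw [hΨ]; exact h3 hq.2⟩
  refine ⟨fun v hv => ⟨(hmaps v hv).1, ?_⟩, hΨm, fun v hv => ?_, fun q hq => ?_⟩
  · rw [(hmaps v hv).2]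
    exact h2 hv.2
  · change TangentVec.ofCoord p i (G C (M.chart i.1 C (expMap nabla p C v))) = v
    rw [(hmaps v hv).2, h4.1 hv.2]
    exact ofCoord_coord (p := p) (C := C) v
  · rw [h.expMap_eq (hΨm hq), hΨ, h4.2 hq.2, (M.chart i.1 C).left_inv hq.1]

-- A single chart around `p` suffices: all open subfunctors are cut out by reduced coordinates in
-- it. The common lifetime T = 2 comes from `IsExpDomain`.
variable (nabla p) in
theorem exists_exponentialMap :
    ∃ (U : Set ((Supermanifold.tangentAt p).pts.obj (SPoint.pt s)))
      (exp : ∀ C, (Supermanifold.tangentAt p).pts.obj C → M.pts.obj C),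
      IsOpen U ∧ (0 : Supermanifold.TangentVec p (SPoint.pt s)) ∈ U ∧
      (∀ C, ∀ v ∈ (Supermanifold.tangentAt p).restrict U C,
        ∃ T > (1 : ℝ), ∃ γ : ℝ → M.pts.obj C,
          nabla.IsGeodesicFrom (Set.Ioo (-T) T) p v γ ∧ γ 1 = exp C v) ∧
      Supermanifold.IsMorphismOn U exp ∧
      ∃ U' ⊆ U, IsOpen U' ∧ (0 : Supermanifold.TangentVec p (SPoint.pt s)) ∈ U' ∧
        ∃ W : Set (M.pts.obj (SPoint.pt s)), IsOpen W ∧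
          Supermanifold.at_ p (SPoint.pt s) ∈ W ∧
          Supermanifold.IsIsomorphismOn U' W exp := by
  obtain ⟨i⟩ := nonempty_chartsAt p
  obtain ⟨O, hO, h0O, h⟩ := exists_isExpDomain nabla i
  obtain ⟨O₁, hsub, hO₁, h0O₁, O', hO', G, hG, hFG⟩ := exists_expCoord_inverse h hO h0O
  refine ⟨(tangentAt p).chartSet i O (SPoint.pt s), expMap nabla p,
    (tangentAt p).isOpen_chartSet i hO _, zero_mem_chartSet h0O, fun C v hv => ?_,
    h.isMorphismOn hO, (tangentAt p).chartSet i O₁ (SPoint.pt s),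
    fun v hv => ⟨hv.1, hsub hv.2⟩, (tangentAt p).isOpen_chartSet i hO₁ _,
    zero_mem_chartSet h0O₁, M.chartSet i.1 O' (SPoint.pt s), M.isOpen_chartSet i.1 hO' _,
    ⟨at_mem p i _, ?_⟩, (h.mono hsub).isIsomorphismOn hO₁ hO' hG hFG⟩
  · rw [restrict_tangentAt_chartSet] at hv
    exact ⟨2, by norm_num, expCurve nabla (C := C) v, (h C v hv.2).1, rfl⟩
  · have h2 := (hFG (SPoint.pt s)).1 (zero_mem_redSet h0O₁ (SPoint.pt s))
    rwa [expCoord_zero h h0O] at h2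

end ExpMap

end

end SuperGeometry

end

theorem mainTheorem9 {s m n : ℕ} (M : Supermanifold.{u} s m n)
    [T2Space (M.pts.obj (SPoint.pt s))] (g : RiemannianMetric M) :
    (∃ nabla : Connection M, nabla.IsLeviCivita g) ∧
    ∀ nabla : Connection M, nabla.IsLeviCivita g →
    ∀ p : M.pts.obj (SPoint.base s),
      -- existence and uniqueness of geodesics
      (∀ (C : SPoint s) (v : Supermanifold.TangentVec p C),
        ∃ T > (0 : ℝ), ∃ γ : ℝ → M.pts.obj C,
          nabla.IsGeodesicFrom (Set.Ioo (-T) T) p v γ ∧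
          ∀ γ' : ℝ → M.pts.obj C, nabla.IsGeodesicFrom (Set.Ioo (-T) T) p v γ' →
            Set.EqOn γ' γ (Set.Ioo (-T) T)) ∧
      -- on every open interval around `0` the geodesic is unique, and it is defined there as soon
      -- as the reduced geodesic is
      (∀ (C : SPoint s) (v : Supermanifold.TangentVec p C) (I : Set ℝ),
        IsOpen I → I.OrdConnected → (0 : ℝ) ∈ I →
        (∀ γ γ' : ℝ → M.pts.obj C, nabla.IsGeodesicFrom I p v γ →
          nabla.IsGeodesicFrom I p v γ' → Set.EqOn γ γ' I) ∧
        ((∃ γ : ℝ → M.pts.obj C, nabla.IsGeodesicFrom I p v γ) ↔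
          ∃ γ : ℝ → M.pts.obj (SPoint.pt s),
            nabla.IsGeodesicFrom I p (Supermanifold.TangentVec.map p C.toPt v) γ)) ∧
      -- the exponential map
      ∃ (U : Set ((Supermanifold.tangentAt p).pts.obj (SPoint.pt s)))
        (exp : ∀ C, (Supermanifold.tangentAt p).pts.obj C → M.pts.obj C),
        IsOpen U ∧ (0 : Supermanifold.TangentVec p (SPoint.pt s)) ∈ U ∧
        (∀ C, ∀ v ∈ (Supermanifold.tangentAt p).restrict U C,
          ∃ T > (1 : ℝ), ∃ γ : ℝ → M.pts.obj C,
            nabla.IsGeodesicFrom (Set.Ioo (-T) T) p v γ ∧ γ 1 = exp C v) ∧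
        Supermanifold.IsMorphismOn U exp ∧
        ∃ U' ⊆ U, IsOpen U' ∧ (0 : Supermanifold.TangentVec p (SPoint.pt s)) ∈ U' ∧
          ∃ W : Set (M.pts.obj (SPoint.pt s)), IsOpen W ∧
            Supermanifold.at_ p (SPoint.pt s) ∈ W ∧
            Supermanifold.IsIsomorphismOn U' W exp := by
  -- Of the equivalence, one direction restricts a geodesic along `C.toPt`; the other is
  -- continuation along the reduced geodesic.
  refine ⟨⟨g.leviCivita, g.isLeviCivita_leviCivita⟩, fun nabla _ p => ⟨fun C v => ?_,
    fun C v I hI hIc h0 => ⟨fun γ γ' h h' => h.eqOn h' hI hIc h0,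
      fun ⟨γ, h⟩ => ⟨_, h.map hI h0 C.toPt⟩,
      fun ⟨γ, h⟩ => exists_isGeodesicFrom_of_reduced hI hIc h0 h⟩,
    exists_exponentialMap nabla p⟩⟩
  obtain ⟨T, hT, γ, hγ⟩ := exists_isGeodesicFrom nabla v
  exact ⟨T, hT, γ, hγ, fun γ' hγ' => hγ'.eqOn hγ isOpen_Ioo Set.ordConnected_Ioo
    ⟨by linarith, hT⟩⟩
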